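/- **Setting.** Let $d\ge 1$ and let $\Omega\subset\mathbb R^d$ be a nonempty open bounded connected polyhedral set (its boundary is a finite union of parts of hyperplanes, and $\Omega$ is the interior of its closure). Let $\Lambda:\Omega\to\mathcal M_d(\mathbb R)$ be measurable, such that for a.e. $x\in\Omega$ the matrix $\Lambda(x)$ is symmetric with eigenvalues in $[\underline\lambda,\overline\lambda]$, $0<\underline\lambda\le\overline\lambda$ (no continuity or isotropy is assumed), and let $f\in L^2(\Omega)$. A weak solution is a function $u\in H^1_0(\Omega)$ with $\int_\Omega\Lambda\nabla u\cdot\nabla v\,dx=\int_\Omega fv\,dx$ for all $v\in H^1_0(\Omega)$. **Discretisations.** A discretisation $\mathcal D=(\mathcal M,\mathcal E,\mathcal P)$ of $\Omega$ consists of: (i) a finite family $\mathcal M$ of nonempty connected open disjoint subsets $K$ of $\Omega$ with $\overline\Omega=\bigcup_{K}\overline K$; (ii) a finite family $\mathcal E$ of disjoint subsets $\sigma$ of $\overline\Omega$, each a nonempty relatively open subset of a hyperplane, with positive $(d-1)$-dimensional measure $|\sigma|$ and with relative boundary $\overline\sigma\setminus\sigma$ of $(d-1)$-dimensional measure zero,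 together with sets $\mathcal E_K\subset\mathcal E$ such that $\partial K=\bigcup_{\sigma\in\mathcal E_K}\overline\sigma$ and such that, with $\mathcal M_\sigma=\{K:\sigma\in\mathcal E_K\}$, for every $\sigma$ either $\mathcal M_\sigma$ has exactly one element and $\sigma\subset\partial\Omega$ ($\sigma\in\mathcal E_{\rm ext}$), or $\mathcal M_\sigma$ has exactly two elements ($\sigma\in\mathcal E_{\rm int}$); (iii) points $x_K\in K$ such that $K$ is star-shaped with respect to $x_K$ and the distance $d_{K,\sigma}$ from $x_K$ to the hyperplane containing $\sigma$ is positive for all $\sigma\in\mathcal E_K$. Let $|K|$ and $h_K$ be the measure and the diameter of $K$, $x_\sigma$ the barycentre of $\sigma$, $n_{K,\sigma}$ the unit normal to $\sigma$ outward to $K$, $D_{K,\sigma}$ the cone with vertex $x_K$ and basis $\sigma$, and $h_{\mathcal D}=\max_K h_K$. Given $\mathcal B\subset\mathcal E_{\rm int}$ and real numbers $(\beta_\sigma^K)_{\sigma\in\mathcal B,K\in\mathcal M}$, set $$\theta_{\mathcal D,\mathcal B}=\max\Big(\max_{\sigma\in\mathcal E_{\rm int},\,K,L\in\mathcal M_\sigma}\frac{d_{K,\sigma}}{d_{L,\sigma}},\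 \max_{K,\,\sigma\in\mathcal E_K}\frac{h_K}{d_{K,\sigma}},\ \max_{K,\,\sigma\in\mathcal E_K\cap\mathcal B}\frac{\sum_{L}|\beta_\sigma^L||x_L-x_\sigma|^2}{h_K^2}\Big).$$ **Discrete spaces and operators.** $X_{\mathcal D}$ is the space of all $v=((v_K)_{K\in\mathcal M},(v_\sigma)_{\sigma\in\mathcal E})$, $X_{\mathcal D,0}=\{v\in X_{\mathcal D}: v_\sigma=0\ \forall\sigma\in\mathcal E_{\rm ext}\}$, and $X_{\mathcal D,\mathcal B}=\{v\in X_{\mathcal D,0}: v_\sigma=\sum_K\beta_\sigma^Kv_K\ \forall\sigma\in\mathcal B\}$. Put $|v|_X^2=\sum_K\sum_{\sigma\in\mathcal E_K}\frac{|\sigma|}{d_{K,\sigma}}(v_\sigma-v_K)^2$; $\Pi_{\mathcal M}v=v_K$ on $K$; $P_{\mathcal D}\varphi=((\varphi(x_K))_K,(\varphi(x_\sigma))_\sigma)$. The discrete gradient $\nabla_{\mathcal D}v$ equals on $D_{K,\sigma}$ the constant $\nabla_Kv+R_{K,\sigma}v\,n_{K,\sigma}$, where $$\nabla_Kv=\frac1{|K|}\sum_{\sigma\in\mathcal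 E_K}|\sigma|(v_\sigma-v_K)n_{K,\sigma},\qquad R_{K,\sigma}v=\frac{\sqrt d}{d_{K,\sigma}}\big(v_\sigma-v_K-\nabla_Kv\cdot(x_\sigma-x_K)\big).$$ **Fluxes.** Let $\mathcal F$ be a family of discretisations of $\Omega$. A family of fluxes consists of linear maps $F^{\mathcal D}_{K,\sigma}:X_{\mathcal D}\to\mathbb R$ ($\mathcal D\in\mathcal F$, $K\in\mathcal M$, $\sigma\in\mathcal E$); put $\langle u,v\rangle_F=\sum_K\sum_{\sigma\in\mathcal E_K}F^{\mathcal D}_{K,\sigma}(u)(v_K-v_\sigma)$. The family is *continuous* if for some $M>0$, $\langle u,v\rangle_F\le M|u|_X|v|_X$ for all $\mathcal D\in\mathcal F$, $u,v\in X_{\mathcal D}$; *coercive* if for some $\alpha>0$, $\alpha|u|_X^2\le\langle u,u\rangle_F$ for all $\mathcal D\in\mathcal F$, $u\in X_{\mathcal D}$; *symmetric* if $\langle u,v\rangle_F=\langle v,u\rangle_F$ for all $\mathcal D\in\mathcal F$, $u,v\in X_{\mathcal D}$; *consistent* if, for every family $w_{\mathcal D}\in X_{\mathcal D,0}$ $(\mathcal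 D\in\mathcal F)$ with $\sup_{\mathcal D}|w_{\mathcal D}|_X<\infty$ and every $w\in H^1_0(\Omega)$ with $\Pi_{\mathcal M}w_{\mathcal D}\to w$ in $L^2(\Omega)$ as $h_{\mathcal D}\to0$, one has $\langle w_{\mathcal D},P_{\mathcal D}\varphi\rangle_F\to\int_\Omega\Lambda\nabla\varphi\cdot\nabla w\,dx$ as $h_{\mathcal D}\to0$ for all $\varphi\in C_c^\infty(\Omega)$. **Theorem (Convergence).** Let $\mathcal F$ be a family of discretisations of $\Omega$ and, for each $\mathcal D\in\mathcal F$, let $\mathcal B\subset\mathcal E_{\rm int}$ and $(\beta_\sigma^K)$ satisfy $\sum_K\beta_\sigma^K=1$ and $x_\sigma=\sum_K\beta_\sigma^Kx_K$ for all $\sigma\in\mathcal B$. Assume that there is $\theta>0$ with $\theta_{\mathcal D,\mathcal B}\le\theta$ for all $\mathcal D\in\mathcal F$, and let $(F^{\mathcal D}_{K,\sigma})$ be a continuous, coercive, symmetric and consistent family of fluxes. Then for each $\mathcal D\in\mathcal F$ there is exactly one $u_{\mathcal D}\in X_{\mathcal D,\mathcal B}$ such that $$\langle u_{\mathcal D},v\rangle_F=\sum_{K\in\mathcal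 M}v_K\int_Kf\,dx\qquad\forall v\in X_{\mathcal D,\mathcal B},$$ there is exactly one weak solution $u\in H^1_0(\Omega)$ of $-\mathrm{div}(\Lambda\nabla u)=f$, and, as $h_{\mathcal D}\to0$, $\Pi_{\mathcal M}u_{\mathcal D}\to u$ in $L^2(\Omega)$ and $\nabla_{\mathcal D}u_{\mathcal D}\to\nabla u$ in $L^2(\Omega)^d$. -/

import Mathlib

open MeasureTheory Filter Topology Set

open scoped RealInnerProductSpace ContDiff ENNReal

noncomputable section

namespace HybridFV

/-- Euclidean space of dimension `d`. -/
abbrev Eucl (d : ℕ) := EuclideanSpace ℝ (Fin d)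

variable {d : ℕ}

/-! ### Hyperplanes, polyhedral sets -/

/-- The hyperplane of equation `ν · x = c` (for `ν ≠ 0`). -/
def hyperplane (ν : Eucl d) (c : ℝ) : Set (Eucl d) := {x | ⟪ν, x⟫ = c}

/-- The `(d-1)`-dimensional Lebesgue measure on the hyperplane `ν · x = c`, for a unit vector `ν`,
as a measure on the whole space: the image, under `y ↦ c ν + y`, of the Lebesgue measure of the
Euclidean space `ν^⊥` (the Haar measure that gives mass `1` to the unit cube spanned by an
orthonormal basis). In dimension `d = 1` it is the unit mass at the point `c ν`. -/
def hyperplaneMeasure (ν : Eucl d) (c : ℝ) : Measure (Eucl d) :=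
  ((stdOrthonormalBasis ℝ (Submodule.span ℝ {ν})ᗮ).toBasis.addHaar).map
    (fun y : (Submodule.span ℝ {ν})ᗮ => c • ν + (y : Eucl d))

/-- Polyhedral open sets: the boundary is a finite union of parts of hyperplanes, and the set has no
slit or puncture (it is the interior of its closure). -/
def IsPolyhedral (Ω : Set (Eucl d)) : Prop :=
  interior (closure Ω) = Ω ∧
    ∃ s : Finset (Eucl d × ℝ), (∀ p ∈ s, p.1 ≠ 0) ∧ frontier Ω ⊆ ⋃ p ∈ s, hyperplane p.1 p.2

/-! ### The space `H¹₀(Ω)` and the continuous problem -/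

/-- Test functions: elements of `C_c^∞(Ω)`, extended by `0`. -/
def IsTestFunction (Ω : Set (Eucl d)) (φ : Eucl d → ℝ) : Prop :=
  ContDiff ℝ ∞ φ ∧ HasCompactSupport φ ∧ tsupport φ ⊆ Ω

/-- `G` is the weak gradient of `u` on `Ω`. -/
def HasWeakGradient (Ω : Set (Eucl d)) (u : Eucl d → ℝ) (G : Eucl d → Eucl d) : Prop :=
  ∀ φ : Eucl d → ℝ, IsTestFunction Ω φ → ∀ e : Eucl d,
    ∫ x in Ω, u x * ⟪gradient φ x, e⟫ = - ∫ x in Ω, ⟪G x, e⟫ * φ x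

/-- `u ∈ H¹₀(Ω)` with (weak) gradient `G`: `u` belongs to `H¹(Ω)` with weak gradient `G`, and it is a
limit in `H¹(Ω)` of elements of `C_c^∞(Ω)`. -/
structure MemH10 (Ω : Set (Eucl d)) (u : Eucl d → ℝ) (G : Eucl d → Eucl d) : Prop where
  memLp : MemLp u 2 (volume.restrict Ω)
  memLp_grad : MemLp G 2 (volume.restrict Ω)
  weak : HasWeakGradient Ω u G
  approx : ∃ φ : ℕ → Eucl d → ℝ, (∀ n, IsTestFunction Ω (φ n)) ∧
    Tendsto (fun n => eLpNorm (fun x => φ n x - u x) 2 (volume.restrict Ω)) atTop (𝓝 0) ∧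
    Tendsto (fun n => eLpNorm (fun x => gradient (φ n) x - G x) 2 (volume.restrict Ω)) atTop (𝓝 0)

/-- The diffusion tensor: measurable, symmetric a.e., with eigenvalues in `[lo, hi]` a.e. -/
structure IsDiffusionTensor (Ω : Set (Eucl d)) (Λ : Eucl d → Matrix (Fin d) (Fin d) ℝ)
    (lo hi : ℝ) : Prop where
  measurable : ∀ i j, AEMeasurable (fun x => Λ x i j) (volume.restrict Ω)
  symm : ∀ᵐ x ∂(volume.restrict Ω), (Λ x).IsSymm
  spectrum_subset : ∀ᵐ x ∂(volume.restrict Ω), spectrum ℝ (Λ x) ⊆ Icc lo hi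

/-- `∫_Ω Λ G · H`. -/
def energy (Ω : Set (Eucl d)) (Λ : Eucl d → Matrix (Fin d) (Fin d) ℝ) (G H : Eucl d → Eucl d) : ℝ :=
  ∫ x in Ω, ⟪Matrix.toEuclideanLin (Λ x) (G x), H x⟫

/-- `u ∈ H¹₀(Ω)`, with gradient `G`, is a weak solution of `-div (Λ ∇u) = f` in `Ω`, `u = 0` on the
boundary. -/
def IsWeakSolution (Ω : Set (Eucl d)) (Λ : Eucl d → Matrix (Fin d) (Fin d) ℝ) (f : Eucl d → ℝ)
    (u : Eucl d → ℝ) (G : Eucl d → Eucl d) : Prop :=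
  MemH10 Ω u G ∧
    ∀ (v : Eucl d → ℝ) (H : Eucl d → Eucl d), MemH10 Ω v H →
      energy Ω Λ G H = ∫ x in Ω, f x * v x

/-! ### Space discretisations -/

/-- A discretisation of `Ω`: control volumes, interfaces ("edges") and one point per control volume.
The control volumes and the interfaces are indexed by finite types. A unit normal `normal σ` and the
number `offset σ` describe the hyperplane that contains the interface `σ`. -/
structure Discretisation (Ω : Set (Eucl d)) where
  /-- indices of the control volumes -/
  Vol : Type
  /-- indices of the interfaces -/
  Edge : Type
  [fintypeVol : Fintype Vol]
  [fintypeEdge : Fintype Edge]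
  /-- the control volume `K` -/
  cell : Vol → Set (Eucl d)
  /-- the interface `σ` -/
  face : Edge → Set (Eucl d)
  /-- the set `E_K` of the interfaces of `K` -/
  edges : Vol → Finset Edge
  /-- the point `x_K` -/
  center : Vol → Eucl d
  /-- a unit vector orthogonal to `σ` -/
  normal : Edge → Eucl d
  /-- the constant in the equation `normal σ · x = offset σ` of the hyperplane of `σ` -/
  offset : Edge → ℝ
  cell_nonempty : ∀ K, (cell K).Nonempty
  cell_connected : ∀ K, IsConnected (cell K)
  cell_open : ∀ K, IsOpen (cell K)
  cell_subset : ∀ K, cell K ⊆ Ω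
  cell_disjoint : ∀ K L, K ≠ L → Disjoint (cell K) (cell L)
  closure_eq : closure Ω = ⋃ K, closure (cell K)
  face_subset : ∀ σ, face σ ⊆ closure Ω
  face_disjoint : ∀ σ τ, σ ≠ τ → Disjoint (face σ) (face τ)
  face_nonempty : ∀ σ, (face σ).Nonempty
  norm_normal : ∀ σ, ‖normal σ‖ = 1
  face_relOpen : ∀ σ, ∃ U : Set (Eucl d), IsOpen U ∧ face σ = U ∩ hyperplane (normal σ) (offset σ)
  face_measure_pos : ∀ σ, 0 < hyperplaneMeasure (normal σ) (offset σ) (face σ)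
  /-- the relative boundary of an interface is negligible in its hyperplane -/
  face_boundary_null : ∀ σ, hyperplaneMeasure (normal σ) (offset σ) (closure (face σ) \ face σ) = 0
  frontier_cell : ∀ K, frontier (cell K) = ⋃ σ ∈ edges K, closure (face σ)
  /-- either `M_σ` has one element, and then `σ` lies on the boundary, or it has two elements -/
  neighbours : ∀ σ, ({K | σ ∈ edges K}.ncard = 1 ∧ face σ ⊆ frontier Ω) ∨
    {K | σ ∈ edges K}.ncard = 2
  center_mem : ∀ K, center K ∈ cell K
  starShaped : ∀ K, StarConvex ℝ (center K) (cell K)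
  dist_pos : ∀ K, ∀ σ ∈ edges K,
    0 < Metric.infDist (center K) (hyperplane (normal σ) (offset σ))

namespace Discretisation

attribute [instance] Discretisation.fintypeVol Discretisation.fintypeEdge

variable {Ω : Set (Eucl d)} (D : Discretisation Ω)

/-- The set `M_σ` of the control volumes that have `σ` as an interface. -/
def nbr (σ : D.Edge) : Set D.Vol := {K | σ ∈ D.edges K}

/-- Interior interfaces. -/
def intEdges : Set D.Edge := {σ | (D.nbr σ).ncard = 2}

/-- Boundary interfaces. -/
def extEdges : Set D.Edge := {σ | (D.nbr σ).ncard = 1}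

/-- The measure `|K|`. -/
def vol (K : D.Vol) : ℝ := volume.real (D.cell K)

/-- The `(d-1)`-dimensional measure `|σ|`. -/
def area (σ : D.Edge) : ℝ := (hyperplaneMeasure (D.normal σ) (D.offset σ)).real (D.face σ)

/-- The barycentre `x_σ` of `σ`. -/
def bary (σ : D.Edge) : Eucl d :=
  ⨍ x in D.face σ, x ∂(hyperplaneMeasure (D.normal σ) (D.offset σ))

/-- The distance `d_{K,σ}` from `x_K` to the hyperplane of `σ`. -/
def dist (K : D.Vol) (σ : D.Edge) : ℝ :=
  Metric.infDist (D.center K) (hyperplane (D.normal σ) (D.offset σ))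

open Classical in
/-- The unit normal `n_{K,σ}` to `σ ∈ E_K` outward to `K`. As `K` is star-shaped with respect to
`x_K`, which is not in the hyperplane of `σ`, it is the one that points away from `x_K`. -/
def outNormal (K : D.Vol) (σ : D.Edge) : Eucl d :=
  if ⟪D.normal σ, D.center K⟫ < D.offset σ then D.normal σ else - D.normal σ

/-- The cone `D_{K,σ}` with vertex `x_K` and basis `σ`. -/
def cone (K : D.Vol) (σ : D.Edge) : Set (Eucl d) :=
  {x | ∃ y ∈ D.face σ, ∃ t ∈ Ioo (0 : ℝ) 1, x = D.center K + t • (y - D.center K)}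

/-- The diameter `h_K`. -/
def diam (K : D.Vol) : ℝ := Metric.diam (D.cell K)

/-- The size `h_D` of the discretisation. -/
def size : ℝ := ⨆ K, D.diam K

/-- The regularity `θ_D` of the mesh (a maximum over finite sets of nonnegative numbers). -/
def theta : ℝ :=
  max
    (⨆ p : {p : D.Edge × D.Vol × D.Vol //
        p.1 ∈ D.intEdges ∧ p.2.1 ∈ D.nbr p.1 ∧ p.2.2 ∈ D.nbr p.1},
      D.dist p.1.2.1 p.1.1 / D.dist p.1.2.2 p.1.1)
    (⨆ p : {p : D.Vol × D.Edge // p.2 ∈ D.edges p.1}, D.diam p.1.1 / D.dist p.1.1 p.1.2)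

/-- The regularity `θ_{D,B}` of the mesh and of the barycentric coefficients. -/
def thetaB (B : Set D.Edge) (β : D.Edge → D.Vol → ℝ) : ℝ :=
  max D.theta
    (⨆ p : {p : D.Vol × D.Edge // p.2 ∈ D.edges p.1 ∧ p.2 ∈ B},
      (∑ L, |β p.1.2 L| * ‖D.center L - D.bary p.1.2‖ ^ 2) / D.diam p.1.1 ^ 2)

/-- The coefficients `β` express the barycentres of the elements of `B` as barycentric combinations
of the points `x_K`. -/
def IsBarycentric (B : Set D.Edge) (β : D.Edge → D.Vol → ℝ) : Prop :=
  ∀ σ ∈ B, ∑ K, β σ K = 1 ∧ D.bary σ = ∑ K, β σ K • D.center K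

/-- The space `X_D` of the discrete unknowns `((v_K)_K, (v_σ)_σ)`. -/
abbrev X : Type := (D.Vol → ℝ) × (D.Edge → ℝ)

/-- Membership in `X_{D,0}`. -/
def MemX0 (v : D.X) : Prop := ∀ σ ∈ D.extEdges, v.2 σ = 0

/-- Membership in `X_{D,B}`. -/
def MemXB (B : Set D.Edge) (β : D.Edge → D.Vol → ℝ) (v : D.X) : Prop :=
  D.MemX0 v ∧ ∀ σ ∈ B, v.2 σ = ∑ K, β σ K * v.1 K

/-- The semi-norm `|v|_X`. -/
def normX (v : D.X) : ℝ :=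
  √(∑ K, ∑ σ ∈ D.edges K, D.area σ / D.dist K σ * (v.2 σ - v.1 K) ^ 2)

/-- The piecewise constant function `Π_M v`. -/
def piM (v : D.X) : Eucl d → ℝ := fun x => ∑ K, (D.cell K).indicator (fun _ => v.1 K) x

/-- The interpolation `P_D φ`. -/
def interp (φ : Eucl d → ℝ) : D.X := (fun K => φ (D.center K), fun σ => φ (D.bary σ))

/-- The cell gradient `∇_K u`. -/
def gradCell (u : D.X) (K : D.Vol) : Eucl d :=
  (D.vol K)⁻¹ • ∑ σ ∈ D.edges K, (D.area σ * (u.2 σ - u.1 K)) • D.outNormal K σ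

/-- The stabilisation `R_{K,σ} u`. -/
def stab (u : D.X) (K : D.Vol) (σ : D.Edge) : ℝ :=
  √(d : ℝ) / D.dist K σ * (u.2 σ - u.1 K - ⟪D.gradCell u K, D.bary σ - D.center K⟫)

/-- The stabilised gradient `∇_{K,σ} u`. -/
def gradCone (u : D.X) (K : D.Vol) (σ : D.Edge) : Eucl d :=
  D.gradCell u K + D.stab u K σ • D.outNormal K σ

/-- The discrete gradient `∇_D u`, equal to `∇_{K,σ} u` in the cone `D_{K,σ}`. -/
def grad (u : D.X) : Eucl d → Eucl d := fun x =>
  ∑ K, ∑ σ ∈ D.edges K, (D.cone K σ).indicator (fun _ => D.gradCone u K σ) x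

/-- The bilinear form `⟨u, v⟩_F` of a family `F` of linear fluxes. -/
def fluxForm (F : D.Vol → D.Edge → (D.X →ₗ[ℝ] ℝ)) (u v : D.X) : ℝ :=
  ∑ K, ∑ σ ∈ D.edges K, F K σ u * (v.1 K - v.2 σ)

/-- `u` is a solution of the scheme: `u ∈ X_{D,B}` and
`⟨u, v⟩_F = ∑_K v_K ∫_K f` for all `v ∈ X_{D,B}`. -/
def IsSchemeSolution (B : Set D.Edge) (β : D.Edge → D.Vol → ℝ)
    (F : D.Vol → D.Edge → (D.X →ₗ[ℝ] ℝ)) (f : Eucl d → ℝ) (u : D.X) : Prop :=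
  D.MemXB B β u ∧
    ∀ v : D.X, D.MemXB B β v → D.fluxForm F u v = ∑ K, v.1 K * ∫ x in D.cell K, f x

end Discretisation

/-! ### Families of discretisations and of fluxes -/

section Families

variable {Ω : Set (Eucl d)} {ι : Type*} (D : ι → Discretisation Ω)

/-- The filter "`h_D → 0`" on the index set of a family of discretisations. -/
def sizeToZero : Filter ι := comap (fun i => (D i).size) (𝓝 0)

/-- A family of numerical fluxes: linear maps `F_{K,σ} : X_D → ℝ` for all `D` of the family. -/
abbrev FluxFamily : Type _ :=
  ∀ i, (D i).Vol → (D i).Edge → ((D i).X →ₗ[ℝ] ℝ)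

variable {D}

/-- Continuous families of fluxes. -/
def FluxFamily.IsContinuous (F : FluxFamily D) : Prop :=
  ∃ M : ℝ, 0 < M ∧ ∀ i, ∀ u v : (D i).X,
    (D i).fluxForm (F i) u v ≤ M * (D i).normX u * (D i).normX v

/-- Coercive families of fluxes. -/
def FluxFamily.IsCoercive (F : FluxFamily D) : Prop :=
  ∃ α : ℝ, 0 < α ∧ ∀ i, ∀ u : (D i).X, α * (D i).normX u ^ 2 ≤ (D i).fluxForm (F i) u u

/-- Symmetric families of fluxes. -/
def FluxFamily.IsSymmetric (F : FluxFamily D) : Prop :=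
  ∀ i, ∀ u v : (D i).X, (D i).fluxForm (F i) u v = (D i).fluxForm (F i) v u

/-- Consistent families of fluxes: for every bounded family `u_D ∈ X_{D,0}` such that `Π_M u_D` tends
in `L²(Ω)` to some `u` (an element of `H¹₀(Ω)`, with gradient `G`), the form `⟨u_D, P_D φ⟩_F` tends to
`∫_Ω Λ ∇φ · ∇u` for all test functions `φ`. -/
def FluxFamily.IsConsistent (F : FluxFamily D) (Λ : Eucl d → Matrix (Fin d) (Fin d) ℝ) : Prop :=
  ∀ (w : ∀ i, (D i).X) (u : Eucl d → ℝ) (G : Eucl d → Eucl d),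
    (∀ i, (D i).MemX0 (w i)) →
    (∃ C : ℝ, 0 < C ∧ ∀ i, (D i).normX (w i) ≤ C) →
    MemH10 Ω u G →
    Tendsto (fun i => eLpNorm (fun x => (D i).piM (w i) x - u x) 2 (volume.restrict Ω))
      (sizeToZero D) (𝓝 0) →
    ∀ φ : Eucl d → ℝ, IsTestFunction Ω φ →
      Tendsto (fun i => (D i).fluxForm (F i) (w i) ((D i).interp φ)) (sizeToZero D)
        (𝓝 (energy Ω Λ (gradient φ) G))

end Families

end HybridFV

end

namespace HybridFV

variable {d : ℕ}

/-! ### Integration over slices and cones -/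

/-! The engine is a discrete Stokes formula. A star-shaped polyhedral cell satisfies the divergence
theorem (`IsStarCell.integral_fderiv_eq_of_hasCompactSupport`), and the outward normals of two cells
at a common face are opposite. Summing over the cells moves a derivative from a smooth function to
the jumps `v_K - v_σ` (`Discretisation.sum_mul_integral_fderiv`), and Cauchy–Schwarz bounds these
jumps by `|v|_X`. This one formula yields, with no regularity of the mesh, the discrete Poincaré
inequality (`sum_vol_mul_sq_le`), uniform continuity of translates in `L²`
(`lintegral_translate_sub_sq_le`) and an asymptotic bound of weak derivatives
(`abs_integral_piM_mul_fderiv_le`).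

Solvability and stability: coercivity and Poincaré make the flux form definite on a
finite-dimensional space, so the scheme is uniquely solvable; testing with the solution bounds
`|u_D|_X` uniformly. The continuous problem is solved by Lax–Milgram in the `H¹` closure of the test
functions.

Compactness: bounded discrete functions, extended by zero, are relatively compact in `L²` by
Kolmogorov–Riesz. A limit along `h → 0` vanishes outside `Ω` and has Lipschitz translates in `L²`.
To see that it lies in `H¹₀(Ω)`, polyhedrality is used: near the boundary `Ω` is left along one of
finitely many directions, so the mass of the limit in a boundary strip of width `r` is `O(r²)`.
Cutting off at scale `r` and mollifying then gives test functions bounded in `H¹`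
(`exists_testFunction_tendsto`), and weak compactness concludes.

Identification of the limit: the interpolant of a test function is corrected to lie in `X_{D,B}`.
Since the coefficients `β` are barycentric, the correction is of second order on the faces and
`O(h)` in `|·|_X`. Consistency and the scheme then give the weak formulation against test functions,
hence against all of `H¹₀`. Uniqueness of the weak solution upgrades subsequences to the whole
family.

Strong convergence of gradients: for a test function `φ` close to `u`, coercivity and symmetry bound
`α |u_D - P φ|²` by `⟨u_D,u_D⟩ - 2⟨u_D,Pφ⟩ + ⟨Pφ,Pφ⟩`, with `Pφ` the corrected interpolant. This
tends to the `Λ`-energy of `u - φ`, which is small (`exists_tendsto_energy_bound`). The discrete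
gradient is bounded by `|·|_X` and converges on interpolants because it is exact on affine
functions, so a triangle inequality finishes. -/

theorem lintegral_comp_smul_add {V : Type*} [NormedAddCommGroup V] [NormedSpace ℝ V]
    [MeasurableSpace V] [BorelSpace V] [FiniteDimensional ℝ V] (μ : Measure V)
    [μ.IsAddHaarMeasure] (F : V → ℝ≥0∞) (hF : Measurable F) {r : ℝ} (hr : 0 < r) (b : V) :
    ∫⁻ x, F x ∂μ = ENNReal.ofReal (r ^ Module.finrank ℝ V) * ∫⁻ x, F (r • x + b) ∂μ := by
  have h1 : ∫⁻ x, F (r • x + b) ∂μ = ∫⁻ x, F (x + b) ∂(Measure.map (fun x => r • x) μ) := by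
    rw [lintegral_map]
    · exact hF.comp (measurable_id.add_const b)
    · exact measurable_const_smul r
  rw [h1, Measure.map_addHaar_smul μ hr.ne', lintegral_smul_measure,
    lintegral_add_right_eq_self (μ := μ) (fun x => F x) b, smul_eq_mul, ← mul_assoc,
    ← ENNReal.ofReal_mul (by positivity), abs_of_pos (by positivity), mul_inv_cancel₀ (by positivity)]
  simp

/-- Fubini for the orthogonal sum of a line and its complement. The line is identified isometrically
with `ℝ` through the unit vector, so no Jacobian appears. -/
theorem lintegral_eq_lintegral_orthogonal (n : Eucl d) (hn : ‖n‖ = 1) (F : Eucl d → ℝ≥0∞)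
    (hF : Measurable F) :
    ∫⁻ x, F x = ∫⁻ s : ℝ, ∫⁻ y : (Submodule.span ℝ {n})ᗮ, F (s • n + (y : Eucl d)) := by
  set S := Submodule.span ℝ {n}
  have h1 : MeasurePreserving ((fun p : S × Sᗮ => ((p.1 : Eucl d) + (p.2 : Eucl d)))) := by
    have h := (S.orthogonalDecomposition.symm.measurePreserving).comp
      (WithLp.volume_preserving_toLp S Sᗮ)
    convert h using 1
    ext p
    simp
  let f : ℝ ≃ₗᵢ[ℝ] S := LinearIsometryEquiv.toSpanUnitSingleton n hn
  have hm : Measurable (fun p : S × Sᗮ => ((p.1 : Eucl d) + (p.2 : Eucl d))) := h1.measurable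
  rw [← h1.lintegral_comp hF]
  erw [lintegral_prod _ (hF.comp hm).aemeasurable]
  have := f.measurePreserving.lintegral_comp_emb f.toHomeomorph.measurableEmbedding
    (fun x : S => ∫⁻ y : Sᗮ, F ((x : Eucl d) + (y : Eucl d)))
  exact this.symm

/-- The union of the half-open segments between `c` and the points of `A`. -/
def coneSet (c : Eucl d) (A : Set (Eucl d)) : Set (Eucl d) :=
  {x | ∃ y ∈ A, ∃ t ∈ Ioo (0 : ℝ) 1, x = c + t • (y - c)}

theorem hyperplaneMeasure_eq_map (n : Eucl d) (c : ℝ) :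
    hyperplaneMeasure n c = (volume : Measure (Submodule.span ℝ {n})ᗮ).map
      (fun y : (Submodule.span ℝ {n})ᗮ => c • n + (y : Eucl d)) := by
  rw [hyperplaneMeasure, OrthonormalBasis.addHaar_eq_volume]

/-- A hyperplane has two unit normals. This allows the normal fixed in the data of a face to be
replaced by the one that is outward to a given cell. -/
theorem hyperplaneMeasure_neg (n : Eucl d) (c : ℝ) :
    hyperplaneMeasure (-n) (-c) = hyperplaneMeasure n c := by
  -- The two spans are equal but not definitionally so, and the measures live on them as types.
  -- Stating the claim for arbitrary submodules lets the equality be eliminated.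
  have key : ∀ (S T : Submodule ℝ (Eucl d)) (p : Eucl d), S = T →
      (volume : Measure S).map (fun y : S => p + (y : Eucl d)) =
        (volume : Measure T).map (fun y : T => p + (y : Eucl d)) := by
    rintro S T p rfl; rfl
  rw [hyperplaneMeasure_eq_map, hyperplaneMeasure_eq_map, neg_smul_neg]
  apply key
  rw [← Set.neg_singleton, Submodule.span_neg]

/-- The base lies at height `δ` above the vertex, so the cone parameter of `x` can only be its
relative height. This explicit description gives measurability and openness of cones. -/
theorem mem_coneSet_iff {n c : Eucl d} {δ : ℝ} (hδ : 0 < δ) {A : Set (Eucl d)}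
    (hA : A ⊆ hyperplane n (⟪n, c⟫ + δ)) (x : Eucl d) :
    x ∈ coneSet c A ↔ ⟪n, x - c⟫ / δ ∈ Ioo (0 : ℝ) 1 ∧ c + (⟪n, x - c⟫ / δ)⁻¹ • (x - c) ∈ A := by
  constructor
  · rintro ⟨y, hy, t, ht, rfl⟩
    have h1 : ⟪n, y⟫ = ⟪n, c⟫ + δ := hA hy
    have h2 : ⟪n, c + t • (y - c) - c⟫ / δ = t := by
      rw [add_sub_cancel_left, inner_smul_right, inner_sub_right, h1]; field_simp; ring
    rw [h2]
    refine ⟨ht, ?_⟩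
    rw [add_sub_cancel_left, smul_smul, inv_mul_cancel₀ ht.1.ne', one_smul, add_sub_cancel]
    exact hy
  · rintro ⟨h1, h2⟩
    refine ⟨_, h2, _, h1, ?_⟩
    rw [add_sub_cancel_left, smul_smul, mul_inv_cancel₀ h1.1.ne', one_smul, add_sub_cancel]

theorem measurableSet_coneSet {n c : Eucl d} {δ : ℝ} (hδ : 0 < δ) {A : Set (Eucl d)}
    (hA : A ⊆ hyperplane n (⟪n, c⟫ + δ)) (hAm : MeasurableSet A) :
    MeasurableSet (coneSet c A) := by
  have : coneSet c A = {x | ⟪n, x - c⟫ / δ ∈ Ioo (0 : ℝ) 1 ∧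
      c + (⟪n, x - c⟫ / δ)⁻¹ • (x - c) ∈ A} := by
    ext x; exact mem_coneSet_iff hδ hA x
  rw [this]
  have hm : Measurable fun x : Eucl d => ⟪n, x - c⟫ / δ := by fun_prop
  exact (hm measurableSet_Ioo).inter
    ((measurable_const.add (hm.inv.smul (measurable_id.sub_const c))) hAm)

theorem lintegral_hyperplaneMeasure (n : Eucl d) (c : ℝ) (F : Eucl d → ℝ≥0∞)
    (hF : Measurable F) :
    ∫⁻ x, F x ∂(hyperplaneMeasure n c) =
      ∫⁻ y : (Submodule.span ℝ {n})ᗮ, F (c • n + (y : Eucl d)) := by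
  rw [hyperplaneMeasure_eq_map, lintegral_map hF]
  exact measurable_const.add measurable_subtype_coe

theorem finrank_orthogonal_span_singleton (n : Eucl d) (hn : ‖n‖ = 1) :
    Module.finrank ℝ (Submodule.span ℝ {n})ᗮ = d - 1 := by
  have h := (Submodule.span ℝ {n}).finrank_add_finrank_orthogonal
  have h2 : Module.finrank ℝ (Submodule.span ℝ {n}) = 1 :=
    finrank_span_singleton (by rintro rfl; simp at hn)
  rw [h2, finrank_euclideanSpace_fin] at h
  omega

/-- Slice orthogonally to `n`. At height `δ t` above the vertex the slice is the base contracted by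
`t` towards `c`; the factor `δ` comes from the height variable and `t ^ (d - 1)` from the slice. -/
theorem lintegral_coneSet {n c : Eucl d} (hn : ‖n‖ = 1) {δ : ℝ} (hδ : 0 < δ) {A : Set (Eucl d)}
    (hA : A ⊆ hyperplane n (⟪n, c⟫ + δ)) (hAm : MeasurableSet A) (F : Eucl d → ℝ≥0∞)
    (hF : Measurable F) :
    ∫⁻ x in coneSet c A, F x = ∫⁻ t in Ioo (0 : ℝ) 1, ENNReal.ofReal (δ * t ^ (d - 1)) *
      ∫⁻ y in A, F (c + t • (y - c)) ∂(hyperplaneMeasure n (⟪n, c⟫ + δ)) := by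
  have hC := measurableSet_coneSet hδ hA hAm
  set a := ⟪n, c⟫ with ha
  set S := Submodule.span ℝ {n} with hS
  have hFi : Measurable ((coneSet c A).indicator F) := hF.indicator hC
  rw [← lintegral_indicator hC, lintegral_eq_lintegral_orthogonal n hn _ hFi]
  have hG : Measurable fun s : ℝ => ∫⁻ y : Sᗮ, (coneSet c A).indicator F (s • n + (y : Eucl d)) := by
    apply Measurable.lintegral_prod_right'
      (f := fun p : ℝ × Sᗮ => (coneSet c A).indicator F (p.1 • n + (p.2 : Eucl d)))
    exact hFi.comp ((measurable_fst.smul_const n).add (measurable_subtype_coe.comp measurable_snd))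
  rw [lintegral_comp_smul_add volume _ hG hδ a, ← lintegral_const_mul _ (by
    exact hG.comp ((measurable_const_smul δ).add_const a)),
    ← lintegral_indicator measurableSet_Ioo]
  congr 1
  ext t
  have hpc : c - a • n ∈ Sᗮ := by
    rw [hS, Submodule.mem_orthogonal_singleton_iff_inner_right, inner_sub_right, inner_smul_right,
      real_inner_self_eq_norm_sq, hn, ha]
    ring
  have hyS : ∀ y : Sᗮ, ⟪n, (y : Eucl d)⟫ = 0 := fun y =>
    (Submodule.mem_orthogonal_singleton_iff_inner_right).1 y.2
  by_cases ht : t ∈ Ioo (0 : ℝ) 1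
  · rw [indicator_of_mem ht]
    have hm2 : Measurable fun y : Sᗮ =>
        (coneSet c A).indicator F ((δ • t + a) • n + (y : Eucl d)) :=
      hFi.comp (measurable_const.add measurable_subtype_coe)
    -- The vector `c - a • n` is the projection of `c` on `n^⊥`. Shifting by `1 - t` times it makes
    -- the dilation by `t` within the slice a homothety centred at `c`.
    rw [lintegral_comp_smul_add volume _ hm2 ht.1 ((1 - t) • (⟨c - a • n, hpc⟩ : Sᗮ)), ← mul_assoc,
      finrank_orthogonal_span_singleton n hn, Module.finrank_self, pow_one,
      ← ENNReal.ofReal_mul hδ.le]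
    congr 1
    rw [← lintegral_indicator hAm, lintegral_hyperplaneMeasure]
    · congr 1
      ext y
      have e1 : (δ • t + a) • n + ((t • y + (1 - t) • (⟨c - a • n, hpc⟩ : Sᗮ) : Sᗮ) : Eucl d) =
          c + t • ((a + δ) • n + (y : Eucl d) - c) := by
        simp only [Submodule.coe_add, Submodule.coe_smul, smul_eq_mul]
        module
      rw [e1]
      have e2 : c + t • ((a + δ) • n + (y : Eucl d) - c) ∈ coneSet c A ↔
          (a + δ) • n + (y : Eucl d) ∈ A := by
        constructor
        · intro h
          rw [mem_coneSet_iff hδ hA] at h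
          have e3 : ⟪n, c + t • ((a + δ) • n + (y : Eucl d) - c) - c⟫ / δ = t := by
            rw [add_sub_cancel_left, inner_smul_right, inner_sub_right, inner_add_right,
              inner_smul_right, real_inner_self_eq_norm_sq, hn, hyS, ← ha]
            field_simp; ring
          rw [e3, add_sub_cancel_left, smul_smul, inv_mul_cancel₀ ht.1.ne', one_smul,
            add_sub_cancel] at h
          exact h.2
        · intro h
          exact ⟨_, h, t, ht, rfl⟩
      by_cases h : (a + δ) • n + (y : Eucl d) ∈ A
      · rw [indicator_of_mem (e2.2 h), indicator_of_mem h]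
      · rw [indicator_of_notMem (fun h' => h (e2.1 h')), indicator_of_notMem h]
    · apply Measurable.indicator _ hAm
      exact hF.comp (by fun_prop)
  · rw [indicator_of_notMem ht]
    have : ∀ y : Sᗮ, (coneSet c A).indicator F ((δ • t + a) • n + (y : Eucl d)) = 0 := by
      intro y
      apply indicator_of_notMem
      rw [mem_coneSet_iff hδ hA]
      intro h
      apply ht
      have e3 : ⟪n, (δ • t + a) • n + (y : Eucl d) - c⟫ / δ = t := by
        rw [inner_sub_right, inner_add_right,
          inner_smul_right, real_inner_self_eq_norm_sq, hn, hyS, ← ha, smul_eq_mul]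
        field_simp; ring
      rw [e3] at h
      exact h.1
    rw [lintegral_congr this, lintegral_zero, mul_zero]

instance (n : Eucl d) (c : ℝ) : SFinite (hyperplaneMeasure n c) := by
  rw [hyperplaneMeasure_eq_map]; infer_instance

/-- Cone coordinates, as an equality of measures. -/
theorem restrict_coneSet_eq_map {n c : Eucl d} (hn : ‖n‖ = 1) {δ : ℝ} (hδ : 0 < δ)
    {A : Set (Eucl d)} (hA : A ⊆ hyperplane n (⟪n, c⟫ + δ)) (hAm : MeasurableSet A) :
    volume.restrict (coneSet c A) =
      (((volume.restrict (Ioo (0 : ℝ) 1)).withDensity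
        (fun t => ENNReal.ofReal (δ * t ^ (d - 1)))).prod
        ((hyperplaneMeasure n (⟪n, c⟫ + δ)).restrict A)).map
      (fun p : ℝ × Eucl d => c + p.1 • (p.2 - c)) := by
  have hΦ : Measurable (fun p : ℝ × Eucl d => c + p.1 • (p.2 - c)) := by fun_prop
  have hw : Measurable fun t : ℝ => ENNReal.ofReal (δ * t ^ (d - 1)) := by fun_prop
  apply Measure.ext_of_lintegral
  intro F hF
  rw [lintegral_coneSet hn hδ hA hAm F hF, lintegral_map hF hΦ,
    lintegral_prod (fun p : ℝ × Eucl d => F (c + p.1 • (p.2 - c))) (hF.comp hΦ).aemeasurable, lintegral_withDensity_eq_lintegral_mul _ hw]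
  · rfl
  · exact Measurable.lintegral_prod_right' (hF.comp hΦ)

theorem hyperplaneMeasure_lt_top_of_isBounded (n : Eucl d) (c : ℝ) {A : Set (Eucl d)}
    (hA : Bornology.IsBounded A) : hyperplaneMeasure n c A < ⊤ := by
  obtain ⟨R, hR⟩ := hA.subset_closedBall (c • n)
  refine (measure_mono hR).trans_lt ?_
  rw [hyperplaneMeasure_eq_map, Measure.map_apply (by fun_prop)
    Metric.isClosed_closedBall.measurableSet]
  refine (measure_mono ?_).trans_lt
    (measure_closedBall_lt_top (x := (0 : (Submodule.span ℝ {n})ᗮ)) (r := R))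
  intro y hy
  simpa [dist_eq_norm] using hy

theorem integral_coneSet {n c : Eucl d} (hn : ‖n‖ = 1) {δ : ℝ} (hδ : 0 < δ) {A : Set (Eucl d)}
    (hA : A ⊆ hyperplane n (⟪n, c⟫ + δ)) (hAm : MeasurableSet A) {F : Eucl d → ℝ}
    (hF : IntegrableOn F (coneSet c A)) (hFm : Measurable F) :
    ∫ x in coneSet c A, F x = ∫ t in (0 : ℝ)..1, δ * t ^ (d - 1) *
      ∫ y in A, F (c + t • (y - c)) ∂(hyperplaneMeasure n (⟪n, c⟫ + δ)) := by
  have hΦ : Measurable (fun p : ℝ × Eucl d => c + p.1 • (p.2 - c)) := by fun_prop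
  have hw : Measurable fun t : ℝ => Real.toNNReal (δ * t ^ (d - 1)) := by fun_prop
  rw [IntegrableOn, restrict_coneSet_eq_map hn hδ hA hAm] at hF
  rw [restrict_coneSet_eq_map hn hδ hA hAm, integral_map hΦ.aemeasurable
    hFm.aestronglyMeasurable, integral_prod]
  · have : (fun t : ℝ => ENNReal.ofReal (δ * t ^ (d - 1))) =
      fun t => ((Real.toNNReal (δ * t ^ (d - 1)) : NNReal) : ℝ≥0∞) := rfl
    rw [this, integral_withDensity_eq_integral_smul hw, intervalIntegral.integral_of_le zero_le_one,
      integral_Ioc_eq_integral_Ioo]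
    apply setIntegral_congr_fun measurableSet_Ioo
    intro t ht
    have h0 : 0 ≤ δ * t ^ (d - 1) := by have := ht.1; positivity
    simp only [NNReal.smul_def, Real.coe_toNNReal _ h0, smul_eq_mul]
  · exact (integrable_map_measure hFm.aestronglyMeasurable hΦ.aemeasurable).1 hF

/-- Used to discard the cones over the relative boundaries of the faces. -/
theorem measure_coneSet_eq_zero {n c : Eucl d} (hn : ‖n‖ = 1) {δ : ℝ} (hδ : 0 < δ)
    {A : Set (Eucl d)} (hA : A ⊆ hyperplane n (⟪n, c⟫ + δ)) (hAm : MeasurableSet A)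
    (h0 : hyperplaneMeasure n (⟪n, c⟫ + δ) A = 0) : volume (coneSet c A) = 0 := by
  have h := lintegral_coneSet hn hδ hA hAm (fun _ => 1) measurable_const
  simpa [h0] using h

end HybridFV

namespace HybridFV

variable {d : ℕ}

/-! ### Star-shaped polyhedral cells -/

/-- A bounded open set `K`, star-shaped with respect to `c`, whose boundary is made of the pieces
`A i` of the hyperplanes `⟪n i, x - c⟫ = δ i`. -/
structure IsStarCell {I : Type*} (K : Set (Eucl d)) (c : Eucl d) (n : I → Eucl d) (δ : I → ℝ)
    (A : I → Set (Eucl d)) : Prop where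
  isOpen : IsOpen K
  isBounded : Bornology.IsBounded K
  star : StarConvex ℝ c K
  center_mem : c ∈ K
  norm_eq : ∀ i, ‖n i‖ = 1
  pos : ∀ i, 0 < δ i
  relOpen : ∀ i, ∃ U, IsOpen U ∧ A i = U ∩ hyperplane (n i) (⟪n i, c⟫ + δ i)
  null : ∀ i, hyperplaneMeasure (n i) (⟪n i, c⟫ + δ i) (closure (A i) \ A i) = 0
  disj : ∀ i j, i ≠ j → Disjoint (A i) (A j)
  frontier_eq : frontier K = ⋃ i, closure (A i)

theorem isClosed_hyperplane (n : Eucl d) (c : ℝ) : IsClosed (hyperplane n c) :=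
  isClosed_eq (by fun_prop) continuous_const

theorem volume_hyperplane {n : Eucl d} (hn : n ≠ 0) (c : ℝ) : volume (hyperplane n c) = 0 := by
  have hne : ‖n‖ ≠ 0 := norm_ne_zero_iff.2 hn
  have : hyperplane n c = hyperplane (‖n‖⁻¹ • n) (‖n‖⁻¹ * c) := by
    ext x
    simp only [hyperplane, mem_ofPred_eq, real_inner_smul_left]
    constructor
    · rintro rfl; rfl
    · intro h; exact mul_left_cancel₀ (inv_ne_zero hne) h
  rw [this]
  have hn1 : ‖‖n‖⁻¹ • n‖ = 1 := by
    rw [norm_smul, norm_inv, norm_norm, inv_mul_cancel₀ hne]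
  generalize ‖n‖⁻¹ • n = m at hn1
  generalize ‖n‖⁻¹ * c = a
  rw [← lintegral_indicator_one (isClosed_hyperplane m a).measurableSet,
    lintegral_eq_lintegral_orthogonal m hn1 _
      (measurable_one.indicator (isClosed_hyperplane m a).measurableSet)]
  rw [lintegral_eq_zero_iff']
  · have h : ∀ᵐ s : ℝ, s ≠ a := by simp [ae_iff]
    filter_upwards [h] with s hs
    have : ∀ y : (Submodule.span ℝ {m})ᗮ, (hyperplane m a).indicator (1 : Eucl d → ℝ≥0∞)
        (s • m + (y : Eucl d)) = 0 := by
      intro y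
      apply indicator_of_notMem
      intro h
      apply hs
      have hy : ⟪m, (y : Eucl d)⟫ = 0 :=
        (Submodule.mem_orthogonal_singleton_iff_inner_right).1 y.2
      simpa [hyperplane, inner_add_right, inner_smul_right, hn1, hy] using h
    rw [lintegral_congr this]
    simp
  · apply Measurable.aemeasurable
    apply Measurable.lintegral_prod_right' (f := fun p : ℝ × (Submodule.span ℝ {m})ᗮ =>
      (hyperplane m a).indicator (1 : Eucl d → ℝ≥0∞) (p.1 • m + (p.2 : Eucl d)))
    exact (measurable_one.indicator (isClosed_hyperplane m a).measurableSet).comp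
      ((measurable_fst.smul_const m).add (measurable_subtype_coe.comp measurable_snd))

/-- A continuous function which at each point coincides with one of finitely many
`C`-Lipschitz functions is `C`-Lipschitz. -/
theorem lipschitzWith_of_selection {E I : Type*} [NormedAddCommGroup E] [NormedSpace ℝ E] [Finite I]
    {g : E → ℝ} (hg : Continuous g) {ℓ : I → E → ℝ} {C : NNReal}
    (hℓ : ∀ i, LipschitzWith C (ℓ i)) (h : ∀ x, ∃ i, g x = ℓ i x) : LipschitzWith C g := by
  apply LipschitzWith.of_dist_le_mul
  intro x y
  -- A branch that differs from `g` at `s` still differs near `s`. As there are finitely many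
  -- branches, any branch selected near `s` must also agree with `g` at `s`.
  have key : ∀ s : ℝ, ∀ᶠ r in 𝓝 s, ∃ i, g (y + r • (x - y)) = ℓ i (y + r • (x - y)) ∧
      g (y + s • (x - y)) = ℓ i (y + s • (x - y)) := by
    intro s
    have h1 : ∀ i, ∀ᶠ r in 𝓝 s, g (y + r • (x - y)) = ℓ i (y + r • (x - y)) →
        g (y + s • (x - y)) = ℓ i (y + s • (x - y)) := by
      intro i
      by_cases hi : g (y + s • (x - y)) = ℓ i (y + s • (x - y))
      · exact Eventually.of_forall fun _ _ => hi
      · have hc : Continuous fun r : ℝ => g (y + r • (x - y)) - ℓ i (y + r • (x - y)) :=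
          (hg.comp (by fun_prop)).sub ((hℓ i).continuous.comp (by fun_prop))
        have := hc.continuousAt.eventually_ne (sub_ne_zero.2 hi)
        filter_upwards [this] with r hr hr'
        exact absurd (sub_eq_zero.2 hr') hr
    filter_upwards [eventually_all.2 h1] with r hr
    obtain ⟨i, hi⟩ := h (y + r • (x - y))
    exact ⟨i, hi, hr i hi⟩
  set D : ℝ := C * ‖x - y‖ with hD
  set F : ℝ → ℝ := fun r => g (y + r • (x - y)) - g y with hF
  have hFc : Continuous F := (hg.comp (by fun_prop)).sub continuous_const
  have hloc : ∀ s : ℝ, ∀ᶠ r in 𝓝 s, |F r - F s| ≤ D * |r - s| := by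
    intro s
    filter_upwards [key s] with r ⟨i, hi1, hi2⟩
    have h3 := (hℓ i).dist_le_mul (y + r • (x - y)) (y + s • (x - y))
    rw [dist_add_left, dist_eq_norm, dist_eq_norm, ← sub_smul, norm_smul, Real.norm_eq_abs,
      Real.norm_eq_abs, ← hi1, ← hi2] at h3
    simp only [hF, sub_sub_sub_cancel_right, hD]
    linarith
  have main : ∀ ⦃r⦄, r ∈ Icc (0 : ℝ) 1 → ‖F r‖ ≤ D * r := by
    -- The comparison lemma for right slopes requires a strict inequality between the two
    -- derivatives; the slack `ε` provides it and is then sent to `0`.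
    have hε : ∀ ε > 0, ∀ ⦃r⦄, r ∈ Icc (0 : ℝ) 1 → ‖F r‖ ≤ (D + ε) * r := by
      intro ε hε
      apply image_norm_le_of_liminf_right_slope_norm_lt_deriv_boundary (f' := fun _ => D)
        (B' := fun _ => D + ε) hFc.continuousOn
      · simp [hF]
      · fun_prop
      · intro s _
        have := ((hasDerivAt_id s).const_mul (D + ε)).hasDerivWithinAt (s := Ici s)
        simpa using this
      · intro s _ _; linarith
      · intro s _ r hr
        apply Eventually.frequently
        filter_upwards [(hloc s).filter_mono nhdsWithin_le_nhds, self_mem_nhdsWithin] with z hz hz'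
        have hz'' : 0 < z - s := sub_pos.2 hz'
        rw [slope_def_field, div_lt_iff₀ hz'']
        have := norm_sub_norm_le (F z) (F s)
        rw [Real.norm_eq_abs (F z - F s)] at this
        rw [abs_of_pos hz''] at hz
        simp only [Function.comp]
        nlinarith
    intro r hr
    apply le_of_forall_pos_le_add
    intro ε he
    have h2 := hε ε he hr
    nlinarith [hr.1, hr.2]
  have := main (right_mem_Icc.2 zero_le_one)
  rw [dist_eq_norm, dist_eq_norm]
  simpa [hF, hD] using this

/-! ### The gauge of a star-shaped polyhedral cell. -/

namespace IsStarCell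

variable {I : Type*} {K : Set (Eucl d)} {c : Eucl d} {n : I → Eucl d} {δ : I → ℝ}
  {A : I → Set (Eucl d)}

theorem face_subset (h : IsStarCell K c n δ A) (i : I) :
    A i ⊆ hyperplane (n i) (⟪n i, c⟫ + δ i) := by
  obtain ⟨U, -, hU⟩ := h.relOpen i
  rw [hU]; exact inter_subset_right

theorem closure_face_subset (h : IsStarCell K c n δ A) (i : I) :
    closure (A i) ⊆ hyperplane (n i) (⟪n i, c⟫ + δ i) :=
  closure_minimal (h.face_subset i) (isClosed_hyperplane _ _)

theorem inner_of_mem (h : IsStarCell K c n δ A) {i : I} {y : Eucl d} (hy : y ∈ closure (A i)) :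
    ⟪n i, y - c⟫ = δ i := by
  have := h.closure_face_subset i hy
  rw [hyperplane, mem_ofPred_eq] at this
  rw [inner_sub_right, this]; ring

theorem measurableSet_face (h : IsStarCell K c n δ A) (i : I) : MeasurableSet (A i) := by
  obtain ⟨U, hUo, hU⟩ := h.relOpen i
  rw [hU]; exact hUo.measurableSet.inter (isClosed_hyperplane _ _).measurableSet

theorem exists_inner_eq (h : IsStarCell K c n δ A) {y : Eucl d} (hy : y ∈ frontier K) :
    ∃ i, y ∈ closure (A i) := by
  rw [h.frontier_eq] at hy; exact mem_iUnion.1 hy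

theorem closure_face_subset_frontier (h : IsStarCell K c n δ A) (i : I) :
    closure (A i) ⊆ frontier K := by
  rw [h.frontier_eq]; exact subset_iUnion (fun i => closure (A i)) i

theorem star' (h : IsStarCell K c n δ A) {y : Eucl d} (hy : y ∈ K) {t : ℝ} (ht0 : 0 ≤ t)
    (ht1 : t ≤ 1) : c + t • (y - c) ∈ K := by
  have := h.star hy (sub_nonneg.2 ht1) ht0 (by ring)
  convert this using 1
  module

theorem star_closure (h : IsStarCell K c n δ A) {y : Eucl d} (hy : y ∈ closure K) {t : ℝ}
    (ht0 : 0 ≤ t) (ht1 : t ≤ 1) : c + t • (y - c) ∈ closure K := by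
  have hc : Continuous fun y : Eucl d => c + t • (y - c) := by fun_prop
  exact map_mem_closure (f := fun y => c + t • (y - c)) hc hy fun z hz => h.star' hz ht0 ht1

/-- Points of the closure are seen from the center through the open cell. -/
theorem lineMap_mem [Finite I] (h : IsStarCell K c n δ A) {y : Eucl d} (hy : y ∈ closure K)
    {t : ℝ} (ht0 : 0 ≤ t) (ht1 : t < 1) : c + t • (y - c) ∈ K := by
  by_contra hcon
  -- If the point of parameter `t` misses `K`, star-shapedness makes all later points of the segment
  -- miss it too, so they are boundary points and each lies on some face hyperplane. Since `δ i >
  -- 0`, the equation of a hyperplane determines the parameter, so infinitely many parameters would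
  -- inject into finitely many faces.
  have h1 : ∀ s ∈ Icc t 1, ∃ i, s * ⟪n i, y - c⟫ = δ i := by
    intro s hs
    have hs0 : 0 ≤ s := ht0.trans hs.1
    have hmem : c + s • (y - c) ∈ frontier K := by
      rw [frontier, h.isOpen.interior_eq]
      refine ⟨h.star_closure hy hs0 hs.2, fun hK => hcon ?_⟩
      rcases hs0.eq_or_lt with h0 | h0
      · have : t = 0 := le_antisymm (h0 ▸ hs.1) ht0
        rw [this, zero_smul, add_zero]; exact h.center_mem
      · have := h.star' hK (div_nonneg ht0 hs0) (div_le_one_of_le₀ hs.1 hs0)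
        rwa [add_sub_cancel_left, smul_smul, div_mul_cancel₀ _ h0.ne'] at this
    obtain ⟨i, hi⟩ := h.exists_inner_eq hmem
    refine ⟨i, ?_⟩
    have := h.inner_of_mem hi
    rwa [add_sub_cancel_left, inner_smul_right] at this
  choose f hf using fun s : Icc t 1 => h1 s s.2
  have hinj : Function.Injective f := by
    intro s s' hss
    have e1 := hf s
    have e2 := hf s'
    rw [← hss] at e2
    have hp := h.pos (f s)
    have hne : ⟪n (f s), y - c⟫ ≠ 0 := by
      intro h0; rw [h0, mul_zero] at e1; linarith
    exact Subtype.ext (mul_right_cancel₀ hne (e1.trans e2.symm))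
  have : Infinite (Icc t 1) := (Icc_infinite ht1).to_subtype
  exact not_injective_infinite_finite f hinj

/-- The gauge of the cell, seen from its center. -/
noncomputable def gaugeFn (K : Set (Eucl d)) (c : Eucl d) (x : Eucl d) : ℝ :=
  gauge ((fun z => c + z) ⁻¹' K) (x - c)

theorem gaugeFn_nonneg (K : Set (Eucl d)) (c x : Eucl d) : 0 ≤ gaugeFn K c x := gauge_nonneg _

theorem isOpen_pre (h : IsStarCell K c n δ A) : IsOpen ((fun z => c + z) ⁻¹' K) :=
  h.isOpen.preimage (by fun_prop)

theorem absorbent_pre (h : IsStarCell K c n δ A) : Absorbent ℝ ((fun z => c + z) ⁻¹' K) :=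
  absorbent_nhds_zero (h.isOpen_pre.mem_nhds (by simpa using h.center_mem))

theorem gaugeFn_smul (K : Set (Eucl d)) (c : Eucl d) {t : ℝ} (ht : 0 ≤ t) (y : Eucl d) :
    gaugeFn K c (c + t • (y - c)) = t * gaugeFn K c y := by
  rw [gaugeFn, add_sub_cancel_left, gauge_smul_of_nonneg ht]; rfl

theorem gaugeFn_lt_one_iff (h : IsStarCell K c n δ A) (x : Eucl d) :
    gaugeFn K c x < 1 ↔ x ∈ K := by
  constructor
  · intro hx
    obtain ⟨b, hb0, hb1, hb⟩ := exists_lt_of_gauge_lt h.absorbent_pre hx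
    obtain ⟨z, hz, hzx⟩ := hb
    have := h.star' (y := c + z) hz hb0.le hb1.le
    rw [add_sub_cancel_left] at this
    simp only at hzx
    rwa [hzx, add_sub_cancel] at this
  · intro hx
    apply interior_subset_gauge_lt_one
    rw [h.isOpen_pre.interior_eq]
    simpa using hx

theorem gaugeFn_lt_iff (h : IsStarCell K c n δ A) {r : ℝ} (hr : 0 < r) (x : Eucl d) :
    gaugeFn K c x < r ↔ c + r⁻¹ • (x - c) ∈ K := by
  rw [← h.gaugeFn_lt_one_iff, gaugeFn_smul K c (inv_nonneg.2 hr.le), inv_mul_lt_iff₀ hr, mul_one]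

theorem gaugeFn_le_iff [Finite I] (h : IsStarCell K c n δ A) {r : ℝ} (hr : 0 < r) (x : Eucl d) :
    gaugeFn K c x ≤ r ↔ c + r⁻¹ • (x - c) ∈ closure K := by
  constructor
  · intro hx
    have h1 : Tendsto (fun s : ℝ => c + s⁻¹ • (x - c)) (𝓝[>] r) (𝓝 (c + r⁻¹ • (x - c))) := by
      apply Tendsto.mono_left _ nhdsWithin_le_nhds
      have : ContinuousAt (fun s : ℝ => c + s⁻¹ • (x - c)) r := by fun_prop (disch := exact hr.ne')
      exact this
    apply mem_closure_of_tendsto h1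
    filter_upwards [self_mem_nhdsWithin] with s hs
    exact (h.gaugeFn_lt_iff (hr.trans hs) x).1 (hx.trans_lt hs)
  · intro hx
    apply le_of_forall_gt_imp_ge_of_dense
    intro s hs
    have hs0 : 0 < s := hr.trans hs
    apply le_of_lt
    rw [h.gaugeFn_lt_iff hs0]
    have := h.lineMap_mem hx (t := r / s) (by positivity) ((div_lt_one hs0).2 hs)
    rw [add_sub_cancel_left, smul_smul] at this
    convert this using 3
    field_simp

theorem gaugeFn_pos (h : IsStarCell K c n δ A) {x : Eucl d} (hx : x ≠ c) :
    0 < gaugeFn K c x := by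
  apply (gauge_pos h.absorbent_pre _).2 (sub_ne_zero.2 hx)
  apply NormedSpace.isVonNBounded_of_isBounded
  obtain ⟨R, hR⟩ := h.isBounded.subset_closedBall c
  apply Metric.isBounded_closedBall (x := (0 : Eucl d)) (r := R) |>.subset
  intro z hz
  simpa [dist_eq_norm] using hR hz

theorem gaugeFn_center (K : Set (Eucl d)) (c : Eucl d) : gaugeFn K c c = 0 := by
  simp [gaugeFn]

/-- The cell need not be convex, so continuity cannot come from subadditivity. For `r > 0` the
sublevel sets are preimages of `K` (strict) and of `closure K` (large) under homotheties; the second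
description relies on `lineMap_mem`. The level `0` uses boundedness, which makes the center the only
zero. -/
theorem continuous_gaugeFn [Finite I] (h : IsStarCell K c n δ A) : Continuous (gaugeFn K c) := by
  rw [OrderTopology.continuous_iff]
  intro r
  constructor
  · rcases lt_trichotomy r 0 with hr | rfl | hr
    · convert isOpen_univ
      ext x
      simpa using hr.trans_le (gaugeFn_nonneg K c x)
    · have : gaugeFn K c ⁻¹' Ioi 0 = {c}ᶜ := by
        ext x
        constructor
        · rintro hx rfl
          simp [gaugeFn_center] at hx
        · intro hx; exact h.gaugeFn_pos hx
      rw [this]; exact isOpen_compl_singleton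
    · have : gaugeFn K c ⁻¹' Ioi r = ((fun x => c + r⁻¹ • (x - c)) ⁻¹' closure K)ᶜ := by
        ext x
        rw [mem_preimage, mem_compl_iff, mem_preimage, ← h.gaugeFn_le_iff hr, mem_Ioi, not_le]
      rw [this]
      exact (isClosed_closure.preimage (by fun_prop)).isOpen_compl
  · rcases le_or_gt r 0 with hr | hr
    · convert isOpen_empty
      ext x
      simpa using hr.trans (gaugeFn_nonneg K c x)
    · have : gaugeFn K c ⁻¹' Iio r = (fun x => c + r⁻¹ • (x - c)) ⁻¹' K := by
        ext x
        rw [mem_preimage, mem_preimage, ← h.gaugeFn_lt_iff hr, mem_Iio]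
      rw [this]
      exact h.isOpen.preimage (by fun_prop)

theorem boundary_point [Finite I] (h : IsStarCell K c n δ A) {x : Eucl d} (hx : x ≠ c) :
    c + (gaugeFn K c x)⁻¹ • (x - c) ∈ frontier K := by
  have hp := h.gaugeFn_pos hx
  rw [frontier, h.isOpen.interior_eq]
  exact ⟨(h.gaugeFn_le_iff hp x).1 le_rfl, fun hK => lt_irrefl _ ((h.gaugeFn_lt_iff hp x).2 hK)⟩

theorem gaugeFn_frontier [Finite I] (h : IsStarCell K c n δ A) {y : Eucl d}
    (hy : y ∈ frontier K) : gaugeFn K c y = 1 := by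
  apply le_antisymm
  · rw [h.gaugeFn_le_iff one_pos]; simpa using frontier_subset_closure hy
  · by_contra hlt
    rw [not_le, h.gaugeFn_lt_one_iff] at hlt
    rw [frontier, h.isOpen.interior_eq] at hy
    exact hy.2 hlt

/-- The radial projection of `x` to the boundary lies on a face, and the equation of that hyperplane
gives the value of the gauge at `x`. -/
theorem exists_gaugeFn_eq [Finite I] [Nonempty I] (h : IsStarCell K c n δ A) (x : Eucl d) :
    ∃ i, gaugeFn K c x = ⟪n i, x - c⟫ / δ i := by
  by_cases hx : x = c
  · subst hx
    exact ⟨Classical.arbitrary I, by simp [gaugeFn_center]⟩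
  · obtain ⟨i, hi⟩ := h.exists_inner_eq (h.boundary_point hx)
    refine ⟨i, ?_⟩
    have h1 := h.inner_of_mem hi
    have hp := h.gaugeFn_pos hx
    have hδ := h.pos i
    rw [add_sub_cancel_left, inner_smul_right] at h1
    rw [← h1]
    have : ⟪n i, x - c⟫ ≠ 0 := by
      intro h0; rw [h0, mul_zero] at h1; linarith
    field_simp

/-- The gauge is a continuous selection of finitely many affine functions with slopes `(δ i)⁻¹`. -/
theorem exists_lipschitzWith_gaugeFn [Finite I] [Nonempty I] (h : IsStarCell K c n δ A) :
    ∃ C, LipschitzWith C (gaugeFn K c) := by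
  cases nonempty_fintype I
  obtain ⟨C, hC⟩ := (Set.finite_range fun i => (δ i)⁻¹).bddAbove
  refine ⟨C.toNNReal, lipschitzWith_of_selection h.continuous_gaugeFn
    (ℓ := fun i x => ⟪n i, x - c⟫ / δ i) (fun i => ?_) h.exists_gaugeFn_eq⟩
  apply LipschitzWith.of_dist_le_mul
  intro x y
  have h1 : (δ i)⁻¹ ≤ C := hC (mem_range_self i)
  have hp := inv_pos.2 (h.pos i)
  rw [Real.coe_toNNReal _ (hp.le.trans h1), Real.dist_eq, ← sub_div, ← inner_sub_right,
    sub_sub_sub_cancel_right, abs_div, abs_of_pos (h.pos i), div_eq_inv_mul, dist_eq_norm]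
  apply mul_le_mul h1 _ (abs_nonneg _) (hp.le.trans h1)
  simpa [h.norm_eq i] using abs_real_inner_le_norm (n i) (x - y)

end IsStarCell

end HybridFV

/-! ### Decomposition into cones and the divergence theorem in a cell. -/

namespace HybridFV

variable {d : ℕ}

namespace IsStarCell

variable {I : Type*} {K : Set (Eucl d)} {c : Eucl d} {n : I → Eucl d} {δ : I → ℝ}
  {A : I → Set (Eucl d)}

theorem gaugeFn_of_mem_coneSet [Finite I] (h : IsStarCell K c n δ A) {i : I} {y : Eucl d}
    (hy : y ∈ closure (A i)) {t : ℝ} (ht : 0 ≤ t) : gaugeFn K c (c + t • (y - c)) = t := by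
  rw [gaugeFn_smul K c ht, h.gaugeFn_frontier (h.closure_face_subset_frontier i hy), mul_one]

theorem coneSet_subset [Finite I] (h : IsStarCell K c n δ A) (i : I) : coneSet c (A i) ⊆ K := by
  rintro x ⟨y, hy, t, ht, rfl⟩
  exact h.lineMap_mem (frontier_subset_closure (h.closure_face_subset_frontier i
    (subset_closure hy))) ht.1.le ht.2

theorem disjoint_coneSet [Finite I] (h : IsStarCell K c n δ A) {i j : I} (hij : i ≠ j) :
    Disjoint (coneSet c (A i)) (coneSet c (A j)) := by
  rw [Set.disjoint_left]
  rintro x ⟨y, hy, t, ht, rfl⟩ ⟨z, hz, s, hs, hx⟩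
  have e1 := h.gaugeFn_of_mem_coneSet (subset_closure hy) ht.1.le
  rw [hx, h.gaugeFn_of_mem_coneSet (subset_closure hz) hs.1.le] at e1
  subst e1
  have : y = z := by
    have h1 := add_left_cancel hx
    have h2 := smul_right_injective _ hs.1.ne' h1
    exact sub_left_injective h2
  subst this
  exact (Set.disjoint_left.1 (h.disj i j hij)) hy hz

theorem gaugeFn_eq_of_mem_coneSet [Finite I] (h : IsStarCell K c n δ A) {i : I} {x : Eucl d}
    (hx : x ∈ coneSet c (A i)) : gaugeFn K c x = ⟪n i, x - c⟫ / δ i := by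
  obtain ⟨y, hy, t, ht, rfl⟩ := hx
  rw [h.gaugeFn_of_mem_coneSet (subset_closure hy) ht.1.le, add_sub_cancel_left, inner_smul_right,
    h.inner_of_mem (subset_closure hy), mul_div_cancel_right₀ _ (h.pos i).ne']

/-- Openness matters beyond measurability: it makes the gauge affine in a neighbourhood of each
point of a cone, so its derivative is known there. -/
theorem isOpen_coneSet (h : IsStarCell K c n δ A) (i : I) : IsOpen (coneSet c (A i)) := by
  obtain ⟨U, hUo, hU⟩ := h.relOpen i
  have hc : Continuous fun x : Eucl d => ⟪n i, x - c⟫ / δ i := by fun_prop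
  have e : coneSet c (A i) = ((fun x : Eucl d => ⟪n i, x - c⟫ / δ i) ⁻¹' Ioo 0 1) ∩
      (fun x => c + (⟪n i, x - c⟫ / δ i)⁻¹ • (x - c)) ⁻¹' U := by
    ext x
    rw [mem_coneSet_iff (h.pos i) (h.face_subset i), mem_inter_iff, mem_preimage, mem_preimage, hU]
    refine and_congr_right fun h1 => ?_
    rw [mem_inter_iff, and_iff_left]
    rw [hyperplane, mem_ofPred_eq, inner_add_right, inner_smul_right]
    have hδ := h.pos i
    have : ⟪n i, x - c⟫ ≠ 0 := by
      intro h0; rw [h0, zero_div] at h1; exact lt_irrefl _ h1.1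
    field_simp
  rw [e]
  apply ContinuousOn.isOpen_inter_preimage _ (isOpen_Ioo.preimage hc) hUo
  apply continuousOn_const.add
  exact (hc.continuousOn.inv₀ fun x hx => hx.1.ne').fun_smul (by fun_prop)

/-- Away from the center, a point of `K` projects radially to some closed face. Only the center,
null because `d > 0`, and the cones over the relative boundaries can be missed. -/
theorem ae_mem_coneSet [Finite I] (h : IsStarCell K c n δ A) (hd : 0 < d) :
    ∀ᵐ x, x ∈ K → x ∈ ⋃ i, coneSet c (A i) := by
  have hnt : Nontrivial (Eucl d) := by
    have : Nonempty (Fin d) := ⟨⟨0, hd⟩⟩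
    infer_instance
  have h1 : ∀ᵐ x : Eucl d, x ≠ c := by
    rw [ae_iff]; simp
  have h2 : ∀ᵐ x : Eucl d, ∀ i, x ∉ coneSet c (closure (A i) \ A i) := by
    rw [ae_all_iff]
    intro i
    rw [ae_iff]
    simp only [not_not, ofPred_mem_eq]
    exact measure_coneSet_eq_zero (h.norm_eq i) (h.pos i)
      (sdiff_subset.trans (h.closure_face_subset i))
      (isClosed_closure.measurableSet.diff (h.measurableSet_face i)) (h.null i)
  filter_upwards [h1, h2] with x hx1 hx2 hxK
  obtain ⟨i, hi⟩ := h.exists_inner_eq (h.boundary_point hx1)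
  have hp := h.gaugeFn_pos hx1
  have hlt := (h.gaugeFn_lt_one_iff x).2 hxK
  have hmem : ∀ B : Set (Eucl d), c + (gaugeFn K c x)⁻¹ • (x - c) ∈ B → x ∈ coneSet c B := by
    intro B hB
    refine ⟨_, hB, _, ⟨hp, hlt⟩, ?_⟩
    rw [add_sub_cancel_left, smul_smul, mul_inv_cancel₀ hp.ne', one_smul, add_sub_cancel]
  rw [mem_iUnion]
  refine ⟨i, hmem _ ?_⟩
  by_contra hcon
  exact hx2 i (hmem _ ⟨hi, hcon⟩)

theorem volume_frontier [Finite I] (h : IsStarCell K c n δ A) : volume (frontier K) = 0 := by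
  rw [h.frontier_eq, measure_iUnion_null_iff]
  intro i
  refine measure_mono_null (h.closure_face_subset i) (volume_hyperplane ?_ _)
  intro h0
  have := h.norm_eq i
  rw [h0, norm_zero] at this
  exact zero_ne_one this

theorem ae_eq_iUnion_coneSet [Finite I] (h : IsStarCell K c n δ A) (hd : 0 < d) :
    K =ᵐ[volume] ⋃ i, coneSet c (A i) := by
  filter_upwards [h.ae_mem_coneSet hd] with x hx
  exact propext ⟨hx, fun hx' => (iUnion_subset h.coneSet_subset) hx'⟩

theorem setIntegral_eq_sum [Fintype I] (h : IsStarCell K c n δ A) (hd : 0 < d)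
    {V : Type*} [NormedAddCommGroup V] [NormedSpace ℝ V] {F : Eucl d → V}
    (hF : IntegrableOn F K) :
    ∫ x in K, F x = ∑ i, ∫ x in coneSet c (A i), F x := by
  rw [setIntegral_congr_set (h.ae_eq_iUnion_coneSet hd)]
  exact integral_iUnion_fintype (fun i => (h.isOpen_coneSet i).measurableSet)
    (fun i j hij => h.disjoint_coneSet hij) fun i => hF.mono_set (h.coneSet_subset i)

/-- Without faces the cell would be open and closed, hence the whole space, which is unbounded when
`d > 0`. -/
theorem nonempty_index (h : IsStarCell K c n δ A) (hd : 0 < d) : Nonempty I := by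
  have hnt : Nontrivial (Eucl d) := by
    have : Nonempty (Fin d) := ⟨⟨0, hd⟩⟩
    infer_instance
  by_contra hI
  rw [not_nonempty_iff] at hI
  have h1 : frontier K = ∅ := by rw [h.frontier_eq]; simp
  have hcl : IsClopen K := by
    rw [isClopen_iff_frontier_eq_empty]; exact h1
  rcases isClopen_iff.1 hcl with h0 | h0
  · exact (h0 ▸ h.center_mem : c ∈ (∅ : Set (Eucl d)))
  · exact NormedSpace.unbounded_univ ℝ (Eucl d) (h0 ▸ h.isBounded)

/-- Integration by parts against `(1 - g)₊`, `g` the gauge of the cell. -/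
theorem sum_inner_mul_integral_coneSet [Fintype I] (h : IsStarCell K c n δ A) (hd : 0 < d)
    {φ : Eucl d → ℝ} (hφ : ContDiff ℝ 1 φ) (hφc : HasCompactSupport φ) (e : Eucl d) :
    ∑ i, ⟪n i, e⟫ / δ i * ∫ x in coneSet c (A i), φ x =
      ∑ i, ∫ x in coneSet c (A i), (1 - ⟪n i, x - c⟫ / δ i) * fderiv ℝ φ x e := by
  have := h.nonempty_index hd
  set f : Eucl d → ℝ := fun x => max 0 (1 - gaugeFn K c x) with hf
  obtain ⟨C, hC⟩ := h.exists_lipschitzWith_gaugeFn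
  have hfl : ∃ C', LipschitzWith C' f :=
    ⟨_, ((LipschitzWith.const (1 : ℝ)).sub hC).const_max 0⟩
  obtain ⟨C', hfl⟩ := hfl
  obtain ⟨D, hφl⟩ := hφ.lipschitzWith_of_hasCompactSupport hφc one_ne_zero
  have hfd : ∀ x, fderiv ℝ φ x (-e) = - fderiv ℝ φ x e := fun x => map_neg _ _
  have key := LipschitzWith.integral_lineDeriv_mul_eq (μ := volume) hfl hφl hφc e
  have hline : ∀ x, lineDeriv ℝ φ x (-e) = - fderiv ℝ φ x e := by
    intro x
    rw [(hφ.differentiable one_ne_zero x).lineDeriv_eq_fderiv, hfd]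
  simp only [hline] at key
  have hdφ : Continuous fun x => fderiv ℝ φ x e := (hφ.continuous_fderiv one_ne_zero).clm_apply
    continuous_const
  have hdφc : HasCompactSupport fun x => fderiv ℝ φ x e := hφc.fderiv_apply ℝ e
  -- outside `K` both integrands vanish
  have hout : ∀ x, x ∉ K → f x = 0 := by
    intro x hx
    rw [← h.gaugeFn_lt_one_iff, not_lt] at hx
    simp [hf, hx]
  have hout' : ∀ᵐ x, x ∉ K → lineDeriv ℝ f x e = 0 := by
    have hfr : ∀ᵐ x : Eucl d, x ∉ frontier K := measure_eq_zero_iff_ae_notMem.1 h.volume_frontier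
    filter_upwards [hfr] with x hx hxK
    have hxc : x ∈ (closure K)ᶜ := fun hc => hx ⟨hc, by rwa [h.isOpen.interior_eq]⟩
    have hev : f =ᶠ[𝓝 x] fun _ => 0 := by
      filter_upwards [isClosed_closure.isOpen_compl.mem_nhds hxc] with z hz
      exact hout z fun hzK => hz (subset_closure hzK)
    rw [hev.lineDeriv_eq]
    simp [lineDeriv]
  have hcone : ∀ i, ∀ x ∈ coneSet c (A i), f x = 1 - ⟪n i, x - c⟫ / δ i := by
    intro i x hx
    have h1 := (h.gaugeFn_lt_one_iff x).2 (h.coneSet_subset i hx)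
    simp only [hf]
    rw [max_eq_right (by linarith), h.gaugeFn_eq_of_mem_coneSet hx]
  have hcone' : ∀ i, ∀ x ∈ coneSet c (A i), lineDeriv ℝ f x e = - (⟪n i, e⟫ / δ i) := by
    intro i x hx
    have hev : f =ᶠ[𝓝 x] fun z => 1 - ⟪n i, z - c⟫ / δ i := by
      filter_upwards [(h.isOpen_coneSet i).mem_nhds hx] with z hz
      exact hcone i z hz
    rw [hev.lineDeriv_eq, lineDeriv]
    have : (fun t : ℝ => 1 - ⟪n i, x + t • e - c⟫ / δ i) =
        fun t : ℝ => (1 - ⟪n i, x - c⟫ / δ i) + t * (-(⟪n i, e⟫ / δ i)) := by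
      ext t
      rw [inner_sub_right, inner_sub_right, inner_add_right, inner_smul_right]
      ring
    rw [this]
    simp
  have hint1 : Integrable fun x => lineDeriv ℝ f x e * φ x :=
    (hφ.continuous.integrable_of_hasCompactSupport hφc).bdd_mul
      (aestronglyMeasurable_lineDeriv hfl.continuous _)
      (Eventually.of_forall fun x => norm_lineDeriv_le_of_lipschitz ℝ hfl)
  have hint2 : Integrable fun x => f x * fderiv ℝ φ x e :=
    (hfl.continuous.mul hdφ).integrable_of_hasCompactSupport hdφc.mul_left
  have hL : ∫ x, lineDeriv ℝ f x e * φ x =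
      - ∑ i, ⟪n i, e⟫ / δ i * ∫ x in coneSet c (A i), φ x := by
    rw [← setIntegral_eq_integral_of_ae_compl_eq_zero (s := K), h.setIntegral_eq_sum hd
      hint1.integrableOn, ← Finset.sum_neg_distrib]
    · refine Finset.sum_congr rfl fun i _ => ?_
      rw [← neg_mul, ← integral_const_mul]
      apply setIntegral_congr_fun (h.isOpen_coneSet i).measurableSet
      intro x hx
      simp only [hcone' i x hx]
    · filter_upwards [hout'] with x hx hxK
      rw [hx hxK, zero_mul]
  have hR : ∫ x, - fderiv ℝ φ x e * f x =
      - ∑ i, ∫ x in coneSet c (A i), (1 - ⟪n i, x - c⟫ / δ i) * fderiv ℝ φ x e := by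
    have : (fun x => - fderiv ℝ φ x e * f x) = fun x => -(f x * fderiv ℝ φ x e) := by
      ext x; ring
    rw [this, integral_neg, ← setIntegral_eq_integral_of_ae_compl_eq_zero (s := K),
      h.setIntegral_eq_sum hd hint2.integrableOn]
    · congr 1
      refine Finset.sum_congr rfl fun i _ => ?_
      apply setIntegral_congr_fun (h.isOpen_coneSet i).measurableSet
      intro x hx
      simp only [hcone i x hx]
    · exact Eventually.of_forall fun x hxK => by rw [hout x hxK, zero_mul]
  rw [hL, hR] at key
  exact neg_injective key

theorem isBounded_face [Finite I] (h : IsStarCell K c n δ A) (i : I) :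
    Bornology.IsBounded (A i) :=
  h.isBounded.closure.subset ((subset_closure.trans (h.closure_face_subset_frontier i)).trans
    frontier_subset_closure)

theorem continuous_integral_face [Finite I] (h : IsStarCell K c n δ A) (i : I)
    {ψ : Eucl d → ℝ} (hψ : Continuous ψ) (hψc : HasCompactSupport ψ) :
    Continuous fun t : ℝ => ∫ y in A i, ψ (c + t • (y - c))
      ∂(hyperplaneMeasure (n i) (⟪n i, c⟫ + δ i)) := by
  have : IsFiniteMeasure ((hyperplaneMeasure (n i) (⟪n i, c⟫ + δ i)).restrict (A i)) :=
    ⟨by simpa using hyperplaneMeasure_lt_top_of_isBounded _ _ (h.isBounded_face i)⟩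
  obtain ⟨C, hC⟩ := hψ.bounded_above_of_compact_support hψc
  apply continuous_of_dominated (bound := fun _ => C)
  · intro t
    exact (hψ.comp (by fun_prop)).aestronglyMeasurable
  · exact fun t => Eventually.of_forall fun y => hC _
  · exact integrable_const _
  · exact Eventually.of_forall fun y => hψ.comp (by fun_prop)

/-- The divergence theorem in a star-shaped polyhedral cell. -/
theorem integral_fderiv_eq_of_hasCompactSupport [Fintype I] (h : IsStarCell K c n δ A)
    (hd : 0 < d) {φ : Eucl d → ℝ} (hφ : ContDiff ℝ 1 φ) (hφc : HasCompactSupport φ) (e : Eucl d) :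
    ∫ x in K, fderiv ℝ φ x e =
      ∑ i, ⟪n i, e⟫ * ∫ y in A i, φ y ∂(hyperplaneMeasure (n i) (⟪n i, c⟫ + δ i)) := by
  set χ : Eucl d → ℝ := fun x => fderiv ℝ φ x e with hχ
  have hχcont : Continuous χ := (hφ.continuous_fderiv one_ne_zero).clm_apply continuous_const
  have hχc : HasCompactSupport χ := hφc.fderiv_apply ℝ e
  have hχint : Integrable χ := hχcont.integrable_of_hasCompactSupport hχc
  set Φ : I → ℝ → ℝ := fun i t => ∫ y in A i, φ (c + t • (y - c))
      ∂(hyperplaneMeasure (n i) (⟪n i, c⟫ + δ i)) with hΦ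
  set X : I → ℝ → ℝ := fun i t => ∫ y in A i, χ (c + t • (y - c))
      ∂(hyperplaneMeasure (n i) (⟪n i, c⟫ + δ i)) with hX
  have hΦc : ∀ i, Continuous (Φ i) := fun i => h.continuous_integral_face i hφ.continuous hφc
  have hXc : ∀ i, Continuous (X i) := fun i => h.continuous_integral_face i hχcont hχc
  set a : ℝ → ℝ := fun t => ∑ i, ⟪n i, e⟫ * (t ^ (d - 1) * Φ i t) with ha
  set b : ℝ → ℝ := fun t => ∑ i, δ i * (t ^ (d - 1) * X i t) with hb
  have hac : Continuous a := by
    apply continuous_finsetSum; intro i _; have := hΦc i; fun_prop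
  have hbc : Continuous b := by
    apply continuous_finsetSum; intro i _; have := hXc i; fun_prop
  have hcont : ∀ s : ℝ, Continuous fun x : Eucl d => c + s • (x - c) := fun s => by fun_prop
  have hclosed : ∀ s : ℝ, s ≠ 0 → IsClosedEmbedding fun x : Eucl d => c + s • (x - c) := by
    intro s hs
    exact ((Homeomorph.addLeft c).isClosedEmbedding.comp
      (Homeomorph.smulOfNeZero s hs).isClosedEmbedding).comp
      (Homeomorph.subRight c).isClosedEmbedding
  have hface : ∀ i, ∀ y ∈ A i, ⟪n i, y - c⟫ = δ i := fun i y hy =>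
    h.inner_of_mem (subset_closure hy)
  -- The identity for `(1 - g)₊` is applied to the dilates `φ (c + s • (x - c))`. In cone
  -- coordinates, after substituting `s t` for the radial variable, it becomes one-dimensional: `a`
  -- collects the face integrals of `φ`, `b` those of its derivative, and `s - t` is what remains of
  -- the weight `1 - g`.
  have scaled : ∀ s : ℝ, 0 < s → ∫ t in (0 : ℝ)..s, a t = ∫ t in (0 : ℝ)..s, (s - t) * b t := by
    intro s hs
    have hφs : ContDiff ℝ 1 fun x => φ (c + s • (x - c)) := hφ.comp (by fun_prop)
    have hφsc : HasCompactSupport fun x => φ (c + s • (x - c)) :=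
      hφc.comp_isClosedEmbedding (hclosed s hs.ne')
    have hfd : ∀ x, fderiv ℝ (fun x => φ (c + s • (x - c))) x e = s * χ (c + s • (x - c)) := by
      intro x
      have h1 : HasFDerivAt (fun x : Eucl d => c + s • (x - c))
          (s • ContinuousLinearMap.id ℝ (Eucl d)) x :=
        (((hasFDerivAt_id x).sub_const c).const_smul s).const_add c
      have h2 := (hφ.differentiable one_ne_zero (c + s • (x - c))).hasFDerivAt.comp x h1
      have h3 := h2.fderiv
      simp only [Function.comp_def] at h3
      rw [h3]
      simp [hχ]
    have key := h.sum_inner_mul_integral_coneSet hd hφs hφsc e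
    simp only [hfd] at key
    have hL : ∀ i, ⟪n i, e⟫ / δ i * ∫ x in coneSet c (A i), φ (c + s • (x - c)) =
        ∫ t in (0 : ℝ)..1, ⟪n i, e⟫ * (t ^ (d - 1) * Φ i (s * t)) := by
      intro i
      rw [integral_coneSet (h.norm_eq i) (h.pos i) (h.face_subset i) (h.measurableSet_face i)
        (hφs.continuous.integrable_of_hasCompactSupport hφsc).integrableOn
        hφs.continuous.measurable, ← intervalIntegral.integral_const_mul]
      congr 1
      ext t
      have hδ := h.pos i
      simp only [hΦ, add_sub_cancel_left, smul_smul]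
      field_simp
    have hR : ∀ i, ∫ x in coneSet c (A i), (1 - ⟪n i, x - c⟫ / δ i) *
        (s * χ (c + s • (x - c))) =
        ∫ t in (0 : ℝ)..1, s * ((1 - t) * (δ i * (t ^ (d - 1) * X i (s * t)))) := by
      intro i
      have hc1 : Continuous fun x : Eucl d => (1 - ⟪n i, x - c⟫ / δ i) *
        (s * χ (c + s • (x - c))) := by
        have := hχcont.comp (hcont s)
        simp only [Function.comp_def] at this
        fun_prop
      have hcs : HasCompactSupport fun x : Eucl d => (1 - ⟪n i, x - c⟫ / δ i) *
        (s * χ (c + s • (x - c))) :=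
        ((hχc.comp_isClosedEmbedding (hclosed s hs.ne')).mul_left (f := fun _ => s)).mul_left
      rw [integral_coneSet (h.norm_eq i) (h.pos i) (h.face_subset i) (h.measurableSet_face i)
        (hc1.integrable_of_hasCompactSupport hcs).integrableOn hc1.measurable]
      congr 1
      ext t
      have hδ := h.pos i
      have : ∫ y in A i, (1 - ⟪n i, c + t • (y - c) - c⟫ / δ i) *
          (s * χ (c + s • (c + t • (y - c) - c))) ∂(hyperplaneMeasure (n i) (⟪n i, c⟫ + δ i)) =
          ∫ y in A i, ((1 - t) * s) * χ (c + (s * t) • (y - c))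
            ∂(hyperplaneMeasure (n i) (⟪n i, c⟫ + δ i)) := by
        apply setIntegral_congr_fun (h.measurableSet_face i)
        intro y hy
        simp only [add_sub_cancel_left, smul_smul, inner_smul_right, hface i y hy,
          mul_div_cancel_right₀ t hδ.ne']
        ring
      rw [this, integral_const_mul]
      simp only [hX]
      ring
    have hcL : ∀ i, Continuous fun t : ℝ => ⟪n i, e⟫ * (t ^ (d - 1) * Φ i (s * t)) := fun i => by
      have := (hΦc i).comp (continuous_const_mul s); simp only [Function.comp_def] at this; fun_prop
    have hcR : ∀ i, Continuous fun t : ℝ =>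
        s * ((1 - t) * (δ i * (t ^ (d - 1) * X i (s * t)))) := fun i => by
      have := (hXc i).comp (continuous_const_mul s); simp only [Function.comp_def] at this; fun_prop
    simp only [hL, hR] at key
    rw [← intervalIntegral.integral_finsetSum fun i _ => (hcL i).intervalIntegrable _ _,
      ← intervalIntegral.integral_finsetSum fun i _ => (hcR i).intervalIntegrable _ _] at key
    have e1 := intervalIntegral.smul_integral_comp_mul_left (a := 0) (b := 1) a s
    have e2 := intervalIntegral.smul_integral_comp_mul_left (a := 0) (b := 1)
      (fun t => (s - t) * b t) s
    rw [mul_zero, mul_one, smul_eq_mul] at e1 e2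
    rw [← e1, ← e2]
    congr 1
    have e3 : ∫ t in (0 : ℝ)..1, a (s * t) = s ^ (d - 1) *
        ∫ t in (0 : ℝ)..1, ∑ i, ⟪n i, e⟫ * (t ^ (d - 1) * Φ i (s * t)) := by
      rw [← intervalIntegral.integral_const_mul]
      congr 1
      ext t
      simp only [ha, Finset.mul_sum, mul_pow]
      refine Finset.sum_congr rfl fun i _ => by ring
    rw [e3, key, ← intervalIntegral.integral_const_mul]
    congr 1
    ext t
    simp only [hb, Finset.mul_sum, mul_pow]
    refine Finset.sum_congr rfl fun i _ => by ring
  -- differentiate at `s = 1`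
  have hd1 : HasDerivAt (fun s : ℝ => ∫ t in (0 : ℝ)..s, a t) (a 1) 1 :=
    intervalIntegral.integral_hasDerivAt_right (hac.intervalIntegrable _ _)
      (hac.stronglyMeasurableAtFilter _ _) hac.continuousAt
  have hb1 : HasDerivAt (fun s : ℝ => ∫ t in (0 : ℝ)..s, b t) (b 1) 1 :=
    intervalIntegral.integral_hasDerivAt_right (hbc.intervalIntegrable _ _)
      (hbc.stronglyMeasurableAtFilter _ _) hbc.continuousAt
  have htb : Continuous fun t : ℝ => t * b t := by fun_prop
  have hb2 : HasDerivAt (fun s : ℝ => ∫ t in (0 : ℝ)..s, t * b t) (1 * b 1) 1 :=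
    intervalIntegral.integral_hasDerivAt_right (htb.intervalIntegrable _ _)
      (htb.stronglyMeasurableAtFilter _ _) htb.continuousAt
  -- The weight `s - t` is split as `s ∫ b - ∫ t b`. At `s = 1` the two boundary terms `b 1` cancel
  -- and the derivative is `∫ b`, which is the volume integral in cone coordinates.
  have hb3 := ((hasDerivAt_id (1 : ℝ)).mul hb1).sub hb2
  have hev : (fun s : ℝ => ∫ t in (0 : ℝ)..s, a t) =ᶠ[𝓝 1]
      (id * fun s : ℝ => ∫ t in (0 : ℝ)..s, b t) - fun s : ℝ => ∫ t in (0 : ℝ)..s, t * b t := by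
    filter_upwards [lt_mem_nhds (zero_lt_one (α := ℝ))] with s hs
    rw [scaled s hs]
    simp only [Pi.sub_apply, Pi.mul_apply, id]
    rw [← intervalIntegral.integral_const_mul, ← intervalIntegral.integral_sub]
    · congr 1; ext t; ring
    · exact (by fun_prop : Continuous fun t => s * b t).intervalIntegrable _ _
    · exact htb.intervalIntegrable _ _
  have heq := hd1.unique (hb3.congr_of_eventuallyEq hev)
  simp only [id, one_mul, add_sub_cancel_right] at heq
  have e4 : a 1 = ∑ i, ⟪n i, e⟫ * ∫ y in A i, φ y ∂(hyperplaneMeasure (n i) (⟪n i, c⟫ + δ i)) := by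
    simp [ha, hΦ]
  rw [← e4, heq, h.setIntegral_eq_sum hd hχint.integrableOn,
    intervalIntegral.integral_finsetSum]
  · refine Finset.sum_congr rfl fun i _ => ?_
    rw [integral_coneSet (h.norm_eq i) (h.pos i) (h.face_subset i) (h.measurableSet_face i)
      hχint.integrableOn hχcont.measurable]
    congr 1; ext t; simp only [hX]; ring
  · intro i _
    have := hXc i
    exact (by fun_prop : Continuous fun t => δ i * (t ^ (d - 1) * X i t)).intervalIntegrable _ _

end IsStarCell

end HybridFV

/-! ### Cells of a discretisation: normals, volumes and the discrete Stokes formula. -/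

namespace HybridFV

variable {d : ℕ}

/-- Since a face is relatively open, a small shift against the outward normal keeps the radial
projection in the face, and so enters the cone over it. -/
theorem IsStarCell.eventually_sub_smul_mem {I : Type*} {K : Set (Eucl d)} {c : Eucl d}
    {n : I → Eucl d} {δ : I → ℝ} {A : I → Set (Eucl d)} [Finite I]
    (h : IsStarCell K c n δ A) {i : I} {y : Eucl d} (hy : y ∈ A i) :
    ∀ᶠ t : ℝ in 𝓝[>] 0, y - t • n i ∈ K := by
  obtain ⟨U, hUo, hU⟩ := h.relOpen i
  have hδ := h.pos i
  have hyU : y ∈ U := by rw [hU] at hy; exact hy.1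
  have hyi := h.inner_of_mem (subset_closure hy)
  have hc : ContinuousAt (fun t : ℝ => c + ((δ i - t) / δ i)⁻¹ • (y - t • n i - c)) 0 := by
    apply ContinuousAt.add continuousAt_const
    apply ContinuousAt.fun_smul
    · apply ContinuousAt.inv₀ (by fun_prop)
      simp [hδ.ne']
    · fun_prop
  have hval : c + ((δ i - 0) / δ i)⁻¹ • (y - (0 : ℝ) • n i - c) = y := by
    simp [hδ.ne']
  have hev : ∀ᶠ t in 𝓝 (0 : ℝ), c + ((δ i - t) / δ i)⁻¹ • (y - t • n i - c) ∈ U := by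
    apply hc.eventually_mem
    rw [hval]; exact hUo.mem_nhds hyU
  filter_upwards [hev.filter_mono nhdsWithin_le_nhds, Ioo_mem_nhdsGT hδ] with t ht1 ht2
  apply h.coneSet_subset i
  have e1 : ⟪n i, y - t • n i - c⟫ = δ i - t := by
    have : y - t • n i - c = (y - c) - t • n i := by abel
    rw [this, inner_sub_right, hyi, inner_smul_right, real_inner_self_eq_norm_sq, h.norm_eq]
    ring
  rw [mem_coneSet_iff hδ (h.face_subset i), e1]
  have h3 : 0 < δ i - t := sub_pos.2 ht2.2
  refine ⟨⟨by positivity, (div_lt_one hδ).2 (by linarith [ht2.1])⟩, ?_⟩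
  rw [hU]
  refine ⟨ht1, ?_⟩
  rw [hyperplane, mem_ofPred_eq, inner_add_right, inner_smul_right, e1]
  field_simp

theorem infDist_hyperplane {ν : Eucl d} (hν : ‖ν‖ = 1) (c : ℝ) (x : Eucl d) :
    Metric.infDist x (hyperplane ν c) = |⟪ν, x⟫ - c| := by
  have hνν : ⟪ν, ν⟫ = 1 := by rw [real_inner_self_eq_norm_sq, hν]; norm_num
  have hmem : x - (⟪ν, x⟫ - c) • ν ∈ hyperplane ν c := by
    rw [hyperplane, mem_ofPred_eq, inner_sub_right, inner_smul_right, hνν]; ring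
  apply le_antisymm
  · refine (Metric.infDist_le_dist_of_mem hmem).trans ?_
    rw [dist_eq_norm, sub_sub_cancel, norm_smul, hν, mul_one, Real.norm_eq_abs]
  · rw [Metric.le_infDist ⟨_, hmem⟩]
    intro y hy
    rw [hyperplane, mem_ofPred_eq] at hy
    rw [← hy, ← inner_sub_right, dist_eq_norm]
    simpa [hν] using abs_real_inner_le_norm ν (x - y)

namespace Discretisation

variable {Ω : Set (Eucl d)} (D : Discretisation Ω)

theorem norm_outNormal (K : D.Vol) (σ : D.Edge) : ‖D.outNormal K σ‖ = 1 := by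
  unfold outNormal; split_ifs
  · exact D.norm_normal σ
  · rw [norm_neg]; exact D.norm_normal σ

/-- Rewrites the equation of the hyperplane of a face in the form required by `IsStarCell`, up to a
simultaneous change of sign of the normal and of the offset. -/
theorem outNormal_offset (K : D.Vol) (σ : D.Edge) :
    (D.outNormal K σ = D.normal σ ∧
      ⟪D.outNormal K σ, D.center K⟫ + D.dist K σ = D.offset σ) ∨
    (D.outNormal K σ = - D.normal σ ∧
      ⟪D.outNormal K σ, D.center K⟫ + D.dist K σ = - D.offset σ) := by
  unfold outNormal Discretisation.dist
  rw [infDist_hyperplane (D.norm_normal σ)]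
  split_ifs with h
  · left; refine ⟨rfl, ?_⟩
    rw [abs_of_neg (by linarith)]; ring
  · right; refine ⟨rfl, ?_⟩
    rw [abs_of_nonneg (by linarith), inner_neg_left]; ring

theorem hyperplane_outNormal (K : D.Vol) (σ : D.Edge) :
    hyperplane (D.outNormal K σ) (⟪D.outNormal K σ, D.center K⟫ + D.dist K σ) =
      hyperplane (D.normal σ) (D.offset σ) := by
  rcases D.outNormal_offset K σ with ⟨h1, h2⟩ | ⟨h1, h2⟩
  · rw [h2, h1]
  · rw [h2, h1]
    ext x
    simp [hyperplane, inner_neg_left]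

theorem hyperplaneMeasure_outNormal (K : D.Vol) (σ : D.Edge) :
    hyperplaneMeasure (D.outNormal K σ) (⟪D.outNormal K σ, D.center K⟫ + D.dist K σ) =
      hyperplaneMeasure (D.normal σ) (D.offset σ) := by
  rcases D.outNormal_offset K σ with ⟨h1, h2⟩ | ⟨h1, h2⟩
  · rw [h2, h1]
  · rw [h2, h1, hyperplaneMeasure_neg]

theorem isStarCell (hΩ : Bornology.IsBounded Ω) (K : D.Vol) :
    IsStarCell (D.cell K) (D.center K) (fun σ : D.edges K => D.outNormal K σ)
      (fun σ => D.dist K σ) (fun σ => D.face σ) where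
  isOpen := D.cell_open K
  isBounded := hΩ.subset (D.cell_subset K)
  star := D.starShaped K
  center_mem := D.center_mem K
  norm_eq := fun σ => D.norm_outNormal K σ
  pos := fun σ => D.dist_pos K σ σ.2
  relOpen := fun σ => by
    rw [D.hyperplane_outNormal]; exact D.face_relOpen σ
  null := fun σ => by
    rw [D.hyperplaneMeasure_outNormal]; exact D.face_boundary_null σ
  disj := fun σ τ h => D.face_disjoint _ _ fun h' => h (Subtype.ext h')
  frontier_eq := by
    rw [D.frontier_cell, iUnion_subtype]

/-- The measure on a face. -/
noncomputable abbrev faceMeasure (σ : D.Edge) : Measure (Eucl d) :=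
  (hyperplaneMeasure (D.normal σ) (D.offset σ)).restrict (D.face σ)

theorem measurableSet_face (σ : D.Edge) : MeasurableSet (D.face σ) := by
  obtain ⟨U, hUo, hU⟩ := D.face_relOpen σ
  rw [hU]; exact hUo.measurableSet.inter (isClosed_hyperplane _ _).measurableSet

theorem measurableSet_cell (K : D.Vol) : MeasurableSet (D.cell K) := (D.cell_open K).measurableSet

theorem isFiniteMeasure_faceMeasure (hΩ : Bornology.IsBounded Ω) (σ : D.Edge) :
    IsFiniteMeasure (D.faceMeasure σ) := by
  constructor
  simpa using hyperplaneMeasure_lt_top_of_isBounded _ _ (hΩ.closure.subset (D.face_subset σ))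

theorem area_pos (hΩ : Bornology.IsBounded Ω) (σ : D.Edge) : 0 < D.area σ :=
  ENNReal.toReal_pos (D.face_measure_pos σ).ne'
    (hyperplaneMeasure_lt_top_of_isBounded _ _ (hΩ.closure.subset (D.face_subset σ))).ne

theorem faceMeasure_real_univ (σ : D.Edge) : (D.faceMeasure σ).real univ = D.area σ := by
  simp [area]

theorem vol_pos (hΩ : Bornology.IsBounded Ω) (K : D.Vol) : 0 < D.vol K :=
  ENNReal.toReal_pos ((D.cell_open K).measure_pos _ (D.cell_nonempty K)).ne'
    (hΩ.subset (D.cell_subset K)).measure_lt_top.ne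

theorem measurableSet_cone (hΩ : Bornology.IsBounded Ω) {K : D.Vol} {σ : D.Edge}
    (hσ : σ ∈ D.edges K) : MeasurableSet (D.cone K σ) :=
  ((D.isStarCell hΩ K).isOpen_coneSet ⟨σ, hσ⟩).measurableSet

theorem cone_subset_cell (hΩ : Bornology.IsBounded Ω) {K : D.Vol} {σ : D.Edge}
    (hσ : σ ∈ D.edges K) : D.cone K σ ⊆ D.cell K :=
  (D.isStarCell hΩ K).coneSet_subset ⟨σ, hσ⟩

theorem disjoint_cone (hΩ : Bornology.IsBounded Ω) {K : D.Vol} {σ τ : D.Edge}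
    (hσ : σ ∈ D.edges K) (hτ : τ ∈ D.edges K) (h : σ ≠ τ) :
    Disjoint (D.cone K σ) (D.cone K τ) :=
  (D.isStarCell hΩ K).disjoint_coneSet (i := ⟨σ, hσ⟩) (j := ⟨τ, hτ⟩)
    fun h' => h (congrArg Subtype.val h')

theorem setIntegral_cell_eq_sum_cone (hΩ : Bornology.IsBounded Ω) (hd : 0 < d) (K : D.Vol)
    {V : Type*} [NormedAddCommGroup V] [NormedSpace ℝ V] {F : Eucl d → V}
    (hF : IntegrableOn F (D.cell K)) :
    ∫ x in D.cell K, F x = ∑ σ ∈ D.edges K, ∫ x in D.cone K σ, F x := by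
  rw [(D.isStarCell hΩ K).setIntegral_eq_sum hd hF]
  exact Finset.sum_coe_sort (D.edges K) fun σ => ∫ x in D.cone K σ, F x

theorem integral_cone (hΩ : Bornology.IsBounded Ω) {K : D.Vol} {σ : D.Edge} (hσ : σ ∈ D.edges K)
    {F : Eucl d → ℝ} (hF : IntegrableOn F (D.cone K σ)) (hFm : Measurable F) :
    ∫ x in D.cone K σ, F x = ∫ t in (0 : ℝ)..1, D.dist K σ * t ^ (d - 1) *
      ∫ y, F (D.center K + t • (y - D.center K)) ∂(D.faceMeasure σ) := by
  have h := D.isStarCell hΩ K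
  have := integral_coneSet (h.norm_eq ⟨σ, hσ⟩) (h.pos ⟨σ, hσ⟩) (h.face_subset ⟨σ, hσ⟩)
    (h.measurableSet_face ⟨σ, hσ⟩) hF hFm
  simp only [D.hyperplaneMeasure_outNormal] at this
  exact this

/-- The volume of a cone: integrate `t ^ (d - 1)` over the unit interval in cone coordinates. -/
theorem area_mul_dist (hΩ : Bornology.IsBounded Ω) (hd : 0 < d) {K : D.Vol} {σ : D.Edge}
    (hσ : σ ∈ D.edges K) : D.area σ * D.dist K σ = d * volume.real (D.cone K σ) := by
  have hfin : volume (D.cone K σ) < ⊤ :=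
    (hΩ.subset ((D.cone_subset_cell hΩ hσ).trans (D.cell_subset K))).measure_lt_top
  have := D.integral_cone hΩ hσ (F := fun _ => 1) (integrableOn_const hfin.ne) measurable_const
  rw [setIntegral_const, smul_eq_mul, mul_one] at this
  simp only [integral_const, smul_eq_mul, mul_one, faceMeasure_real_univ] at this
  rw [this]
  have h2 : ∀ t : ℝ, D.dist K σ * t ^ (d - 1) * D.area σ = (D.dist K σ * D.area σ) * t ^ (d - 1) :=
    fun t => by ring
  simp only [h2, intervalIntegral.integral_const_mul, integral_pow]
  have hd' : (d : ℝ) ≠ 0 := by exact_mod_cast hd.ne'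
  have h3 : ((d - 1 : ℕ) : ℝ) + 1 = d := by
    rw [← Nat.cast_add_one, Nat.sub_add_cancel hd]
  rw [Nat.sub_add_cancel hd, h3]
  simp [hd.ne']
  field_simp

theorem sum_volume_cone (hΩ : Bornology.IsBounded Ω) (hd : 0 < d) (K : D.Vol) :
    ∑ σ ∈ D.edges K, volume.real (D.cone K σ) = D.vol K := by
  have hfin : volume (D.cell K) < ⊤ := (hΩ.subset (D.cell_subset K)).measure_lt_top
  have := D.setIntegral_cell_eq_sum_cone hΩ hd K (F := fun _ => (1 : ℝ))
    (integrableOn_const hfin.ne)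
  simp only [setIntegral_const, smul_eq_mul, mul_one] at this
  exact this.symm

theorem sum_area_mul_dist (hΩ : Bornology.IsBounded Ω) (hd : 0 < d) (K : D.Vol) :
    ∑ σ ∈ D.edges K, D.area σ * D.dist K σ = d * D.vol K := by
  rw [← D.sum_volume_cone hΩ hd K, Finset.mul_sum]
  exact Finset.sum_congr rfl fun σ hσ => D.area_mul_dist hΩ hd hσ

theorem integral_fderiv_cell (hΩ : Bornology.IsBounded Ω) (hd : 0 < d) (K : D.Vol)
    {φ : Eucl d → ℝ} (hφ : ContDiff ℝ 1 φ) (e : Eucl d) :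
    ∫ x in D.cell K, fderiv ℝ φ x e =
      ∑ σ ∈ D.edges K, ⟪D.outNormal K σ, e⟫ * ∫ y, φ y ∂(D.faceMeasure σ) := by
  have h := D.isStarCell hΩ K
  obtain ⟨R, hR0, hR⟩ := hΩ.closure.subset_ball_lt 0 0
  -- A bump function equal to `1` on a ball that contains the closure of `Ω` removes the need for
  -- compact support. This matters because the formula is later applied to affine functions.
  let χ : ContDiffBump (0 : Eucl d) := ⟨R, R + 1, hR0, by linarith⟩
  have hψ : ContDiff ℝ 1 fun x => χ x * φ x := χ.contDiff.mul hφ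
  have hψc : HasCompactSupport fun x => χ x * φ x := χ.hasCompactSupport.mul_right
  have heq : ∀ x ∈ Metric.ball (0 : Eucl d) R, χ x * φ x = φ x := by
    intro x hx
    rw [χ.one_of_mem_closedBall (Metric.ball_subset_closedBall hx), one_mul]
  have key := h.integral_fderiv_eq_of_hasCompactSupport hd hψ hψc e
  simp only [D.hyperplaneMeasure_outNormal] at key
  have hL : ∫ x in D.cell K, fderiv ℝ φ x e =
      ∫ x in D.cell K, fderiv ℝ (fun x => χ x * φ x) x e := by
    apply setIntegral_congr_fun (D.measurableSet_cell K)
    intro x hx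
    have hxR : x ∈ Metric.ball (0 : Eucl d) R := hR (subset_closure (D.cell_subset K hx))
    have : (fun x => χ x * φ x) =ᶠ[𝓝 x] φ := by
      filter_upwards [Metric.isOpen_ball.mem_nhds hxR] with z hz using heq z hz
    simp only [this.fderiv_eq]
  rw [hL, key, ← Finset.sum_coe_sort (D.edges K)]
  refine Finset.sum_congr rfl fun σ _ => ?_
  congr 1
  apply setIntegral_congr_fun (D.measurableSet_face σ)
  intro y hy
  exact heq y (hR (D.face_subset σ hy))

/-- If the two outward normals coincided, a point of the face shifted slightly inwards would belong
to both cells, which are disjoint. -/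
theorem outNormal_eq_neg (hΩ : Bornology.IsBounded Ω) {K L : D.Vol} (hKL : K ≠ L) {σ : D.Edge}
    (hK : σ ∈ D.edges K) (hL : σ ∈ D.edges L) : D.outNormal L σ = - D.outNormal K σ := by
  obtain ⟨y, hy⟩ := D.face_nonempty σ
  have h1 := (D.isStarCell hΩ K).eventually_sub_smul_mem (i := ⟨σ, hK⟩) hy
  have h2 := (D.isStarCell hΩ L).eventually_sub_smul_mem (i := ⟨σ, hL⟩) hy
  have hne : D.outNormal L σ ≠ D.outNormal K σ := by
    intro heq
    simp only [heq] at h2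
    obtain ⟨t, ht1, ht2⟩ := (h1.and h2).exists
    exact Set.disjoint_left.1 (D.cell_disjoint K L hKL) ht1 ht2
  rcases D.outNormal_offset K σ with ⟨hk, -⟩ | ⟨hk, -⟩ <;>
    rcases D.outNormal_offset L σ with ⟨hl, -⟩ | ⟨hl, -⟩
  · exact absurd (hl.trans hk.symm) hne
  · rw [hk, hl]
  · rw [hk, hl, neg_neg]
  · exact absurd (hl.trans hk.symm) hne

theorem mem_extEdges_or (σ : D.Edge) : σ ∈ D.extEdges ∨ σ ∈ D.intEdges := by
  rcases D.neighbours σ with ⟨h, -⟩ | h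
  · left; exact h
  · right; exact h

theorem extEdges_subset_frontier {σ : D.Edge} (hσ : σ ∈ D.extEdges) : D.face σ ⊆ frontier Ω := by
  rcases D.neighbours σ with ⟨-, h⟩ | h
  · exact h
  · have h1 : (D.nbr σ).ncard = 1 := hσ
    have h2 : (D.nbr σ).ncard = 2 := h
    omega

theorem exists_mem_edges (σ : D.Edge) : ∃ K, σ ∈ D.edges K := by
  have : (D.nbr σ).ncard ≠ 0 := by
    rcases D.neighbours σ with ⟨h, -⟩ | h
    · have h1 : (D.nbr σ).ncard = 1 := h
      omega
    · have h1 : (D.nbr σ).ncard = 2 := h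
      omega
  exact nonempty_of_ncard_ne_zero this

/-- Conservativity: the contributions of the two sides of the interior faces cancel. -/
theorem sum_outNormal_eq_zero (hΩ : Bornology.IsBounded Ω) {z : D.Edge → ℝ}
    (hz : ∀ σ ∈ D.extEdges, z σ = 0) (e : Eucl d) :
    ∑ K, ∑ σ ∈ D.edges K, z σ * ⟪D.outNormal K σ, e⟫ = 0 := by
  classical
  rw [Finset.sum_comm' (t' := Finset.univ) (s' := fun σ => Finset.univ.filter fun K => σ ∈ D.edges K)
    (by simp)]
  refine Finset.sum_eq_zero fun σ _ => ?_
  rcases D.mem_extEdges_or σ with h | h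
  · simp [hz σ h]
  · obtain ⟨K, L, hKL, hn⟩ := ncard_eq_two.1 (h : (D.nbr σ).ncard = 2)
    have hK : σ ∈ D.edges K := by
      have : K ∈ D.nbr σ := by rw [hn]; simp
      exact this
    have hL : σ ∈ D.edges L := by
      have : L ∈ D.nbr σ := by rw [hn]; simp
      exact this
    have hf : (Finset.univ.filter fun K => σ ∈ D.edges K) = {K, L} := by
      ext M
      have : M ∈ D.nbr σ ↔ M ∈ ({K, L} : Set D.Vol) := by rw [hn]
      simpa [nbr] using this
    rw [hf, Finset.sum_pair hKL, D.outNormal_eq_neg hΩ hKL hK hL, inner_neg_left]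
    ring

/-- Discrete integration by parts. -/
theorem sum_mul_integral_fderiv (hΩ : Bornology.IsBounded Ω) (hd : 0 < d) (a : D.Vol → ℝ)
    {b : D.Edge → ℝ} (hb : ∀ σ ∈ D.extEdges, b σ = 0) {φ : Eucl d → ℝ} (hφ : ContDiff ℝ 1 φ)
    (e : Eucl d) :
    ∑ K, a K * ∫ x in D.cell K, fderiv ℝ φ x e =
      ∑ K, ∑ σ ∈ D.edges K, (a K - b σ) * ⟪D.outNormal K σ, e⟫ * ∫ y, φ y ∂(D.faceMeasure σ) := by
  have h0 := D.sum_outNormal_eq_zero hΩ (z := fun σ => b σ * ∫ y, φ y ∂(D.faceMeasure σ))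
    (fun σ hσ => by rw [hb σ hσ, zero_mul]) e
  rw [← sub_zero (∑ K, a K * _), ← h0, ← Finset.sum_sub_distrib]
  refine Finset.sum_congr rfl fun K _ => ?_
  rw [D.integral_fderiv_cell hΩ hd K hφ e, Finset.mul_sum, ← Finset.sum_sub_distrib]
  refine Finset.sum_congr rfl fun σ _ => ?_
  ring

end Discretisation

end HybridFV

namespace HybridFV

variable {d : ℕ}

namespace Discretisation

variable {Ω : Set (Eucl d)} (D : Discretisation Ω)

/-! ### Geometric bounds -/

theorem isBounded_cell (hΩ : Bornology.IsBounded Ω) (K : D.Vol) : Bornology.IsBounded (D.cell K) :=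
  hΩ.subset (D.cell_subset K)

theorem face_subset_closure_cell {K : D.Vol} {σ : D.Edge} (hσ : σ ∈ D.edges K) :
    D.face σ ⊆ closure (D.cell K) := by
  intro y hy
  apply frontier_subset_closure
  rw [D.frontier_cell]
  exact mem_biUnion hσ (subset_closure hy)

theorem dist_le_diam_of_mem_closure (hΩ : Bornology.IsBounded Ω) {K : D.Vol} {x y : Eucl d}
    (hx : x ∈ closure (D.cell K)) (hy : y ∈ closure (D.cell K)) : ‖x - y‖ ≤ D.diam K := by
  rw [← dist_eq_norm, diam, ← Metric.diam_closure]
  exact Metric.dist_le_diam_of_mem (D.isBounded_cell hΩ K).closure hx hy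

theorem diam_nonneg (K : D.Vol) : 0 ≤ D.diam K := Metric.diam_nonneg

theorem integrable_face (hΩ : Bornology.IsBounded Ω) (σ : D.Edge) {V : Type*}
    [NormedAddCommGroup V] {F : Eucl d → V} (hF : Continuous F) :
    Integrable F (D.faceMeasure σ) := by
  have := D.isFiniteMeasure_faceMeasure hΩ σ
  have hcomp : IsCompact (closure Ω) := hΩ.isCompact_closure
  obtain ⟨C, hC⟩ := hcomp.exists_bound_of_continuousOn hF.continuousOn
  apply Integrable.of_bound hF.aestronglyMeasurable C
  filter_upwards [ae_restrict_mem (D.measurableSet_face σ)] with y hy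
  exact hC y (D.face_subset σ hy)

theorem integral_id_face (hΩ : Bornology.IsBounded Ω) (σ : D.Edge) :
    ∫ y, y ∂(D.faceMeasure σ) = D.area σ • D.bary σ := by
  have h := D.area_pos hΩ σ
  unfold bary
  rw [average_eq, D.faceMeasure_real_univ, smul_smul, mul_inv_cancel₀ h.ne', one_smul]

theorem integral_inner_face (hΩ : Bornology.IsBounded Ω) (σ : D.Edge) (g c : Eucl d) :
    ∫ y, ⟪g, y - c⟫ ∂(D.faceMeasure σ) = D.area σ * ⟪g, D.bary σ - c⟫ := by
  have := D.isFiniteMeasure_faceMeasure hΩ σ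
  have hi : Integrable (fun y => y) (D.faceMeasure σ) := D.integrable_face hΩ σ continuous_id
  have hi2 : Integrable (fun y : Eucl d => y - c) (D.faceMeasure σ) := hi.sub (integrable_const c)
  rw [integral_inner (𝕜 := ℝ) hi2 g, integral_sub hi (integrable_const c), D.integral_id_face hΩ, integral_const,
    D.faceMeasure_real_univ, ← smul_sub, inner_smul_right]

theorem bary_mem_convexHull (hΩ : Bornology.IsBounded Ω) (σ : D.Edge) {s : Set (Eucl d)}
    (hs : Convex ℝ s) (hsc : IsClosed s) (h : D.face σ ⊆ s) : D.bary σ ∈ s := by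
  have := D.isFiniteMeasure_faceMeasure hΩ σ
  have : NeZero (D.faceMeasure σ) := by
    constructor
    intro h0
    have := D.face_measure_pos σ
    rw [Measure.restrict_eq_zero] at h0
    exact this.ne' h0
  apply hs.average_mem hsc
  · filter_upwards [ae_restrict_mem (D.measurableSet_face σ)] with y hy using h hy
  · exact D.integrable_face hΩ σ continuous_id

theorem norm_bary_sub_le (hΩ : Bornology.IsBounded Ω) {K : D.Vol} {σ : D.Edge}
    (hσ : σ ∈ D.edges K) {x : Eucl d} (hx : x ∈ closure (D.cell K)) :
    ‖D.bary σ - x‖ ≤ D.diam K := by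
  rw [← dist_eq_norm, ← Metric.mem_closedBall]
  apply D.bary_mem_convexHull hΩ σ (convex_closedBall _ _) Metric.isClosed_closedBall
  intro y hy
  rw [Metric.mem_closedBall, dist_eq_norm]
  exact D.dist_le_diam_of_mem_closure hΩ (D.face_subset_closure_cell hσ hy) hx

theorem center_mem_closure (K : D.Vol) : D.center K ∈ closure (D.cell K) :=
  subset_closure (D.center_mem K)

theorem dist_le_diam (hΩ : Bornology.IsBounded Ω) {K : D.Vol} {σ : D.Edge}
    (hσ : σ ∈ D.edges K) : D.dist K σ ≤ D.diam K := by
  obtain ⟨y, hy⟩ := D.face_nonempty σ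
  have h1 : y ∈ hyperplane (D.normal σ) (D.offset σ) := by
    obtain ⟨U, -, hU⟩ := D.face_relOpen σ
    rw [hU] at hy; exact hy.2
  refine (Metric.infDist_le_dist_of_mem h1).trans ?_
  rw [dist_eq_norm]
  exact D.dist_le_diam_of_mem_closure hΩ (D.center_mem_closure K) (D.face_subset_closure_cell hσ hy)

theorem dist_pos' {K : D.Vol} {σ : D.Edge} (hσ : σ ∈ D.edges K) : 0 < D.dist K σ :=
  D.dist_pos K σ hσ

theorem diam_le_size (K : D.Vol) : D.diam K ≤ D.size :=
  le_ciSup (f := D.diam) (Set.finite_range _).bddAbove K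

theorem size_nonneg : 0 ≤ D.size := Real.iSup_nonneg D.diam_nonneg

/-- Strict positivity is used twice in the convergence proof: as slack for near-minimisers, and to
exclude finitely many given meshes once `h` is small. -/
theorem size_pos (hΩ : Bornology.IsBounded Ω) (hd : 0 < d) (hne : Ω.Nonempty) : 0 < D.size := by
  obtain ⟨x, hx⟩ := hne
  have : x ∈ ⋃ K, closure (D.cell K) := D.closure_eq ▸ subset_closure hx
  obtain ⟨K, -⟩ := mem_iUnion.1 this
  obtain ⟨⟨σ, hσ⟩⟩ := (D.isStarCell hΩ K).nonempty_index hd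
  exact (D.dist_pos' hσ).trans_le ((D.dist_le_diam hΩ hσ).trans (D.diam_le_size K))

theorem diam_le_theta {B : Set D.Edge} {β : D.Edge → D.Vol → ℝ} {θ : ℝ} (h : D.thetaB B β ≤ θ)
    {K : D.Vol} {σ : D.Edge} (hσ : σ ∈ D.edges K) : D.diam K ≤ θ * D.dist K σ := by
  rw [← div_le_iff₀ (D.dist_pos' hσ)]
  have h1 : D.theta ≤ θ := (le_max_left _ _).trans h
  have h2 := (le_max_right _ _).trans h1
  refine le_trans ?_ h2
  exact le_ciSup (f := fun p : {p : D.Vol × D.Edge // p.2 ∈ D.edges p.1} =>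
    D.diam p.1.1 / D.dist p.1.1 p.1.2) (Set.finite_range _).bddAbove ⟨(K, σ), hσ⟩

theorem sum_abs_mul_sq_le_theta {B : Set D.Edge} {β : D.Edge → D.Vol → ℝ} {θ : ℝ}
    (hΩ : Bornology.IsBounded Ω) (h : D.thetaB B β ≤ θ)
    {K : D.Vol} {σ : D.Edge} (hσ : σ ∈ D.edges K) (hσB : σ ∈ B) :
    ∑ L, |β σ L| * ‖D.center L - D.bary σ‖ ^ 2 ≤ θ * D.diam K ^ 2 := by
  have hp : 0 < D.diam K := (D.dist_pos' hσ).trans_le (D.dist_le_diam hΩ hσ)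
  rw [← div_le_iff₀ (by positivity)]
  refine le_trans ?_ ((le_max_right _ _).trans h)
  exact le_ciSup (f := fun p : {p : D.Vol × D.Edge // p.2 ∈ D.edges p.1 ∧ p.2 ∈ B} =>
    (∑ L, |β p.1.2 L| * ‖D.center L - D.bary p.1.2‖ ^ 2) / D.diam p.1.1 ^ 2)
    (Set.finite_range _).bddAbove ⟨(K, σ), hσ, hσB⟩

/-! ### The cells cover the domain up to a null set -/

theorem ae_exists_mem_cell (hΩ : Bornology.IsBounded Ω) :
    ∀ᵐ x, x ∈ Ω → ∃ K, x ∈ D.cell K := by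
  have h1 : ∀ᵐ x : Eucl d, ∀ K, x ∉ frontier (D.cell K) := by
    rw [ae_all_iff]
    intro K
    exact measure_eq_zero_iff_ae_notMem.1 (D.isStarCell hΩ K).volume_frontier
  filter_upwards [h1] with x hx hxΩ
  have : x ∈ ⋃ K, closure (D.cell K) := D.closure_eq ▸ subset_closure hxΩ
  obtain ⟨K, hK⟩ := mem_iUnion.1 this
  refine ⟨K, ?_⟩
  by_contra hcon
  exact hx K ⟨hK, by rwa [(D.cell_open K).interior_eq]⟩

theorem ae_eq_iUnion_cell (hΩ : Bornology.IsBounded Ω) : Ω =ᵐ[volume] ⋃ K, D.cell K := by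
  filter_upwards [D.ae_exists_mem_cell hΩ] with x hx
  exact propext ⟨fun h => mem_iUnion.2 (hx h), fun h => (iUnion_subset D.cell_subset) h⟩

theorem setIntegral_eq_sum_cell (hΩ : Bornology.IsBounded Ω) {V : Type*} [NormedAddCommGroup V]
    [NormedSpace ℝ V] {F : Eucl d → V} (hF : IntegrableOn F Ω) :
    ∫ x in Ω, F x = ∑ K, ∫ x in D.cell K, F x := by
  rw [setIntegral_congr_set (D.ae_eq_iUnion_cell hΩ)]
  exact integral_iUnion_fintype D.measurableSet_cell (fun K L h => D.cell_disjoint K L h)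
    fun K => hF.mono_set (D.cell_subset K)

theorem setIntegral_eq_sum_cone (hΩ : Bornology.IsBounded Ω) (hd : 0 < d) {V : Type*}
    [NormedAddCommGroup V] [NormedSpace ℝ V] {F : Eucl d → V} (hF : IntegrableOn F Ω) :
    ∫ x in Ω, F x = ∑ K, ∑ σ ∈ D.edges K, ∫ x in D.cone K σ, F x := by
  rw [D.setIntegral_eq_sum_cell hΩ hF]
  exact Finset.sum_congr rfl fun K _ =>
    D.setIntegral_cell_eq_sum_cone hΩ hd K (hF.mono_set (D.cell_subset K))

theorem sum_vol (hΩ : Bornology.IsBounded Ω) : ∑ K, D.vol K = volume.real Ω := by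
  have := D.setIntegral_eq_sum_cell hΩ (F := fun _ => (1 : ℝ))
    (integrableOn_const hΩ.measure_lt_top.ne)
  simp only [setIntegral_const, smul_eq_mul, mul_one] at this
  exact this.symm

theorem sum_sum_area_mul_dist (hΩ : Bornology.IsBounded Ω) (hd : 0 < d) :
    ∑ K, ∑ σ ∈ D.edges K, D.area σ * D.dist K σ = d * volume.real Ω := by
  rw [← D.sum_vol hΩ, Finset.mul_sum]
  exact Finset.sum_congr rfl fun K _ => D.sum_area_mul_dist hΩ hd K

theorem piM_apply_of_mem (v : D.X) {K : D.Vol} {x : Eucl d} (hx : x ∈ D.cell K) :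
    D.piM v x = v.1 K := by
  unfold piM
  rw [Finset.sum_eq_single K, indicator_of_mem hx]
  · intro L _ hL
    exact indicator_of_notMem (fun h => Set.disjoint_left.1 (D.cell_disjoint L K hL) h hx) _
  · simp

theorem piM_apply_of_notMem (v : D.X) {x : Eucl d} (hx : x ∉ Ω) : D.piM v x = 0 := by
  unfold piM
  exact Finset.sum_eq_zero fun K _ => indicator_of_notMem (fun h => hx (D.cell_subset K h)) _

theorem measurable_piM (v : D.X) : Measurable (D.piM v) := by
  unfold piM
  exact Finset.measurable_fun_sum _ fun K _ => measurable_const.indicator (D.measurableSet_cell K)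

theorem exists_bound_piM (v : D.X) : ∃ C, ∀ x, ‖D.piM v x‖ ≤ C := by
  refine ⟨∑ K, ‖v.1 K‖, fun x => (norm_sum_le _ _).trans (Finset.sum_le_sum fun K _ => ?_)⟩
  exact norm_indicator_le_norm_self (f := fun _ => v.1 K) x

theorem integrable_of_bound_of_notMem {V : Type*} [NormedAddCommGroup V]
    (hΩ : Bornology.IsBounded Ω) (hΩo : IsOpen Ω) {F : Eucl d → V} (hF : AEStronglyMeasurable F)
    {C : ℝ} (hC : ∀ x, ‖F x‖ ≤ C) (h0 : ∀ x, x ∉ Ω → F x = 0) : Integrable F := by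
  have : IntegrableOn F Ω := IntegrableOn.of_bound hΩ.measure_lt_top hF.restrict C
    (Eventually.of_forall hC)
  rw [← integrable_indicator_iff hΩo.measurableSet] at this
  rwa [indicator_eq_self.2] at this
  intro x hx
  by_contra hxΩ
  exact hx (h0 x hxΩ)

theorem memLp_piM (hΩ : Bornology.IsBounded Ω) (hΩo : IsOpen Ω) (v : D.X) :
    MemLp (D.piM v) 2 := by
  obtain ⟨C, hC⟩ := D.exists_bound_piM v
  rw [memLp_two_iff_integrable_sq (D.measurable_piM v).aestronglyMeasurable]
  refine integrable_of_bound_of_notMem hΩ hΩo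
    ((D.measurable_piM v).pow_const 2).aestronglyMeasurable (C := C ^ 2) (fun x => ?_) fun x hx => ?_
  · rw [norm_pow]; gcongr; exact hC x
  · rw [D.piM_apply_of_notMem v hx]; norm_num

theorem setIntegral_piM_mul (hΩ : Bornology.IsBounded Ω) (v : D.X) {F : Eucl d → ℝ}
    (hF : IntegrableOn F Ω) :
    ∫ x in Ω, D.piM v x * F x = ∑ K, v.1 K * ∫ x in D.cell K, F x := by
  obtain ⟨C, hC⟩ := D.exists_bound_piM v
  rw [D.setIntegral_eq_sum_cell hΩ]
  · refine Finset.sum_congr rfl fun K _ => ?_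
    rw [← integral_const_mul]
    apply setIntegral_congr_fun (D.measurableSet_cell K)
    intro x hx
    simp only [D.piM_apply_of_mem v hx]
  · exact Integrable.bdd_mul hF (D.measurable_piM v).aestronglyMeasurable (Eventually.of_forall hC)

theorem setIntegral_piM_sq (hΩ : Bornology.IsBounded Ω) (v : D.X) :
    ∫ x in Ω, D.piM v x ^ 2 = ∑ K, D.vol K * v.1 K ^ 2 := by
  obtain ⟨C, hC⟩ := D.exists_bound_piM v
  rw [D.setIntegral_eq_sum_cell hΩ]
  · refine Finset.sum_congr rfl fun K _ => ?_
    rw [← smul_eq_mul, vol, ← setIntegral_const]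
    apply setIntegral_congr_fun (D.measurableSet_cell K)
    intro x hx
    simp only [D.piM_apply_of_mem v hx]
  · refine IntegrableOn.of_bound hΩ.measure_lt_top
      ((D.measurable_piM v).pow_const 2).aestronglyMeasurable (C ^ 2) (Eventually.of_forall fun x => ?_)
    rw [norm_pow]; gcongr; exact hC x

/-! ### Discrete functional inequalities -/

theorem normX_nonneg (v : D.X) : 0 ≤ D.normX v := Real.sqrt_nonneg _

theorem normX_sq (hΩ : Bornology.IsBounded Ω) (v : D.X) :
    D.normX v ^ 2 = ∑ K, ∑ σ ∈ D.edges K, D.area σ / D.dist K σ * (v.2 σ - v.1 K) ^ 2 := by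
  unfold normX
  rw [Real.sq_sqrt]
  refine Finset.sum_nonneg fun K _ => Finset.sum_nonneg fun σ hσ => ?_
  have h1 := D.area_pos hΩ σ
  have h2 := D.dist_pos' hσ
  positivity

/-- The Cauchy–Schwarz inequality in the form used for discrete gradients. -/
theorem sum_area_mul_le (hΩ : Bornology.IsBounded Ω) (v : D.X) (a : D.Vol → D.Edge → ℝ) :
    ∑ K, ∑ σ ∈ D.edges K, D.area σ * |v.2 σ - v.1 K| * a K σ ≤
      D.normX v * √(∑ K, ∑ σ ∈ D.edges K, D.area σ * D.dist K σ * a K σ ^ 2) := by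
  unfold normX
  simp only [Finset.sum_sigma']
  -- The weight `|σ|` is split as the product of `√(|σ| / d_{K,σ})`, which builds `|v|_X`, and
  -- `√(|σ| d_{K,σ})`.
  have key := Real.sum_mul_le_sqrt_mul_sqrt (Finset.univ.sigma D.edges)
    (fun p => √(D.area p.2 / D.dist p.1 p.2) * |v.2 p.2 - v.1 p.1|)
    (fun p => √(D.area p.2 * D.dist p.1 p.2) * a p.1 p.2)
  have hp : ∀ p ∈ Finset.univ.sigma D.edges, 0 < D.area p.2 ∧ 0 < D.dist p.1 p.2 := fun p hp =>
    ⟨D.area_pos hΩ _, D.dist_pos' (Finset.mem_sigma.1 hp).2⟩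
  convert key using 1
  · refine Finset.sum_congr rfl fun p h => ?_
    obtain ⟨h1, h2⟩ := hp p h
    have h3 : √(D.area p.2 / D.dist p.1 p.2) * √(D.area p.2 * D.dist p.1 p.2) = D.area p.2 := by
      rw [← Real.sqrt_mul (by positivity), div_mul_eq_mul_div, ← mul_assoc,
        mul_div_assoc, div_self h2.ne', mul_one, Real.sqrt_mul_self h1.le]
    rw [mul_mul_mul_comm, h3, mul_assoc]
  · congr 2
    · refine Finset.sum_congr rfl fun p h => ?_
      obtain ⟨h1, h2⟩ := hp p h
      rw [mul_pow, Real.sq_sqrt (by positivity), sq_abs]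
    · refine Finset.sum_congr rfl fun p h => ?_
      obtain ⟨h1, h2⟩ := hp p h
      rw [mul_pow, Real.sq_sqrt (by positivity)]

/-- Controls the jumps of `v²` and of `v|v|`. In the second Cauchy–Schwarz factor, `|v_σ| ≤ |v_K| +
|v_σ - v_K|`: the cell values give the `L²` norm through `∑ |σ| d_{K,σ} = d |K|`, and the
differences give `|v|_X` through `d_{K,σ} ≤ 2R`. -/
theorem sum_area_mul_add_le (hΩ : Bornology.IsBounded Ω) (hd : 0 < d) {R : ℝ}
    (hR : Ω ⊆ Metric.closedBall 0 R) (v : D.X) :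
    ∑ K, ∑ σ ∈ D.edges K, D.area σ * |v.2 σ - v.1 K| * (|v.1 K| + |v.2 σ|) ≤
      D.normX v * √(8 * d * (∑ K, D.vol K * v.1 K ^ 2) + 8 * R ^ 2 * D.normX v ^ 2) := by
  refine (D.sum_area_mul_le hΩ v fun K σ => |v.1 K| + |v.2 σ|).trans ?_
  gcongr
  · exact D.normX_nonneg v
  rw [D.normX_sq hΩ, Finset.mul_sum, Finset.mul_sum, ← Finset.sum_add_distrib]
  refine Finset.sum_le_sum fun K _ => ?_
  have h1 : 8 * d * (D.vol K * v.1 K ^ 2) =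
      ∑ σ ∈ D.edges K, 8 * (D.area σ * D.dist K σ * v.1 K ^ 2) := by
    rw [← Finset.mul_sum, ← Finset.sum_mul, D.sum_area_mul_dist hΩ hd K]; ring
  rw [h1, Finset.mul_sum, ← Finset.sum_add_distrib]
  refine Finset.sum_le_sum fun σ hσ => ?_
  have ha := D.area_pos hΩ σ
  have hp := D.dist_pos' hσ
  have hdist : D.dist K σ ≤ 2 * R := by
    refine (D.dist_le_diam hΩ hσ).trans ?_
    have := Metric.diam_mono ((D.cell_subset K).trans hR) Metric.isBounded_closedBall
    have hR0 : 0 ≤ R := by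
      by_contra h
      rw [Metric.closedBall_eq_empty.2 (not_le.1 h)] at hR
      exact hR (D.cell_subset K (D.center_mem K))
    exact this.trans (Metric.diam_closedBall hR0)
  have h2 : (|v.1 K| + |v.2 σ|) ^ 2 ≤ 8 * v.1 K ^ 2 + 2 * (v.2 σ - v.1 K) ^ 2 := by
    have h3 : |v.2 σ| ≤ |v.1 K| + |v.2 σ - v.1 K| := by
      have := abs_add_le (v.1 K) (v.2 σ - v.1 K)
      rwa [add_sub_cancel] at this
    rw [← sq_abs (v.1 K), ← sq_abs (v.2 σ - v.1 K)]
    have h4 : |v.1 K| + |v.2 σ| ≤ 2 * |v.1 K| + |v.2 σ - v.1 K| := by linarith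
    calc (|v.1 K| + |v.2 σ|) ^ 2 ≤ (2 * |v.1 K| + |v.2 σ - v.1 K|) ^ 2 := by gcongr
      _ ≤ _ := by nlinarith [sq_nonneg (2 * |v.1 K| - |v.2 σ - v.1 K|)]
  have h5 : D.area σ * D.dist K σ * (2 * (v.2 σ - v.1 K) ^ 2) ≤
      8 * R ^ 2 * (D.area σ / D.dist K σ * (v.2 σ - v.1 K) ^ 2) := by
    have e1 : D.area σ * D.dist K σ * (2 * (v.2 σ - v.1 K) ^ 2) =
      2 * D.dist K σ ^ 2 * (D.area σ / D.dist K σ * (v.2 σ - v.1 K) ^ 2) := by field_simp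
    rw [e1]
    apply mul_le_mul_of_nonneg_right _ (by positivity)
    nlinarith
  calc D.area σ * D.dist K σ * (|v.1 K| + |v.2 σ|) ^ 2
      ≤ D.area σ * D.dist K σ * (8 * v.1 K ^ 2 + 2 * (v.2 σ - v.1 K) ^ 2) := by gcongr
    _ ≤ _ := by linarith

theorem exists_unit_vector (hd : 0 < d) : ∃ e : Eucl d, ‖e‖ = 1 :=
  ⟨EuclideanSpace.single ⟨0, hd⟩ 1, by simp⟩

theorem abs_integral_face_le (hΩ : Bornology.IsBounded Ω) (σ : D.Edge) {φ : Eucl d → ℝ} {C : ℝ}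
    (hC : ∀ y ∈ D.face σ, |φ y| ≤ C) : |∫ y, φ y ∂(D.faceMeasure σ)| ≤ C * D.area σ := by
  have := D.isFiniteMeasure_faceMeasure hΩ σ
  rw [← D.faceMeasure_real_univ, ← Real.norm_eq_abs]
  apply norm_integral_le_of_norm_le_const
  filter_upwards [ae_restrict_mem (D.measurableSet_face σ)] with y hy using hC y hy

theorem abs_inner_outNormal_le (K : D.Vol) (σ : D.Edge) (e : Eucl d) :
    |⟪D.outNormal K σ, e⟫| ≤ ‖e‖ := by
  simpa [D.norm_outNormal] using abs_real_inner_le_norm (D.outNormal K σ) e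

/-- The total variation estimate for the piecewise constant functions on the mesh. -/
theorem abs_sum_mul_integral_fderiv_le (hΩ : Bornology.IsBounded Ω) (hd : 0 < d) (a : D.Vol → ℝ)
    {b : D.Edge → ℝ} (hb : ∀ σ ∈ D.extEdges, b σ = 0) {φ : Eucl d → ℝ} (hφ : ContDiff ℝ 1 φ)
    (e : Eucl d) :
    |∑ K, a K * ∫ x in D.cell K, fderiv ℝ φ x e| ≤
      ‖e‖ * ∑ K, ∑ σ ∈ D.edges K, |a K - b σ| * |∫ y, φ y ∂(D.faceMeasure σ)| := by
  rw [D.sum_mul_integral_fderiv hΩ hd a hb hφ e, Finset.mul_sum]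
  refine (Finset.abs_sum_le_sum_abs _ _).trans (Finset.sum_le_sum fun K _ => ?_)
  rw [Finset.mul_sum]
  refine (Finset.abs_sum_le_sum_abs _ _).trans (Finset.sum_le_sum fun σ _ => ?_)
  rw [abs_mul, abs_mul, mul_comm |a K - b σ|, mul_assoc]
  gcongr
  exact D.abs_inner_outNormal_le K σ e

/-- The discrete Poincaré inequality. -/
theorem sum_vol_mul_sq_le (hΩ : Bornology.IsBounded Ω) (hd : 0 < d) {R : ℝ} (hR0 : 0 ≤ R)
    (hR : Ω ⊆ Metric.closedBall 0 R) {v : D.X} (hv : D.MemX0 v) :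
    ∑ K, D.vol K * v.1 K ^ 2 ≤ (8 * d + 8) * R ^ 2 * D.normX v ^ 2 := by
  obtain ⟨e, he⟩ := exists_unit_vector hd
  set S := ∑ K, D.vol K * v.1 K ^ 2 with hS
  have hS0 : 0 ≤ S := Finset.sum_nonneg fun K _ =>
    mul_nonneg (D.vol_pos hΩ K).le (sq_nonneg _)
  -- The discrete Stokes formula is used with the squares `v_K²`, `v_σ²` and with a linear function
  -- whose derivative along `e` is `1`, so that its left-hand side is `S` itself.
  have hφ : ContDiff ℝ 1 fun x : Eucl d => ⟪e, x⟫ := contDiff_const.inner ℝ contDiff_id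
  have hfd : ∀ x, fderiv ℝ (fun x : Eucl d => ⟪e, x⟫) x e = 1 := by
    intro x
    have : HasFDerivAt (fun x : Eucl d => ⟪e, x⟫) (innerSL ℝ e) x := (innerSL ℝ e).hasFDerivAt
    rw [this.fderiv, innerSL_apply_apply, real_inner_self_eq_norm_sq, he]; norm_num
  have h1 := D.abs_sum_mul_integral_fderiv_le hΩ hd (fun K => v.1 K ^ 2)
    (b := fun σ => v.2 σ ^ 2) (fun σ hσ => by simp [hv σ hσ]) hφ e
  simp only [hfd, setIntegral_const, smul_eq_mul, mul_one, he, one_mul] at h1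
  have h2 : S ≤ R * ∑ K, ∑ σ ∈ D.edges K, D.area σ * |v.2 σ - v.1 K| * (|v.1 K| + |v.2 σ|) := by
    have h3 : S = |∑ K, v.1 K ^ 2 * volume.real (D.cell K)| := by
      rw [← abs_of_nonneg hS0, hS]
      congr 1
      exact Finset.sum_congr rfl fun K _ => mul_comm _ _
    rw [h3]
    refine h1.trans ?_
    rw [Finset.mul_sum]
    refine Finset.sum_le_sum fun K _ => ?_
    rw [Finset.mul_sum]
    refine Finset.sum_le_sum fun σ _ => ?_
    have h4 : |∫ y, ⟪e, y⟫ ∂(D.faceMeasure σ)| ≤ R * D.area σ := by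
      apply D.abs_integral_face_le hΩ
      intro y hy
      have h5 := abs_real_inner_le_norm e y
      have h6 : y ∈ Metric.closedBall (0 : Eucl d) R :=
        closure_minimal hR Metric.isClosed_closedBall (D.face_subset σ hy)
      rw [he, one_mul] at h5
      exact h5.trans (by simpa using h6)
    have h5 : |v.1 K ^ 2 - v.2 σ ^ 2| ≤ |v.2 σ - v.1 K| * (|v.1 K| + |v.2 σ|) := by
      have : v.1 K ^ 2 - v.2 σ ^ 2 = -(v.2 σ - v.1 K) * (v.1 K + v.2 σ) := by ring
      rw [this, abs_mul, abs_neg]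
      gcongr
      exact abs_add_le _ _
    have ha := D.area_pos hΩ σ
    calc _ ≤ (|v.2 σ - v.1 K| * (|v.1 K| + |v.2 σ|)) * (R * D.area σ) := by gcongr
      _ = _ := by ring
  have h3 := h2.trans (mul_le_mul_of_nonneg_left (D.sum_area_mul_add_le hΩ hd hR v) hR0)
  rw [← hS] at h3
  set N := D.normX v
  have hN : 0 ≤ N := D.normX_nonneg v
  have h4 : S ^ 2 ≤ (R * N) ^ 2 * (8 * d * S + 8 * R ^ 2 * N ^ 2) := by
    have h5 : 0 ≤ 8 * d * S + 8 * R ^ 2 * N ^ 2 := by positivity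
    calc S ^ 2 ≤ (R * (N * √(8 * d * S + 8 * R ^ 2 * N ^ 2))) ^ 2 := by gcongr
      _ = (R * N) ^ 2 * (8 * d * S + 8 * R ^ 2 * N ^ 2) := by
        rw [← mul_assoc, mul_pow, Real.sq_sqrt h5]
  have hd0 : (0 : ℝ) ≤ d := Nat.cast_nonneg d
  have e1 : (8 * d + 8) * R ^ 2 * N ^ 2 = (8 * d + 8) * (R * N) ^ 2 := by ring
  have e2 : 8 * R ^ 2 * N ^ 2 = 8 * (R * N) ^ 2 := by ring
  rw [e1]
  rw [e2] at h4
  set m := (R * N) ^ 2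
  have hm : 0 ≤ m := sq_nonneg _
  -- With `m = (R N)²` the estimate reads `S² ≤ m (8 d S + 8 m)`. If `S > (8 d + 8) m`, then `m ≤
  -- S`, hence `S² ≤ (8 d + 8) m S`, a contradiction.
  by_contra hcon
  rw [not_le] at hcon
  have h6 : m ≤ S := by nlinarith
  have h7 : S ^ 2 ≤ (8 * d + 8) * m * S := by nlinarith
  have h8 : 0 < S := lt_of_le_of_lt (by positivity) hcon
  nlinarith

end Discretisation

end HybridFV

namespace HybridFV

variable {d : ℕ}

/-! ### Second order Taylor bounds for test functions -/

/-- `φ` is `C^1`, and `φ`, `∇φ` satisfy Lipschitz and Taylor bounds with the constant `M`. -/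
structure HasTaylorBound (φ : Eucl d → ℝ) (M : ℝ) : Prop where
  contDiff : ContDiff ℝ 1 φ
  nonneg : 0 ≤ M
  bound : ∀ x, |φ x| ≤ M
  bound_grad : ∀ x, ‖gradient φ x‖ ≤ M
  lip : ∀ x y, |φ x - φ y| ≤ M * ‖x - y‖
  lip_grad : ∀ x y, ‖gradient φ x - gradient φ y‖ ≤ M * ‖x - y‖
  taylor : ∀ x y, |φ y - φ x - ⟪gradient φ x, y - x⟫| ≤ M * ‖y - x‖ ^ 2

theorem inner_gradient_eq_fderiv {φ : Eucl d → ℝ} (x e : Eucl d) :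
    ⟪gradient φ x, e⟫ = fderiv ℝ φ x e := by
  simp [gradient]

theorem norm_gradient_eq {φ : Eucl d → ℝ} (x : Eucl d) : ‖gradient φ x‖ = ‖fderiv ℝ φ x‖ := by
  simp [gradient]

theorem continuous_gradient {φ : Eucl d → ℝ} (hφ : ContDiff ℝ 1 φ) : Continuous (gradient φ) := by
  unfold gradient
  exact (LinearIsometryEquiv.continuous _).comp (hφ.continuous_fderiv one_ne_zero)

theorem IsTestFunction.contDiff_one {Ω : Set (Eucl d)} {φ : Eucl d → ℝ}
    (h : IsTestFunction Ω φ) : ContDiff ℝ 1 φ := h.1.of_le (by exact_mod_cast le_top)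

theorem IsTestFunction.exists_hasTaylorBound {Ω : Set (Eucl d)} {φ : Eucl d → ℝ}
    (h : IsTestFunction Ω φ) : ∃ M, HasTaylorBound φ M := by
  have h1 := h.contDiff_one
  have hfd1 : ContDiff ℝ 1 (fderiv ℝ φ) := h.1.fderiv_right (by
    rw [one_add_one_eq_two]
    exact WithTop.coe_le_coe.2 (le_top : (2 : ℕ∞) ≤ ⊤))
  have hfdc : HasCompactSupport (fderiv ℝ φ) := h.2.1.fderiv ℝ
  obtain ⟨C, hC⟩ := hfd1.lipschitzWith_of_hasCompactSupport hfdc one_ne_zero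
  obtain ⟨C', hC'⟩ := h1.lipschitzWith_of_hasCompactSupport h.2.1 one_ne_zero
  obtain ⟨C₀, hC₀⟩ := h1.continuous.bounded_above_of_compact_support h.2.1
  have hC₀0 : 0 ≤ C₀ := (norm_nonneg _).trans (hC₀ 0)
  have hCC : (0 : ℝ) ≤ C := C.2
  have hCC' : (0 : ℝ) ≤ C' := C'.2
  have hlip : ∀ x y, |φ x - φ y| ≤ C' * ‖x - y‖ := fun x y => by
    have := hC'.dist_le_mul x y; rwa [Real.dist_eq, dist_eq_norm] at this
  have hlip2 : ∀ x y, ‖fderiv ℝ φ x - fderiv ℝ φ y‖ ≤ C * ‖x - y‖ := fun x y => by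
    have := hC.dist_le_mul x y; rwa [dist_eq_norm, dist_eq_norm] at this
  refine ⟨C + C' + C₀, h1, by positivity, fun x => ?_, fun x => ?_, fun x y => ?_, fun x y => ?_,
    fun x y => ?_⟩
  · exact (hC₀ x).trans (by linarith)
  · rw [norm_gradient_eq]
    refine (norm_fderiv_le_of_lipschitz ℝ hC').trans (by linarith)
  · refine (hlip x y).trans ?_
    gcongr; linarith
  · have : gradient φ x - gradient φ y =
        (InnerProductSpace.toDual ℝ (Eucl d)).symm (fderiv ℝ φ x - fderiv ℝ φ y) := by
      rw [map_sub]; rfl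
    rw [this, LinearIsometryEquiv.norm_map]
    refine (hlip2 x y).trans ?_
    gcongr; linarith
  · have key := (convex_closedBall x ‖y - x‖).norm_image_sub_le_of_norm_hasFDerivWithin_le'
      (f := φ) (f' := fderiv ℝ φ) (φ := fderiv ℝ φ x) (C := C * ‖y - x‖)
      (fun z _ => (h1.differentiable one_ne_zero z).hasFDerivAt.hasFDerivWithinAt)
      (fun z hz => by
        refine (hlip2 z x).trans ?_
        gcongr
        simpa [dist_eq_norm] using hz)
      (Metric.mem_closedBall_self (norm_nonneg _)) (y := y) (by simp [dist_eq_norm])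
    rw [inner_gradient_eq_fderiv, ← Real.norm_eq_abs]
    refine key.trans ?_
    rw [mul_assoc, ← sq]
    gcongr; linarith

namespace Discretisation

variable {Ω : Set (Eucl d)} (D : Discretisation Ω)

/-! ### The discrete gradient -/

/-- The part of the squared norm that belongs to the cell `K`. -/
noncomputable def normCellSq (v : D.X) (K : D.Vol) : ℝ :=
  ∑ σ ∈ D.edges K, D.area σ / D.dist K σ * (v.2 σ - v.1 K) ^ 2

/-- Cauchy–Schwarz with the same splitting of `|σ|`; the identity `∑ |σ| d_{K,σ} = d |K|` produces
the factor `d |K|`. -/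
theorem vol_mul_norm_gradCell_sq_le (hΩ : Bornology.IsBounded Ω) (hd : 0 < d) (v : D.X)
    (K : D.Vol) : D.vol K * ‖D.gradCell v K‖ ^ 2 ≤ d * D.normCellSq v K := by
  have hv := D.vol_pos hΩ K
  have h1 : ‖D.gradCell v K‖ ≤ (D.vol K)⁻¹ * ∑ σ ∈ D.edges K, D.area σ * |v.2 σ - v.1 K| := by
    unfold gradCell
    rw [norm_smul, Real.norm_of_nonneg (by positivity)]
    gcongr
    refine (norm_sum_le _ _).trans (Finset.sum_le_sum fun σ _ => ?_)
    rw [norm_smul, D.norm_outNormal, mul_one, norm_mul, Real.norm_of_nonneg (D.area_pos hΩ σ).le,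
      Real.norm_eq_abs]
  have h2 : (∑ σ ∈ D.edges K, D.area σ * |v.2 σ - v.1 K|) ^ 2 ≤
      D.normCellSq v K * (d * D.vol K) := by
    rw [← D.sum_area_mul_dist hΩ hd K]
    apply Finset.sum_sq_le_sum_mul_sum_of_sq_le_mul
    · intro σ hσ
      have := D.area_pos hΩ σ; have := D.dist_pos' hσ; positivity
    · intro σ hσ
      have := D.area_pos hΩ σ; have := D.dist_pos' hσ; positivity
    · intro σ hσ
      have := D.area_pos hΩ σ; have := D.dist_pos' hσ
      rw [mul_pow, sq_abs]
      apply le_of_eq; field_simp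
  calc D.vol K * ‖D.gradCell v K‖ ^ 2
      ≤ D.vol K * ((D.vol K)⁻¹ * ∑ σ ∈ D.edges K, D.area σ * |v.2 σ - v.1 K|) ^ 2 := by gcongr
    _ = (D.vol K)⁻¹ * (∑ σ ∈ D.edges K, D.area σ * |v.2 σ - v.1 K|) ^ 2 := by field_simp
    _ ≤ (D.vol K)⁻¹ * (D.normCellSq v K * (d * D.vol K)) := by gcongr
    _ = d * D.normCellSq v K := by field_simp

/-- The factor `√d` in the stabilisation cancels the `1 / d` in the volume of the cone, leaving the
weight `|σ| / d_{K,σ}` of `|v|_X`. The term with `∇_K v` costs `θ`, because `|x_σ - x_K| ≤ h_K ≤ θ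
d_{K,σ}`. -/
theorem volume_cone_mul_stab_sq_le (hΩ : Bornology.IsBounded Ω) (hd : 0 < d) {θ : ℝ} (v : D.X)
    {K : D.Vol} {σ : D.Edge} (hσ : σ ∈ D.edges K) (hθ : D.diam K ≤ θ * D.dist K σ) :
    volume.real (D.cone K σ) * D.stab v K σ ^ 2 ≤
      2 * (D.area σ / D.dist K σ * (v.2 σ - v.1 K) ^ 2) +
        2 * d * θ ^ 2 * (volume.real (D.cone K σ) * ‖D.gradCell v K‖ ^ 2) := by
  have hp := D.dist_pos' hσ
  have hd0 : (0 : ℝ) < d := by exact_mod_cast hd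
  have hdiam := D.diam_nonneg K
  have hc : volume.real (D.cone K σ) = D.area σ * D.dist K σ / d := by
    rw [D.area_mul_dist hΩ hd hσ]; field_simp
  have ha := D.area_pos hΩ σ
  set q := ⟪D.gradCell v K, D.bary σ - D.center K⟫ with hq
  have hq1 : q ^ 2 ≤ ‖D.gradCell v K‖ ^ 2 * (θ * D.dist K σ) ^ 2 := by
    rw [← mul_pow, ← sq_abs q]
    gcongr
    refine (abs_real_inner_le_norm _ _).trans ?_
    gcongr
    exact (D.norm_bary_sub_le hΩ hσ (D.center_mem_closure K)).trans hθ
  unfold stab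
  rw [mul_pow, div_pow, Real.sq_sqrt hd0.le, ← hq]
  have h2 : (v.2 σ - v.1 K - q) ^ 2 ≤ 2 * (v.2 σ - v.1 K) ^ 2 + 2 * q ^ 2 := by
    nlinarith [sq_nonneg (v.2 σ - v.1 K + q)]
  rw [hc]
  calc D.area σ * D.dist K σ / d * (d / D.dist K σ ^ 2 * (v.2 σ - v.1 K - q) ^ 2)
      = D.area σ / D.dist K σ * (v.2 σ - v.1 K - q) ^ 2 := by field_simp
    _ ≤ D.area σ / D.dist K σ * (2 * (v.2 σ - v.1 K) ^ 2 +
          2 * (‖D.gradCell v K‖ ^ 2 * (θ * D.dist K σ) ^ 2)) := by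
        gcongr; linarith
    _ = _ := by field_simp

theorem sum_cone_norm_gradCone_sq_le (hΩ : Bornology.IsBounded Ω) (hd : 0 < d) {θ : ℝ}
    (hθ : ∀ K, ∀ σ ∈ D.edges K, D.diam K ≤ θ * D.dist K σ) (v : D.X) :
    ∑ K, ∑ σ ∈ D.edges K, volume.real (D.cone K σ) * ‖D.gradCone v K σ‖ ^ 2 ≤
      (4 + 2 * d + 4 * d ^ 2 * θ ^ 2) * D.normX v ^ 2 := by
  rw [D.normX_sq hΩ, Finset.mul_sum]
  refine Finset.sum_le_sum fun K _ => ?_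
  have h1 : ∀ σ ∈ D.edges K, volume.real (D.cone K σ) * ‖D.gradCone v K σ‖ ^ 2 ≤
      4 * (D.area σ / D.dist K σ * (v.2 σ - v.1 K) ^ 2) +
        (2 + 4 * d * θ ^ 2) * (volume.real (D.cone K σ) * ‖D.gradCell v K‖ ^ 2) := by
    intro σ hσ
    have h2 := D.volume_cone_mul_stab_sq_le hΩ hd v hσ (hθ K σ hσ)
    have h3 : ‖D.gradCone v K σ‖ ^ 2 ≤ 2 * ‖D.gradCell v K‖ ^ 2 + 2 * D.stab v K σ ^ 2 := by
      unfold gradCone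
      have h4 : ‖D.gradCell v K + D.stab v K σ • D.outNormal K σ‖ ≤
          ‖D.gradCell v K‖ + |D.stab v K σ| := by
        refine (norm_add_le _ _).trans ?_
        rw [norm_smul, D.norm_outNormal, mul_one, Real.norm_eq_abs]
      rw [← sq_abs (D.stab v K σ)]
      calc _ ≤ (‖D.gradCell v K‖ + |D.stab v K σ|) ^ 2 := by gcongr
        _ ≤ _ := by nlinarith [sq_nonneg (‖D.gradCell v K‖ - |D.stab v K σ|)]
    have h5 : 0 ≤ volume.real (D.cone K σ) := measureReal_nonneg
    nlinarith
  refine (Finset.sum_le_sum h1).trans ?_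
  rw [Finset.sum_add_distrib, ← Finset.mul_sum, ← Finset.mul_sum, ← Finset.sum_mul,
    D.sum_volume_cone hΩ hd]
  have h6 := D.vol_mul_norm_gradCell_sq_le hΩ hd v K
  rw [normCellSq] at h6
  have h7 : 0 ≤ 2 + 4 * d * θ ^ 2 := by positivity
  nlinarith

theorem grad_apply_of_mem (hΩ : Bornology.IsBounded Ω) (v : D.X) {K : D.Vol} {σ : D.Edge}
    (hσ : σ ∈ D.edges K) {x : Eucl d} (hx : x ∈ D.cone K σ) :
    D.grad v x = D.gradCone v K σ := by
  unfold grad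
  rw [Finset.sum_eq_single K, Finset.sum_eq_single σ, indicator_of_mem hx]
  · intro τ hτ hne
    exact indicator_of_notMem
      (fun h => Set.disjoint_left.1 (D.disjoint_cone hΩ hτ hσ hne) h hx) _
  · exact fun h => absurd hσ h
  · intro L _ hL
    refine Finset.sum_eq_zero fun τ hτ => indicator_of_notMem (fun h => ?_) _
    exact Set.disjoint_left.1 (D.cell_disjoint L K hL) (D.cone_subset_cell hΩ hτ h)
      (D.cone_subset_cell hΩ hσ hx)
  · simp

theorem measurable_grad (hΩ : Bornology.IsBounded Ω) (v : D.X) : Measurable (D.grad v) := by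
  unfold grad
  exact Finset.measurable_fun_sum _ fun K _ => Finset.measurable_fun_sum _ fun σ hσ =>
    measurable_const.indicator (D.measurableSet_cone hΩ hσ)

theorem exists_bound_grad (v : D.X) : ∃ C, ∀ x, ‖D.grad v x‖ ≤ C := by
  refine ⟨∑ K, ∑ σ ∈ D.edges K, ‖D.gradCone v K σ‖, fun x => (norm_sum_le _ _).trans
    (Finset.sum_le_sum fun K _ => (norm_sum_le _ _).trans (Finset.sum_le_sum fun σ _ => ?_))⟩
  exact norm_indicator_le_norm_self (f := fun _ => D.gradCone v K σ) x

theorem setIntegral_norm_grad_sq (hΩ : Bornology.IsBounded Ω) (hd : 0 < d) (v : D.X) :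
    ∫ x in Ω, ‖D.grad v x‖ ^ 2 =
      ∑ K, ∑ σ ∈ D.edges K, volume.real (D.cone K σ) * ‖D.gradCone v K σ‖ ^ 2 := by
  obtain ⟨C, hC⟩ := D.exists_bound_grad v
  rw [D.setIntegral_eq_sum_cone hΩ hd]
  · refine Finset.sum_congr rfl fun K _ => Finset.sum_congr rfl fun σ hσ => ?_
    rw [← smul_eq_mul, ← setIntegral_const]
    apply setIntegral_congr_fun (D.measurableSet_cone hΩ hσ)
    intro x hx
    simp only [D.grad_apply_of_mem hΩ v hσ hx]
  · refine IntegrableOn.of_bound hΩ.measure_lt_top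
      ((D.measurable_grad hΩ v).norm.pow_const 2).aestronglyMeasurable (C ^ 2)
      (Eventually.of_forall fun x => ?_)
    rw [norm_pow, norm_norm]; gcongr; exact hC x

theorem gradCell_sub (u v : D.X) (K : D.Vol) :
    D.gradCell (u - v) K = D.gradCell u K - D.gradCell v K := by
  unfold gradCell
  rw [← smul_sub, ← Finset.sum_sub_distrib]
  congr 1
  refine Finset.sum_congr rfl fun σ _ => ?_
  simp only [Prod.fst_sub, Prod.snd_sub, Pi.sub_apply]
  module

theorem gradCone_sub (u v : D.X) (K : D.Vol) (σ : D.Edge) :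
    D.gradCone (u - v) K σ = D.gradCone u K σ - D.gradCone v K σ := by
  unfold gradCone stab
  simp only [gradCell_sub, Prod.fst_sub, Prod.snd_sub, Pi.sub_apply, inner_sub_left]
  module

theorem grad_sub (u v : D.X) (x : Eucl d) : D.grad (u - v) x = D.grad u x - D.grad v x := by
  unfold grad
  simp only [gradCone_sub, ← Finset.sum_sub_distrib]
  refine Finset.sum_congr rfl fun K _ => Finset.sum_congr rfl fun σ _ => ?_
  by_cases hx : x ∈ D.cone K σ
  · simp [hx]
  · simp [hx]

/-! ### Interpolation -/

/-- The divergence theorem for an affine function, whose integral on a face is `|σ|` times its value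
at the barycentre. It makes `∇_K` exact on affine functions. -/
theorem sum_area_inner_smul_outNormal (hΩ : Bornology.IsBounded Ω) (hd : 0 < d) (K : D.Vol)
    (g : Eucl d) :
    ∑ σ ∈ D.edges K, (D.area σ * ⟪g, D.bary σ - D.center K⟫) • D.outNormal K σ =
      D.vol K • g := by
  apply ext_inner_right ℝ
  intro e
  have hφ : ContDiff ℝ 1 fun x : Eucl d => ⟪g, x - D.center K⟫ :=
    contDiff_const.inner ℝ (contDiff_id.sub contDiff_const)
  have hfd : ∀ x, fderiv ℝ (fun x : Eucl d => ⟪g, x - D.center K⟫) x e = ⟪g, e⟫ := by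
    intro x
    have h1 : HasFDerivAt (fun x : Eucl d => ⟪g, x - D.center K⟫) (innerSL ℝ g) x :=
      (innerSL ℝ g).hasFDerivAt.comp x ((hasFDerivAt_id x).sub_const _)
    rw [h1.fderiv, innerSL_apply_apply]
  have key := D.integral_fderiv_cell hΩ hd K hφ e
  simp only [hfd, setIntegral_const, smul_eq_mul, D.integral_inner_face hΩ] at key
  rw [sum_inner, real_inner_smul_left]
  unfold vol
  rw [key]
  refine Finset.sum_congr rfl fun σ _ => ?_
  rw [real_inner_smul_left]; ring

/-- Exactness on affine functions removes the first order Taylor polynomial of `φ` at `x_K`. Each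
face leaves a remainder of order `|σ| h_K²`, one `h_K` is exchanged for `θ d_{K,σ}`, and the faces
are summed. -/
theorem norm_gradCell_interp_sub_le (hΩ : Bornology.IsBounded Ω) (hd : 0 < d) {θ : ℝ} {K : D.Vol}
    (hθ : ∀ σ ∈ D.edges K, D.diam K ≤ θ * D.dist K σ) {φ : Eucl d → ℝ} {M : ℝ}
    (hφ : HasTaylorBound φ M) :
    ‖D.gradCell (D.interp φ) K - gradient φ (D.center K)‖ ≤ M * θ * d * D.diam K := by
  have hv := D.vol_pos hΩ K
  have hM := hφ.nonneg
  set g := gradient φ (D.center K) with hg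
  have h1 : D.gradCell (D.interp φ) K - g = (D.vol K)⁻¹ • ∑ σ ∈ D.edges K,
      (D.area σ * (φ (D.bary σ) - φ (D.center K) - ⟪g, D.bary σ - D.center K⟫)) •
        D.outNormal K σ := by
    have h2 : g = (D.vol K)⁻¹ • ∑ σ ∈ D.edges K,
        (D.area σ * ⟪g, D.bary σ - D.center K⟫) • D.outNormal K σ := by
      rw [D.sum_area_inner_smul_outNormal hΩ hd, smul_smul, inv_mul_cancel₀ hv.ne', one_smul]
    conv_lhs => rw [h2]
    unfold gradCell interp
    rw [← smul_sub, ← Finset.sum_sub_distrib]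
    congr 1
    refine Finset.sum_congr rfl fun σ _ => ?_
    rw [← sub_smul, ← mul_sub]
  rw [h1, norm_smul, Real.norm_of_nonneg (by positivity), inv_mul_le_iff₀ hv]
  have h3 : ∀ σ ∈ D.edges K, ‖(D.area σ * (φ (D.bary σ) - φ (D.center K) -
      ⟪g, D.bary σ - D.center K⟫)) • D.outNormal K σ‖ ≤
      (M * θ * D.diam K) * (D.area σ * D.dist K σ) := by
    intro σ hσ
    have ha := D.area_pos hΩ σ
    have hdi := D.diam_nonneg K
    rw [norm_smul, D.norm_outNormal, mul_one, norm_mul, Real.norm_of_nonneg ha.le,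
      Real.norm_eq_abs]
    calc _ ≤ D.area σ * (M * ‖D.bary σ - D.center K‖ ^ 2) := by
          gcongr; exact hφ.taylor _ _
      _ ≤ D.area σ * (M * (D.diam K * D.diam K)) := by
          rw [sq]
          have := D.norm_bary_sub_le hΩ hσ (D.center_mem_closure K)
          gcongr
      _ ≤ D.area σ * (M * (D.diam K * (θ * D.dist K σ))) := by
          gcongr; exact hθ σ hσ
      _ = _ := by ring
  refine (norm_sum_le _ _).trans ((Finset.sum_le_sum h3).trans (le_of_eq ?_))
  rw [← Finset.mul_sum, D.sum_area_mul_dist hΩ hd]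
  ring

/-- The stabilisation measures a defect from affine behaviour: on the interpolant it is a second
order remainder divided by `d_{K,σ}`, and `h_K / d_{K,σ} ≤ θ` leaves one power of `h_K`. -/
theorem norm_gradCone_interp_sub_le (hΩ : Bornology.IsBounded Ω) (hd : 0 < d) {θ : ℝ}
    (hθ0 : 0 ≤ θ) {K : D.Vol}
    (hθ : ∀ σ ∈ D.edges K, D.diam K ≤ θ * D.dist K σ) {φ : Eucl d → ℝ} {M : ℝ}
    (hφ : HasTaylorBound φ M) {σ : D.Edge} (hσ : σ ∈ D.edges K) {x : Eucl d}
    (hx : x ∈ D.cell K) :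
    ‖D.gradCone (D.interp φ) K σ - gradient φ x‖ ≤
      (1 + θ * d + d * θ * (1 + θ * d)) * M * D.diam K := by
  have hM := hφ.nonneg
  have hp := D.dist_pos' hσ
  have hdi := D.diam_nonneg K
  have hd1 : (1 : ℝ) ≤ d := by exact_mod_cast hd
  set g := gradient φ (D.center K) with hg
  have h1 := D.norm_gradCell_interp_sub_le hΩ hd hθ hφ
  have hb := D.norm_bary_sub_le hΩ hσ (D.center_mem_closure K)
  have h2 : |φ (D.bary σ) - φ (D.center K) -
      ⟪D.gradCell (D.interp φ) K, D.bary σ - D.center K⟫| ≤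
      M * (1 + θ * d) * D.diam K ^ 2 := by
    have e : φ (D.bary σ) - φ (D.center K) -
      ⟪D.gradCell (D.interp φ) K, D.bary σ - D.center K⟫ =
      (φ (D.bary σ) - φ (D.center K) - ⟪g, D.bary σ - D.center K⟫) -
        ⟪D.gradCell (D.interp φ) K - g, D.bary σ - D.center K⟫ := by
      rw [inner_sub_left]; ring
    rw [e]
    refine (abs_sub _ _).trans ?_
    have h3 := hφ.taylor (D.center K) (D.bary σ)
    have h4 := (abs_real_inner_le_norm (D.gradCell (D.interp φ) K - g)
      (D.bary σ - D.center K)).trans (mul_le_mul h1 hb (norm_nonneg _) (by positivity))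
    have h5 : M * ‖D.bary σ - D.center K‖ ^ 2 ≤ M * D.diam K ^ 2 := by gcongr
    linarith
  have h3 : |D.stab (D.interp φ) K σ| ≤ d * θ * (1 + θ * d) * M * D.diam K := by
    unfold stab
    rw [abs_mul, abs_of_nonneg (by positivity : 0 ≤ √(d : ℝ) / D.dist K σ)]
    have h4 : √(d : ℝ) ≤ d := by
      rw [Real.sqrt_le_left (by positivity)]; nlinarith
    calc _ ≤ d / D.dist K σ * (M * (1 + θ * d) * D.diam K ^ 2) := by
          gcongr; exact h2
      _ = (d * (1 + θ * d) * M * D.diam K) * (D.diam K / D.dist K σ) := by field_simp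
      _ ≤ (d * (1 + θ * d) * M * D.diam K) * θ := by
          gcongr; rw [div_le_iff₀ hp]; exact hθ σ hσ
      _ = _ := by ring
  have h4 : ‖g - gradient φ x‖ ≤ M * D.diam K := by
    refine (hφ.lip_grad _ _).trans ?_
    gcongr
    exact D.dist_le_diam_of_mem_closure hΩ (D.center_mem_closure K) (subset_closure hx)
  have e : D.gradCone (D.interp φ) K σ - gradient φ x =
      (D.gradCell (D.interp φ) K - g) + (D.stab (D.interp φ) K σ • D.outNormal K σ +
        (g - gradient φ x)) := by
    unfold gradCone; abel
  rw [e]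
  refine (norm_add_le _ _).trans ?_
  have h5 := norm_add_le (D.stab (D.interp φ) K σ • D.outNormal K σ) (g - gradient φ x)
  rw [norm_smul, D.norm_outNormal, mul_one, Real.norm_eq_abs] at h5
  linarith

/-- The interpolation in `X_{D,B}`. -/
noncomputable def interpB (B : Set D.Edge) (β : D.Edge → D.Vol → ℝ) (φ : Eucl d → ℝ) : D.X := by
  classical
  exact (fun K => φ (D.center K), fun σ =>
    if σ ∈ B then ∑ K, β σ K * φ (D.center K) else φ (D.bary σ))

theorem interpB_memXB {B : Set D.Edge} (hB : B ⊆ D.intEdges) (β : D.Edge → D.Vol → ℝ)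
    {φ : Eucl d → ℝ} (h0 : D.MemX0 (D.interp φ)) : D.MemXB B β (D.interpB B β φ) := by
  constructor
  · intro σ hσ
    have : σ ∉ B := by
      intro h
      have h1 : (D.nbr σ).ncard = 2 := hB h
      have h2 : (D.nbr σ).ncard = 1 := hσ
      omega
    simp only [interpB, this, if_false]
    exact h0 σ hσ
  · intro σ hσ
    simp [interpB, hσ]

/-- Cell values are unchanged, so only faces of `B` contribute. Expanding `φ` at `x_σ`, the two
barycentric identities cancel the terms of order zero and one; the last quantity in `θ_{D,B}` bounds
the remainder by `M θ h_K²`. The division by `d_{K,σ}` is paid for by `h_K² ≤ θ d_{K,σ} h`. -/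
theorem normX_interpB_sub_interp_le (hΩ : Bornology.IsBounded Ω) (hd : 0 < d) {θ : ℝ}
    (hθ0 : 0 ≤ θ) {B : Set D.Edge} {β : D.Edge → D.Vol → ℝ} (hreg : D.thetaB B β ≤ θ)
    (hβ : D.IsBarycentric B β) {φ : Eucl d → ℝ} {M : ℝ} (hφ : HasTaylorBound φ M) :
    D.normX (D.interpB B β φ - D.interp φ) ≤
      M * θ ^ 2 * √(d * volume.real Ω) * D.size := by
  have hM := hφ.nonneg
  have hs := D.size_nonneg
  have hd0 : (0 : ℝ) ≤ d := Nat.cast_nonneg d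
  rw [← pow_le_pow_iff_left₀ (D.normX_nonneg _) (by positivity) two_ne_zero, D.normX_sq hΩ]
  have hR : (M * θ ^ 2 * √(d * volume.real Ω) * D.size) ^ 2 =
      (M * θ ^ 2 * D.size) ^ 2 * (∑ K, ∑ σ ∈ D.edges K, D.area σ * D.dist K σ) := by
    rw [D.sum_sum_area_mul_dist hΩ hd, mul_right_comm, mul_pow, Real.sq_sqrt (by positivity)]
  rw [hR, Finset.mul_sum]
  refine Finset.sum_le_sum fun K _ => ?_
  rw [Finset.mul_sum]
  refine Finset.sum_le_sum fun σ hσ => ?_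
  have ha := D.area_pos hΩ σ
  have hp := D.dist_pos' hσ
  have hdi := D.diam_nonneg K
  simp only [Prod.fst_sub, Prod.snd_sub, Pi.sub_apply]
  have h0 : (D.interpB B β φ).1 K = (D.interp φ).1 K := rfl
  rw [h0, sub_self, sub_zero]
  have h1 : |(D.interpB B β φ).2 σ - (D.interp φ).2 σ| ≤ M * θ * D.diam K ^ 2 := by
    by_cases hσB : σ ∈ B
    · obtain ⟨hb1, hb2⟩ := hβ σ hσB
      have e1 : (D.interpB B β φ).2 σ - (D.interp φ).2 σ = ∑ L, β σ L *
          (φ (D.center L) - φ (D.bary σ) -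
            ⟪gradient φ (D.bary σ), D.center L - D.bary σ⟫) := by
        have e2 : ∑ L, β σ L * ⟪gradient φ (D.bary σ), D.center L - D.bary σ⟫ = 0 := by
          simp only [← real_inner_smul_right]
          rw [← inner_sum]
          simp only [smul_sub]
          rw [Finset.sum_sub_distrib, ← Finset.sum_smul, hb1, one_smul, ← hb2, sub_self,
            inner_zero_right]
        have e3 : ∑ L, β σ L * φ (D.bary σ) = φ (D.bary σ) := by
          rw [← Finset.sum_mul, hb1, one_mul]
        simp only [mul_sub]
        rw [Finset.sum_sub_distrib, Finset.sum_sub_distrib, e3]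
        rw [e2]
        simp [interpB, hσB, interp]
      rw [e1]
      have h2 := D.sum_abs_mul_sq_le_theta hΩ hreg hσ hσB
      calc _ ≤ ∑ L, M * (|β σ L| * ‖D.center L - D.bary σ‖ ^ 2) := by
            refine (Finset.abs_sum_le_sum_abs _ _).trans (Finset.sum_le_sum fun L _ => ?_)
            rw [abs_mul]
            have := hφ.taylor (D.bary σ) (D.center L)
            calc _ ≤ |β σ L| * (M * ‖D.center L - D.bary σ‖ ^ 2) := by gcongr
              _ = _ := by ring
        _ ≤ _ := by
            rw [← Finset.mul_sum, mul_assoc]; gcongr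
    · have : (D.interpB B β φ).2 σ = (D.interp φ).2 σ := by
        simp [interpB, hσB, interp]
      rw [this, sub_self, abs_zero]
      positivity
  have h2 : D.diam K ^ 2 ≤ θ * D.dist K σ * D.size := by
    rw [sq]
    have := D.diam_le_theta hreg hσ
    have := D.diam_le_size K
    gcongr
  calc D.area σ / D.dist K σ * ((D.interpB B β φ).2 σ - (D.interp φ).2 σ) ^ 2
      ≤ D.area σ / D.dist K σ * (M * θ * (θ * D.dist K σ * D.size)) ^ 2 := by
        rw [← sq_abs]
        gcongr
        exact h1.trans (by gcongr)
    _ = _ := by field_simp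

/-- The point is that, up to `O(h²)`, the bound involves only the `L²` norm of the gradient. A
sequence of test functions bounded in `H¹` thus has interpolants that are eventually bounded by a
common constant, although `M` may be unbounded along the sequence. -/
theorem normX_interp_sq_le (hΩ : Bornology.IsBounded Ω) (hd : 0 < d) {θ : ℝ}
    (hθ : ∀ K, ∀ σ ∈ D.edges K, D.diam K ≤ θ * D.dist K σ) {φ : Eucl d → ℝ} {M : ℝ}
    (hφ : HasTaylorBound φ M) :
    D.normX (D.interp φ) ^ 2 ≤ 2 * d * θ ^ 2 * (2 * (∫ x in Ω, ‖gradient φ x‖ ^ 2) +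
      3 * M ^ 2 * D.size ^ 2 * volume.real Ω) := by
  have hM := hφ.nonneg
  have hs := D.size_nonneg
  have hcont := continuous_gradient hφ.contDiff
  have hint : IntegrableOn (fun x => ‖gradient φ x‖ ^ 2) Ω := by
    refine IntegrableOn.of_bound hΩ.measure_lt_top (hcont.norm.pow 2).aestronglyMeasurable (M ^ 2)
      (Eventually.of_forall fun x => ?_)
    rw [norm_pow, norm_norm]
    have := hφ.bound_grad x
    gcongr
  rw [D.normX_sq hΩ, D.setIntegral_eq_sum_cell hΩ hint, ← D.sum_vol hΩ, Finset.mul_sum,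
    Finset.mul_sum, ← Finset.sum_add_distrib, Finset.mul_sum]
  refine Finset.sum_le_sum fun K _ => ?_
  set g := gradient φ (D.center K) with hg
  have hdi := D.diam_nonneg K
  have hds := D.diam_le_size K
  have h1 : ∀ σ ∈ D.edges K, D.area σ / D.dist K σ * (φ (D.bary σ) - φ (D.center K)) ^ 2 ≤
      (2 * θ ^ 2 * (‖g‖ ^ 2 + M ^ 2 * D.size ^ 2)) * (D.area σ * D.dist K σ) := by
    intro σ hσ
    have ha := D.area_pos hΩ σ
    have hp := D.dist_pos' hσ
    have hb := D.norm_bary_sub_le hΩ hσ (D.center_mem_closure K)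
    have h2 : |φ (D.bary σ) - φ (D.center K)| ≤ (‖g‖ + M * D.size) * (θ * D.dist K σ) := by
      have h3 := hφ.taylor (D.center K) (D.bary σ)
      have h4 := abs_real_inner_le_norm g (D.bary σ - D.center K)
      have h5 : |φ (D.bary σ) - φ (D.center K)| ≤ ‖g‖ * ‖D.bary σ - D.center K‖ +
          M * ‖D.bary σ - D.center K‖ ^ 2 := by
        have := abs_add_le (φ (D.bary σ) - φ (D.center K) - ⟪g, D.bary σ - D.center K⟫)
          ⟪g, D.bary σ - D.center K⟫
        rw [sub_add_cancel] at this
        linarith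
      refine h5.trans ?_
      calc _ = (‖g‖ + M * ‖D.bary σ - D.center K‖) * ‖D.bary σ - D.center K‖ := by ring
        _ ≤ _ := by
          have := hb.trans hds
          have := hb.trans (hθ K σ hσ)
          gcongr
    calc D.area σ / D.dist K σ * (φ (D.bary σ) - φ (D.center K)) ^ 2
        ≤ D.area σ / D.dist K σ * ((‖g‖ + M * D.size) * (θ * D.dist K σ)) ^ 2 := by
          rw [← sq_abs]; gcongr
      _ = (‖g‖ + M * D.size) ^ 2 * θ ^ 2 * (D.area σ * D.dist K σ) := by field_simp
      _ ≤ _ := by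
          have : (‖g‖ + M * D.size) ^ 2 ≤ 2 * (‖g‖ ^ 2 + M ^ 2 * D.size ^ 2) := by
            nlinarith [sq_nonneg (‖g‖ - M * D.size)]
          calc _ ≤ 2 * (‖g‖ ^ 2 + M ^ 2 * D.size ^ 2) * θ ^ 2 * (D.area σ * D.dist K σ) := by gcongr
            _ = _ := by ring
  refine (Finset.sum_le_sum h1).trans ?_
  rw [← Finset.mul_sum, D.sum_area_mul_dist hΩ hd]
  have h2 : D.vol K * ‖g‖ ^ 2 ≤ 2 * (∫ x in D.cell K, ‖gradient φ x‖ ^ 2) +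
      2 * M ^ 2 * D.size ^ 2 * D.vol K := by
    have hi := hint.mono_set (D.cell_subset K)
    have hfin : volume (D.cell K) ≠ ⊤ := (D.isBounded_cell hΩ K).measure_lt_top.ne
    have h3 : ∫ x in D.cell K, ‖g‖ ^ 2 ≤
        ∫ x in D.cell K, (2 * ‖gradient φ x‖ ^ 2 + 2 * M ^ 2 * D.size ^ 2) := by
      apply setIntegral_mono_on (integrableOn_const hfin)
        ((hi.const_mul 2).add (integrableOn_const hfin)) (D.measurableSet_cell K)
      intro x hx
      have h4 : ‖g‖ ≤ ‖gradient φ x‖ + M * D.size := by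
        have h5 := norm_add_le (gradient φ x) (g - gradient φ x)
        rw [add_sub_cancel] at h5
        have h6 := hφ.lip_grad (D.center K) x
        have h7 := (D.dist_le_diam_of_mem_closure hΩ (D.center_mem_closure K)
          (subset_closure hx)).trans hds
        have h8 : M * ‖D.center K - x‖ ≤ M * D.size := by gcongr
        linarith
      calc ‖g‖ ^ 2 ≤ (‖gradient φ x‖ + M * D.size) ^ 2 := by gcongr
        _ ≤ _ := by
          simp only [Pi.add_apply]
          nlinarith [sq_nonneg (‖gradient φ x‖ - M * D.size)]
    rw [setIntegral_const, integral_add (hi.const_mul 2) (integrableOn_const hfin),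
      integral_const_mul, setIntegral_const, smul_eq_mul, smul_eq_mul] at h3
    unfold vol
    linarith
  have hv := D.vol_pos hΩ K
  calc 2 * θ ^ 2 * (‖g‖ ^ 2 + M ^ 2 * D.size ^ 2) * (d * D.vol K)
      = 2 * d * θ ^ 2 * (D.vol K * ‖g‖ ^ 2 + M ^ 2 * D.size ^ 2 * D.vol K) := by ring
    _ ≤ 2 * d * θ ^ 2 * ((2 * (∫ x in D.cell K, ‖gradient φ x‖ ^ 2) +
      2 * M ^ 2 * D.size ^ 2 * D.vol K) + M ^ 2 * D.size ^ 2 * D.vol K) := by gcongr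
    _ = _ := by ring

/-- The discrete weak derivative is bounded by the `L²` norm of the test function, up to a term of
order `h`. -/
theorem abs_integral_piM_mul_fderiv_le (hΩ : Bornology.IsBounded Ω) (hd : 0 < d) {v : D.X}
    (hv : D.MemX0 v) {φ : Eucl d → ℝ} {M : ℝ} (hφ : HasTaylorBound φ M) (e : Eucl d) :
    |∫ x in Ω, D.piM v x * fderiv ℝ φ x e| ≤ ‖e‖ * (D.normX v *
      √(2 * d * ((∫ x in Ω, φ x ^ 2) + M ^ 2 * D.size ^ 2 * volume.real Ω))) := by
  have hM := hφ.nonneg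
  have hs := D.size_nonneg
  have hint : IntegrableOn (fun x => φ x ^ 2) Ω := by
    refine IntegrableOn.of_bound hΩ.measure_lt_top
      (hφ.contDiff.continuous.pow 2).aestronglyMeasurable (M ^ 2) (Eventually.of_forall fun x => ?_)
    rw [norm_pow]
    have := hφ.bound x
    gcongr; exact this
  have hint' : IntegrableOn (fun x => fderiv ℝ φ x e) Ω := by
    refine IntegrableOn.of_bound hΩ.measure_lt_top
      ((hφ.contDiff.continuous_fderiv one_ne_zero).clm_apply
        continuous_const).aestronglyMeasurable (M * ‖e‖) (Eventually.of_forall fun x => ?_)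
    have := hφ.bound_grad x
    rw [norm_gradient_eq] at this
    exact (ContinuousLinearMap.le_opNorm _ _).trans (by gcongr)
  rw [D.setIntegral_piM_mul hΩ v hint']
  refine (D.abs_sum_mul_integral_fderiv_le hΩ hd v.1 (b := v.2) hv hφ.contDiff e).trans ?_
  gcongr
  -- `q σ` is the modulus of the average of `φ` on `σ`. It is compared with `φ` at the points of the
  -- cone, at the cost of `M h`; the factor `2 d` comes from squaring a sum and from `|σ| d_{K,σ} =
  -- d |D_{K,σ}|`.
  set q : D.Edge → ℝ := fun σ => (D.area σ)⁻¹ * |∫ y, φ y ∂(D.faceMeasure σ)| with hq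
  have h1 : ∀ K, ∀ σ ∈ D.edges K, |v.1 K - v.2 σ| * |∫ y, φ y ∂(D.faceMeasure σ)| =
      D.area σ * |v.2 σ - v.1 K| * q σ := by
    intro K σ _
    have ha := D.area_pos hΩ σ
    rw [abs_sub_comm, hq]
    field_simp
  rw [Finset.sum_congr rfl fun K _ => Finset.sum_congr rfl (h1 K)]
  refine (D.sum_area_mul_le hΩ v fun K σ => q σ).trans ?_
  gcongr
  · exact D.normX_nonneg v
  rw [D.setIntegral_eq_sum_cone hΩ hd hint, ← D.sum_vol hΩ, Finset.mul_sum,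
    ← Finset.sum_add_distrib, Finset.mul_sum]
  refine Finset.sum_le_sum fun K _ => ?_
  rw [← D.sum_volume_cone hΩ hd K, Finset.mul_sum, ← Finset.sum_add_distrib, Finset.mul_sum]
  refine Finset.sum_le_sum fun σ hσ => ?_
  have ha := D.area_pos hΩ σ
  rw [D.area_mul_dist hΩ hd hσ]
  have hi : IntegrableOn (fun x => φ x ^ 2) (D.cone K σ) :=
    hint.mono_set ((D.cone_subset_cell hΩ hσ).trans (D.cell_subset K))
  have hfin : volume (D.cone K σ) ≠ ⊤ :=
    ((D.isBounded_cell hΩ K).subset (D.cone_subset_cell hΩ hσ)).measure_lt_top.ne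
  have h3 : ∫ x in D.cone K σ, q σ ^ 2 ≤
      ∫ x in D.cone K σ, (2 * φ x ^ 2 + 2 * (M ^ 2 * D.size ^ 2)) := by
    apply setIntegral_mono_on (integrableOn_const hfin)
      ((hi.const_mul 2).add (integrableOn_const hfin)) (D.measurableSet_cone hΩ hσ)
    intro x hx
    have h4 : q σ ≤ |φ x| + M * D.size := by
      rw [hq, inv_mul_le_iff₀ ha, mul_comm]
      apply D.abs_integral_face_le hΩ
      intro y hy
      have h5 := hφ.lip y x
      have h6 := (D.dist_le_diam_of_mem_closure hΩ (D.face_subset_closure_cell hσ hy)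
        (subset_closure (D.cone_subset_cell hΩ hσ hx))).trans (D.diam_le_size K)
      have h7 := abs_add_le (φ x) (φ y - φ x)
      rw [add_sub_cancel] at h7
      have h8 : M * ‖y - x‖ ≤ M * D.size := by gcongr
      linarith
    have hq0 : 0 ≤ q σ := by positivity
    calc q σ ^ 2 ≤ (|φ x| + M * D.size) ^ 2 := by gcongr
      _ ≤ _ := by
        simp only [Pi.add_apply]
        rw [← sq_abs (φ x)]
        nlinarith [sq_nonneg (|φ x| - M * D.size)]
  rw [setIntegral_const, integral_add (hi.const_mul 2) (integrableOn_const hfin),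
    integral_const_mul, setIntegral_const, smul_eq_mul, smul_eq_mul] at h3
  have hd0 : (0 : ℝ) ≤ d := Nat.cast_nonneg d
  nlinarith

theorem bary_mem_cthickening (hΩ : Bornology.IsBounded Ω) (σ : D.Edge) {y : Eucl d}
    (hy : y ∈ D.face σ) : ‖D.bary σ - y‖ ≤ D.size := by
  obtain ⟨K, hK⟩ := D.exists_mem_edges σ
  exact (D.norm_bary_sub_le hΩ hK (D.face_subset_closure_cell hK hy)).trans (D.diam_le_size K)

/-- On fine meshes, the interpolation of a test function vanishes on the boundary. -/
theorem exists_pos_memX0_interp (hΩ : Bornology.IsBounded Ω) (hΩo : IsOpen Ω) {φ : Eucl d → ℝ}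
    (hφ : IsTestFunction Ω φ) :
    ∃ ε > 0, ∀ D : Discretisation Ω, D.size < ε → D.MemX0 (D.interp φ) := by
  obtain ⟨ε, hε, hεΩ⟩ := (show IsCompact (tsupport φ) from hφ.2.1).exists_thickening_subset_open
    hΩo hφ.2.2
  refine ⟨ε, hε, fun D hD σ hσ => ?_⟩
  by_contra hne
  -- A face need not be convex, so its barycentre may lie off it. A point of the face itself, at
  -- distance at most `h` from the barycentre, is used as the boundary point.
  obtain ⟨y, hy⟩ := D.face_nonempty σ
  have h1 : y ∈ frontier Ω := D.extEdges_subset_frontier hσ hy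
  have h2 : D.bary σ ∈ tsupport φ := subset_tsupport φ hne
  have h3 : y ∈ Metric.thickening ε (tsupport φ) := by
    rw [Metric.mem_thickening_iff]
    refine ⟨_, h2, ?_⟩
    rw [dist_comm, dist_eq_norm]
    exact (D.bary_mem_cthickening hΩ σ hy).trans_lt hD
  rw [frontier, hΩo.interior_eq] at h1
  exact h1.2 (hεΩ h3)

end Discretisation

end HybridFV
namespace HybridFV
variable {d : ℕ}

/-! ### Weak sequential compactness -/

/-- Sequential Banach–Alaoglu in the dual of a separable space, transported by the Riesz
isomorphism. -/
theorem exists_subseq_tendsto_inner {H : Type*} [NormedAddCommGroup H] [InnerProductSpace ℝ H]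
    [CompleteSpace H] [TopologicalSpace.SeparableSpace H] {x : ℕ → H} {C : ℝ}
    (hx : ∀ n, ‖x n‖ ≤ C) :
    ∃ (a : H) (φ : ℕ → ℕ), StrictMono φ ∧
      ∀ y, Tendsto (fun n => ⟪x (φ n), y⟫) atTop (𝓝 ⟪a, y⟫) := by
  obtain ⟨a, -, φ, hφ, h⟩ := WeakDual.isSeqCompact_closedBall ℝ H
    (0 : StrongDual ℝ H) C (x := fun n => StrongDual.toWeakDual (InnerProductSpace.toDual ℝ H (x n)))
    (fun n => by
      simp only [mem_preimage, Metric.mem_closedBall, dist_zero_right]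
      exact ((InnerProductSpace.toDual ℝ H).norm_map (x n)).trans_le (hx n))
  refine ⟨(InnerProductSpace.toDual ℝ H).symm (WeakDual.toStrongDual a), φ, hφ, fun y => ?_⟩
  have h1 := ((WeakDual.eval_continuous y).tendsto a).comp h
  rw [InnerProductSpace.toDual_symm_apply]
  exact h1

/-! ### Translations and duality -/

theorem exists_bound_fderiv {φ : Eucl d → ℝ} (hφ : ContDiff ℝ 1 φ) (hc : HasCompactSupport φ) :
    ∃ M, ∀ x, ‖fderiv ℝ φ x‖ ≤ M :=
  (hφ.continuous_fderiv one_ne_zero).bounded_above_of_compact_support (hc.fderiv ℝ)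

/-- A bound on the weak derivative of `u` in the direction `η` bounds its increments. -/
theorem abs_integral_mul_translate_sub_le {u : Eucl d → ℝ} (hu : Integrable u) {φ : Eucl d → ℝ}
    (hφ : ContDiff ℝ 1 φ) (hc : HasCompactSupport φ) {η : Eucl d} {A : ℝ}
    (h : ∀ s : ℝ, |∫ x, u x * fderiv ℝ φ (x - s • η) η| ≤ A) :
    |∫ x, (u (x + η) - u x) * φ x| ≤ A := by
  obtain ⟨M, hM⟩ := exists_bound_fderiv hφ hc
  obtain ⟨M0, hM0⟩ := hφ.continuous.bounded_above_of_compact_support hc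
  have hint : ∀ s : ℝ, Integrable (fun x => u x * φ (x - s • η)) := fun s =>
    hu.mul_bdd (c := M0) (hφ.continuous.comp (by fun_prop)).aestronglyMeasurable
      (Eventually.of_forall fun x => hM0 _)
  -- The increment of `u`, tested against `φ`, is the increment from `s = 0` to `s = 1` of `∫ u φ(·
  -- - s η)`. The hypothesis bounds the derivative in `s`, so the mean value inequality applies.
  have hder : ∀ s : ℝ, HasDerivAt (fun s => ∫ x, u x * φ (x - s • η))
      (∫ x, u x * (fderiv ℝ φ (x - s • η) (-η))) s := fun s => by
    refine (hasDerivAt_integral_of_dominated_loc_of_deriv_le (μ := volume)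
      (F' := fun s x => u x * (fderiv ℝ φ (x - s • η) (-η)))
      (bound := fun x => ‖u x‖ * (M * ‖η‖)) univ_mem (Eventually.of_forall fun s =>
        (hint s).aestronglyMeasurable) (hint s) ?_ ?_ (hu.norm.mul_const _) ?_).2
    · refine hu.aestronglyMeasurable.mul (Continuous.aestronglyMeasurable ?_)
      exact ((hφ.continuous_fderiv one_ne_zero).comp (by fun_prop)).clm_apply continuous_const
    · refine Eventually.of_forall fun x s _ => ?_
      rw [norm_mul]
      gcongr
      refine (ContinuousLinearMap.le_opNorm _ _).trans ?_
      rw [norm_neg]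
      gcongr
      exact hM _
    · refine Eventually.of_forall fun x s _ => ?_
      have h1 : HasDerivAt (fun s : ℝ => x - s • η) (-η) s := by
        simpa using ((hasDerivAt_id s).smul_const η).const_sub x
      exact ((((hφ.differentiable one_ne_zero) _).hasFDerivAt).comp_hasDerivAt s h1).const_mul _
  have key := norm_image_sub_le_of_norm_deriv_le_segment_01'
    (fun s _ => (hder s).hasDerivWithinAt) (C := A) (fun s _ => by
      simp only [map_neg, mul_neg, integral_neg, norm_neg]
      exact h s)
  have e1 : ∫ x, (u (x + η) - u x) * φ x = (∫ x, u x * φ (x - (1 : ℝ) • η)) -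
      ∫ x, u x * φ (x - (0 : ℝ) • η) := by
    rw [← integral_add_right_eq_self (fun x => u x * φ (x - (1 : ℝ) • η)) η, ← integral_sub]
    · simp [sub_mul]
    · exact (hint 1).comp_add_right η
    · exact hint 0
  rw [e1]
  exact key

/-- `L¹` norms by duality with test functions. -/
theorem integral_abs_le_of_dual {g : Eucl d → ℝ} (hg : Integrable g) {A : ℝ}
    (h : ∀ φ : Eucl d → ℝ, ContDiff ℝ ∞ φ → HasCompactSupport φ → (∀ x, |φ x| ≤ 1) →
      |∫ x, g x * φ x| ≤ A) : ∫ x, |g x| ≤ A := by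
  refine le_of_forall_pos_le_add fun ε hε => ?_
  obtain ⟨ψ, hc, hs, hψ⟩ := (memLp_one_iff_integrable.2 hg).exist_eLpNorm_sub_le
    ENNReal.one_ne_top le_rfl (ε := ε / 3) (by positivity)
  have hψi : Integrable ψ := hs.continuous.integrable_of_hasCompactSupport hc
  have h1 : ∫ x, |g x - ψ x| ≤ ε / 3 := by
    rw [eLpNorm_one_eq_lintegral_enorm] at hψ
    have := (hg.sub hψi)
    calc ∫ x, |g x - ψ x| = (∫⁻ x, ‖(g - ψ) x‖ₑ).toReal := by
          rw [← integral_norm_eq_lintegral_enorm this.aestronglyMeasurable]; rfl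
      _ ≤ ε / 3 := ENNReal.toReal_le_of_le_ofReal (by positivity) hψ
  -- The test function is the smoothed sign `ψ / √(ψ² + δ²)` of a smooth approximation `ψ` of `g`.
  -- It loses at most `δ` at each point of the support of `ψ`, whence this choice; replacing `g` by
  -- `ψ` costs `ε / 3` twice.
  obtain ⟨δ, hδ, hδ'⟩ : ∃ δ : ℝ, 0 < δ ∧ δ * volume.real (tsupport ψ) ≤ ε / 3 := by
    refine ⟨ε / 3 / (volume.real (tsupport ψ) + 1), by positivity, ?_⟩
    rw [div_mul_eq_mul_div, div_le_iff₀ (by positivity)]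
    have : 0 ≤ volume.real (tsupport ψ) := measureReal_nonneg
    gcongr
    linarith
  have hpos : ∀ x, 0 < ψ x ^ 2 + δ ^ 2 := fun x => by positivity
  set φ : Eucl d → ℝ := fun x => ψ x * (√(ψ x ^ 2 + δ ^ 2))⁻¹ with hφ
  have hφs : ContDiff ℝ ∞ φ := hs.mul ((((hs.pow 2).add contDiff_const).sqrt
    fun x => (hpos x).ne').inv fun x => (Real.sqrt_pos.2 (hpos x)).ne')
  have hφc : HasCompactSupport φ := hc.mul_right
  have hle : ∀ x, |ψ x| ≤ √(ψ x ^ 2 + δ ^ 2) := fun x => by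
    rw [← Real.sqrt_sq_eq_abs]
    exact Real.sqrt_le_sqrt (by nlinarith)
  have hφ1 : ∀ x, |φ x| ≤ 1 := fun x => by
    rw [hφ]
    simp only [abs_mul, abs_inv, abs_of_nonneg (Real.sqrt_nonneg _)]
    rw [← div_eq_mul_inv]
    exact div_le_one_of_le₀ (hle x) (Real.sqrt_nonneg _)
  have hkey : ∀ x, |ψ x| ≤ ψ x * φ x + (tsupport ψ).indicator (fun _ => δ) x := fun x => by
    by_cases hx : x ∈ tsupport ψ
    · rw [indicator_of_mem hx]
      have h2 := Real.sqrt_pos.2 (hpos x)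
      have h3 : √(ψ x ^ 2 + δ ^ 2) ≤ |ψ x| + δ := by
        rw [Real.sqrt_le_iff]
        refine ⟨by positivity, ?_⟩
        nlinarith [abs_nonneg (ψ x), sq_abs (ψ x)]
      have h4 : ψ x * φ x = |ψ x| ^ 2 / √(ψ x ^ 2 + δ ^ 2) := by
        rw [hφ, sq_abs]; simp only; ring
      rw [h4]
      have h5 : |ψ x| - δ ≤ |ψ x| ^ 2 / √(ψ x ^ 2 + δ ^ 2) := by
        rw [le_div_iff₀ h2]
        by_cases h6 : |ψ x| - δ ≤ 0
        · exact (mul_nonpos_of_nonpos_of_nonneg h6 h2.le).trans (by positivity)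
        · nlinarith
      linarith
    · have : ψ x = 0 := image_eq_zero_of_notMem_tsupport hx
      simp [this, hx]
  have hgφ : Integrable fun x => g x * φ x := hg.mul_bdd (c := 1)
    hφs.continuous.aestronglyMeasurable (Eventually.of_forall hφ1)
  have hψφ : Integrable fun x => ψ x * φ x := hψi.mul_bdd (c := 1)
    hφs.continuous.aestronglyMeasurable (Eventually.of_forall hφ1)
  have hind : Integrable ((tsupport ψ).indicator (fun _ => δ)) :=
    (integrable_indicator_iff (isClosed_tsupport ψ).measurableSet).2
      (integrableOn_const hc.measure_lt_top.ne)
  have hdiff : Integrable fun x => |g x - ψ x| := (hg.sub hψi).abs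
  calc ∫ x, |g x| ≤ ∫ x, (g x * φ x + (tsupport ψ).indicator (fun _ => δ) x +
        (|g x - ψ x| + |g x - ψ x|)) := by
        refine integral_mono hg.abs ((hgφ.add hind).add (hdiff.add hdiff)) fun x => ?_
        have a1 : |g x| ≤ |g x - ψ x| + |ψ x| := by
          simpa using abs_add_le (g x - ψ x) (ψ x)
        have a2 : (ψ x - g x) * φ x ≤ |g x - ψ x| := by
          refine (le_abs_self _).trans ?_
          rw [abs_mul, abs_sub_comm]
          exact mul_le_of_le_one_right (abs_nonneg _) (hφ1 x)
        simp only
        linarith [hkey x]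
    _ = (∫ x, g x * φ x) + δ * volume.real (tsupport ψ) +
        ((∫ x, |g x - ψ x|) + ∫ x, |g x - ψ x|) := by
        refine (integral_add (hgφ.add hind) (hdiff.add hdiff)).trans ?_
        rw [integral_add' hgφ hind, integral_add' hdiff hdiff,
          integral_indicator (isClosed_tsupport ψ).measurableSet, setIntegral_const, smul_eq_mul,
          mul_comm δ]
    _ ≤ A + ε := by linarith [le_abs_self (∫ x, g x * φ x), h φ hφs hφc hφ1]

/-- `L²` norms by duality with test functions. -/
theorem eLpNorm_le_of_dual {g : Eucl d → ℝ} (hg : MemLp g 2) {A : ℝ} (hA : 0 ≤ A)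
    (h : ∀ φ : Eucl d → ℝ, ContDiff ℝ ∞ φ → HasCompactSupport φ →
      |∫ x, g x * φ x| ≤ A * √(∫ x, φ x ^ 2)) : eLpNorm g 2 volume ≤ ENNReal.ofReal A := by
  have key : ∀ f : Lp ℝ 2 (volume : Measure (Eucl d)), ⟪hg.toLp g, f⟫ ≤ A * ‖f‖ := by
    intro f
    have hcl : IsClosed {f : Lp ℝ 2 (volume : Measure (Eucl d)) | ⟪hg.toLp g, f⟫ ≤ A * ‖f‖} :=
      isClosed_le (by fun_prop) (by fun_prop)
    have hd := Lp.dense_hasCompactSupport_contDiff (E := Eucl d) (F := ℝ) (p := 2) (μ := volume)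
      (by norm_num)
    refine (hcl.closure_subset_iff.2 ?_) (hd f)
    rintro f ⟨φ, hfφ, hc, hs⟩
    have e1 : ⟪hg.toLp g, f⟫ = ∫ x, g x * φ x := by
      rw [L2.inner_def]
      refine integral_congr_ae ?_
      filter_upwards [hfφ, hg.coeFn_toLp] with x h1 h2
      rw [h1, h2]; simp [mul_comm]
    have e2 : ‖f‖ = √(∫ x, φ x ^ 2) := by
      rw [norm_eq_sqrt_real_inner, L2.inner_def]
      congr 1
      refine integral_congr_ae ?_
      filter_upwards [hfφ] with x h1
      rw [h1]; simp [sq]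
    rw [mem_ofPred_eq, e1, e2]
    exact (le_abs_self _).trans (h φ hs hc)
  -- By density the bound holds against every `L²` function, in particular against `g` itself.
  have h1 := key (hg.toLp g)
  rw [real_inner_self_eq_norm_sq] at h1
  have h2 : ‖hg.toLp g‖ ≤ A := by
    by_contra hlt
    push Not at hlt
    nlinarith
  rw [Lp.norm_toLp] at h2
  exact (ENNReal.le_ofReal_iff_toReal_le hg.eLpNorm_ne_top hA).2 h2

/-! ### Mollification -/

theorem enorm_integral_sq_le {α F : Type*} [MeasurableSpace α] [NormedAddCommGroup F]
    [NormedSpace ℝ F] (P : Measure α) [IsProbabilityMeasure P] {g : α → F}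
    (hg : AEStronglyMeasurable g P) : ‖∫ t, g t ∂P‖ₑ ^ 2 ≤ ∫⁻ t, ‖g t‖ₑ ^ 2 ∂P := by
  have h1 : ‖∫ t, g t ∂P‖ₑ ≤ eLpNorm g 1 P := by
    rw [eLpNorm_one_eq_lintegral_enorm]; exact enorm_integral_le_lintegral_enorm _
  have h2 : eLpNorm g 1 P ≤ eLpNorm g 2 P := eLpNorm_le_eLpNorm_of_exponent_le (by norm_num) hg
  have h3 : eLpNorm g 2 P ^ 2 = ∫⁻ t, ‖g t‖ₑ ^ 2 ∂P := by
    have := eLpNorm_nnreal_pow_eq_lintegral (f := g) (μ := P) (p := 2) (by norm_num)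
    simpa using this
  rw [← h3]
  gcongr
  exact h1.trans h2

theorem eLpNorm_two_sq {α F : Type*} [MeasurableSpace α] [NormedAddCommGroup F] (P : Measure α)
    (g : α → F) : eLpNorm g 2 P ^ 2 = ∫⁻ t, ‖g t‖ₑ ^ 2 ∂P := by
  have := eLpNorm_nnreal_pow_eq_lintegral (f := g) (μ := P) (p := 2) (by norm_num)
  simpa using this

/-- Jensen for the probability measure, then Tonelli. Both mollification estimates are instances, a
mollification being an average of translates. -/
theorem lintegral_enorm_integral_sq_le {α γ F : Type*} [MeasurableSpace α] [MeasurableSpace γ]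
    [NormedAddCommGroup F] [NormedSpace ℝ F] (μ : Measure γ) [SFinite μ]
    (P : Measure α) [IsProbabilityMeasure P] {g : γ → α → F}
    (hg : AEStronglyMeasurable (Function.uncurry g) (μ.prod P)) {C : ℝ≥0∞}
    (hC : ∀ᵐ t ∂P, ∫⁻ x, ‖g x t‖ₑ ^ 2 ∂μ ≤ C) :
    ∫⁻ x, ‖∫ t, g x t ∂P‖ₑ ^ 2 ∂μ ≤ C := by
  calc ∫⁻ x, ‖∫ t, g x t ∂P‖ₑ ^ 2 ∂μ ≤ ∫⁻ x, ∫⁻ t, ‖g x t‖ₑ ^ 2 ∂P ∂μ := by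
        refine lintegral_mono_ae ?_
        filter_upwards [hg.prodMk_left] with x hx
        exact enorm_integral_sq_le P hx
    _ = ∫⁻ t, ∫⁻ x, ‖g x t‖ₑ ^ 2 ∂μ ∂P := lintegral_lintegral_swap (hg.enorm.pow_const 2)
    _ ≤ ∫⁻ _, C ∂P := lintegral_mono_ae hC
    _ = C := by simp

/-- A smooth bump function with radius `r`. -/
noncomputable def bump (r : ℝ) (hr : 0 < r) : ContDiffBump (0 : Eucl d) :=
  ⟨r / 2, r, by positivity, by linarith⟩

/-- The normalised bump function with radius `r`. -/
noncomputable def mollifier (r : ℝ) (hr : 0 < r) : Eucl d → ℝ := (bump r hr).normed volume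

section Mollifier

variable (r : ℝ) (hr : 0 < r)

theorem mollifier_contDiff : ContDiff ℝ ∞ (mollifier (d := d) r hr) := (bump r hr).contDiff_normed

theorem mollifier_nonneg (x : Eucl d) : 0 ≤ mollifier r hr x := (bump r hr).nonneg_normed x

theorem mollifier_integral : ∫ x : Eucl d, mollifier r hr x = 1 := (bump r hr).integral_normed

theorem mollifier_hasCompactSupport : HasCompactSupport (mollifier (d := d) r hr) :=
  (bump r hr).hasCompactSupport_normed

theorem mollifier_support : Function.support (mollifier (d := d) r hr) = Metric.ball 0 r :=
  (bump r hr).support_normed_eq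

theorem mollifier_integrable : Integrable (mollifier (d := d) r hr) := (bump r hr).integrable_normed

/-- The probability measure with density `mollifier r`. -/
noncomputable def mollifierMeasure : Measure (Eucl d) :=
  volume.withDensity fun x => ENNReal.ofReal (mollifier r hr x)

instance : IsProbabilityMeasure (mollifierMeasure (d := d) r hr) := by
  constructor
  rw [mollifierMeasure, withDensity_apply _ MeasurableSet.univ, setLIntegral_univ,
    ← ofReal_integral_eq_lintegral_ofReal (mollifier_integrable r hr)
      (Eventually.of_forall (mollifier_nonneg r hr)), mollifier_integral, ENNReal.ofReal_one]

theorem mollifierMeasure_absolutelyContinuous :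
    mollifierMeasure (d := d) r hr ≪ volume := withDensity_absolutelyContinuous _ _

theorem ae_mem_ball_mollifierMeasure : ∀ᵐ t ∂(mollifierMeasure (d := d) r hr), ‖t‖ < r := by
  have hm : Measurable fun x : Eucl d => ENNReal.ofReal (mollifier r hr x) :=
    (mollifier_contDiff r hr).continuous.measurable.ennreal_ofReal
  rw [mollifierMeasure, ae_withDensity_iff hm]
  refine Eventually.of_forall fun x hx => ?_
  have : x ∈ Function.support (mollifier (d := d) r hr) := fun h0 => hx (by simp [h0])
  rw [mollifier_support] at this
  simpa using this

theorem integral_mollifierMeasure {F : Type*} [NormedAddCommGroup F] [NormedSpace ℝ F]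
    (g : Eucl d → F) :
    ∫ t, g t ∂(mollifierMeasure r hr) = ∫ t, mollifier r hr t • g t := by
  rw [mollifierMeasure, integral_withDensity_eq_integral_toReal_smul
    (mollifier_contDiff r hr).continuous.measurable.ennreal_ofReal (by simp)]
  refine integral_congr_ae (Eventually.of_forall fun t => ?_)
  simp only
  rw [ENNReal.toReal_ofReal (mollifier_nonneg r hr t)]

/-- The mollification of a function. -/
noncomputable def mollify (u : Eucl d → ℝ) : Eucl d → ℝ :=
  convolution (mollifier r hr) u (ContinuousLinearMap.lsmul ℝ ℝ) volume

theorem mollify_eq (u : Eucl d → ℝ) (x : Eucl d) :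
    mollify r hr u x = ∫ t, u (x - t) ∂(mollifierMeasure r hr) := by
  rw [integral_mollifierMeasure]; rfl

theorem mollify_eq' (u : Eucl d → ℝ) (x : Eucl d) :
    mollify r hr u x = ∫ t, u t * mollifier r hr (x - t) := by
  rw [mollify, convolution_eq_swap]
  simp [mul_comm]

variable {u : Eucl d → ℝ}

theorem mollify_contDiff (hu : LocallyIntegrable u) : ContDiff ℝ ∞ (mollify r hr u) :=
  (mollifier_hasCompactSupport r hr).contDiff_convolution_left _ (mollifier_contDiff r hr) hu

theorem integrable_mollifierMeasure (hu : LocallyIntegrable u) (x : Eucl d) :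
    Integrable (fun t => u (x - t)) (mollifierMeasure r hr) := by
  rw [mollifierMeasure, integrable_withDensity_iff_integrable_smul'
    (mollifier_contDiff r hr).continuous.measurable.ennreal_ofReal (by simp)]
  have h := (mollifier_hasCompactSupport r hr).convolutionExists_left
    (ContinuousLinearMap.lsmul ℝ ℝ) (mollifier_contDiff r hr).continuous hu x
  refine h.congr (Eventually.of_forall fun t => ?_)
  simp only
  rw [ENNReal.toReal_ofReal (mollifier_nonneg r hr t)]; rfl

theorem mollify_support_subset (u : Eucl d → ℝ) {S : Set (Eucl d)} (h : ∀ x ∉ S, u x = 0)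
    {x : Eucl d} (hx : ∀ y ∈ S, r ≤ ‖x - y‖) : mollify r hr u x = 0 := by
  rw [mollify_eq]
  refine integral_eq_zero_of_ae ?_
  filter_upwards [ae_mem_ball_mollifierMeasure r hr] with t ht
  refine h _ fun hS => ?_
  have := hx _ hS
  simp at this
  linarith

theorem aestronglyMeasurable_uncurry_sub (hu : AEStronglyMeasurable u) :
    AEStronglyMeasurable (fun p : Eucl d × Eucl d => u (p.1 - p.2))
      ((volume : Measure (Eucl d)).prod (mollifierMeasure r hr)) := by
  refine AEStronglyMeasurable.mono_ac ?_ (hu.comp_quasiMeasurePreserving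
    (quasiMeasurePreserving_sub_of_right_invariant volume volume))
  exact Measure.AbsolutelyContinuous.prod (Measure.AbsolutelyContinuous.refl _)
    (mollifierMeasure_absolutelyContinuous r hr)

/-- The mollification error is bounded by the increments. -/
theorem lintegral_mollify_sub_sq_le (hu : LocallyIntegrable u) {C : ℝ≥0∞}
    (h : ∀ t : Eucl d, ‖t‖ < r → ∫⁻ x, ‖u (x - t) - u x‖ₑ ^ 2 ≤ C) :
    ∫⁻ x, ‖mollify r hr u x - u x‖ₑ ^ 2 ≤ C := by
  have e : ∀ x, mollify r hr u x - u x = ∫ t, (u (x - t) - u x) ∂(mollifierMeasure r hr) := by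
    intro x
    rw [integral_sub (integrable_mollifierMeasure r hr hu x) (integrable_const _), mollify_eq]
    simp
  simp_rw [e]
  refine lintegral_enorm_integral_sq_le volume _ ?_ ?_
  · exact (aestronglyMeasurable_uncurry_sub r hr hu.aestronglyMeasurable).sub
      hu.aestronglyMeasurable.comp_fst
  · filter_upwards [ae_mem_ball_mollifierMeasure r hr] with t ht using h t ht

/-- Mollification does not increase the `L²` norm of the increments. -/
theorem lintegral_mollify_translate_sub_sq_le (hu : LocallyIntegrable u) (η : Eucl d) :
    ∫⁻ x, ‖mollify r hr u (x + η) - mollify r hr u x‖ₑ ^ 2 ≤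
      ∫⁻ x, ‖u (x + η) - u x‖ₑ ^ 2 := by
  have e : ∀ x, mollify r hr u (x + η) - mollify r hr u x =
      ∫ t, (u (x - t + η) - u (x - t)) ∂(mollifierMeasure r hr) := by
    intro x
    have h1 := integrable_mollifierMeasure r hr hu (x + η)
    simp_rw [add_sub_right_comm] at h1
    rw [integral_sub h1 (integrable_mollifierMeasure r hr hu x),
      mollify_eq, mollify_eq]
    simp_rw [add_sub_right_comm]
  simp_rw [e]
  have hη : AEStronglyMeasurable (fun x => u (x + η) - u x) :=
    (hu.aestronglyMeasurable.comp_quasiMeasurePreserving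
      (measurePreserving_add_right volume η).quasiMeasurePreserving).sub hu.aestronglyMeasurable
  refine lintegral_enorm_integral_sq_le volume _ ?_ ?_
  · exact aestronglyMeasurable_uncurry_sub r hr hη
  · refine Eventually.of_forall fun t => le_of_eq ?_
    exact lintegral_sub_right_eq_self (fun x => ‖u (x + η) - u x‖ₑ ^ 2) t

end Mollifier

end HybridFV
namespace HybridFV
variable {d : ℕ}

/-! ### Compactness in `L²` -/

theorem locallyIntegrable_of_memLp_two {u : Eucl d → ℝ} (hu : MemLp u 2) : LocallyIntegrable u :=
  hu.locallyIntegrable (by norm_num)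

theorem eLpNorm_two_le_iff {α F : Type*} [MeasurableSpace α] [NormedAddCommGroup F]
    {P : Measure α} {g : α → F} {c : ℝ≥0∞} :
    eLpNorm g 2 P ≤ c ↔ ∫⁻ t, ‖g t‖ₑ ^ 2 ∂P ≤ c ^ 2 := by
  rw [← eLpNorm_two_sq]
  exact (ENNReal.pow_le_pow_left_iff two_ne_zero).symm

/-- The **Kolmogorov–Riesz** compactness criterion in `L²`. -/
theorem exists_subseq_tendsto_of_translate {u : ℕ → Eucl d → ℝ} {S : Set (Eucl d)}
    (hS : Bornology.IsBounded S) (hSm : MeasurableSet S)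
    (hu : ∀ n, MemLp (u n) 2) (h0 : ∀ n, ∀ x ∉ S, u n x = 0) {C : ℝ}
    (hC : ∀ n, eLpNorm (u n) 2 ≤ ENNReal.ofReal C)
    (ht : ∀ ε : ℝ, 0 < ε → ∃ r : ℝ, 0 < r ∧ ∀ n, ∀ t : Eucl d, ‖t‖ < r →
      ∫⁻ x, ‖u n (x - t) - u n x‖ₑ ^ 2 ≤ ENNReal.ofReal ε) :
    ∃ (φ : ℕ → ℕ) (v : Eucl d → ℝ), StrictMono φ ∧ MemLp v 2 ∧ (∀ x ∉ S, v x = 0) ∧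
      Tendsto (fun n => eLpNorm (fun x => u (φ n) x - v x) 2) atTop (𝓝 0) := by
  have hC0 : ∀ n, ‖(hu n).toLp (u n)‖ ≤ max C 0 := fun n => by
    rw [Lp.norm_toLp]
    refine ENNReal.toReal_le_of_le_ofReal (le_max_right _ _) ((hC n).trans ?_)
    exact ENNReal.ofReal_le_ofReal (le_max_left _ _)
  have : Fact ((2 : ℝ≥0∞) ≠ ⊤) := ⟨by norm_num⟩
  obtain ⟨a, φ, hφ, ha⟩ := exists_subseq_tendsto_inner hC0
  obtain ⟨R, hR⟩ := hS.subset_closedBall 0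
  -- mollified functions converge in `L²`
  have hmol : ∀ (r : ℝ) (hr : 0 < r), ∃ m : Eucl d → ℝ, AEStronglyMeasurable m ∧
      Tendsto (fun n => ∫⁻ x, ‖mollify r hr (u (φ n)) x - m x‖ₑ ^ 2) atTop (𝓝 0) := by
    intro r hr
    have hρ : MemLp (mollifier (d := d) r hr) 2 :=
      (mollifier_contDiff r hr).continuous.memLp_of_hasCompactSupport
        (mollifier_hasCompactSupport r hr)
    have hρx : ∀ x, MemLp (fun t => mollifier (d := d) r hr (x - t)) 2 := fun x =>
      hρ.comp_measurePreserving (Measure.measurePreserving_sub_left volume x)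
    have hnorm : ∀ x, ‖(hρx x).toLp‖ = (eLpNorm (mollifier (d := d) r hr) 2).toReal := fun x => by
      rw [Lp.norm_toLp]
      congr 1
      exact eLpNorm_comp_measurePreserving hρ.aestronglyMeasurable
        (Measure.measurePreserving_sub_left volume x)
    -- The value of a mollification at a point is an inner product with a reflected translate of the
    -- mollifier, so weak convergence gives pointwise convergence. The translates share one norm
    -- `κ`, which provides the constant for dominated convergence.
    have hin : ∀ n x, mollify r hr (u n) x = ⟪(hu n).toLp (u n), (hρx x).toLp⟫ := fun n x => by
      rw [mollify_eq', L2.inner_def]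
      refine integral_congr_ae ?_
      filter_upwards [(hu n).coeFn_toLp, (hρx x).coeFn_toLp] with t h1 h2
      rw [h1, h2]; simp [mul_comm]
    set κ := (eLpNorm (mollifier (d := d) r hr) 2).toReal
    set m : Eucl d → ℝ := fun x => ⟪a, (hρx x).toLp⟫ with hm
    have hlim : ∀ x, Tendsto (fun n => mollify r hr (u (φ n)) x) atTop (𝓝 (m x)) := fun x => by
      simp_rw [hin]; exact ha _
    have hmeas : ∀ n, AEStronglyMeasurable (mollify r hr (u (φ n))) := fun n =>
      (mollify_contDiff r hr
        (locallyIntegrable_of_memLp_two (hu _))).continuous.aestronglyMeasurable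
    have hmm : AEStronglyMeasurable m :=
      aestronglyMeasurable_of_tendsto_ae atTop hmeas (Eventually.of_forall hlim)
    refine ⟨m, hmm, ?_⟩
    have hz : ∀ n x, x ∉ Metric.closedBall (0 : Eucl d) (R + r) → mollify r hr (u n) x = 0 := by
      intro n x hx
      refine mollify_support_subset r hr (u n) (h0 n) fun y hy => ?_
      have h1 := hR hy
      simp only [Metric.mem_closedBall, dist_zero_right, not_le] at h1 hx
      linarith [norm_sub_norm_le x y]
    have hmz : ∀ x, x ∉ Metric.closedBall (0 : Eucl d) (R + r) → m x = 0 := fun x hx =>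
      tendsto_nhds_unique (hlim x) (by simp [hz _ x hx])
    set K := (max C 0 + ‖a‖) * κ
    have hκ : 0 ≤ κ := ENNReal.toReal_nonneg
    have hb : ∀ n x, ‖mollify r hr (u (φ n)) x - m x‖ ≤ K := fun n x => by
      refine (norm_sub_le _ _).trans ?_
      rw [hin, hm]
      have h1 := norm_inner_le_norm (𝕜 := ℝ) ((hu (φ n)).toLp (u (φ n))) ((hρx x).toLp)
      have h2 := norm_inner_le_norm (𝕜 := ℝ) a ((hρx x).toLp)
      rw [hnorm] at h1 h2
      have h3 := mul_le_mul_of_nonneg_right (hC0 (φ n)) hκ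
      simp only [K, add_mul]
      linarith
    have := tendsto_lintegral_of_dominated_convergence'
      (F := fun n x => ‖mollify r hr (u (φ n)) x - m x‖ₑ ^ 2) (f := fun _ => 0) (μ := volume)
      (bound := (Metric.closedBall (0 : Eucl d) (R + r)).indicator fun _ => ENNReal.ofReal K ^ 2)
      (fun n => ((hmeas n).sub hmm).enorm.pow_const 2)
      (fun n => Eventually.of_forall fun x => by
        by_cases hx : x ∈ Metric.closedBall (0 : Eucl d) (R + r)
        · rw [indicator_of_mem hx]
          refine pow_le_pow_left' ?_ 2
          rw [← ofReal_norm]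
          exact ENNReal.ofReal_le_ofReal (hb n x)
        · simp [hz _ x hx, hmz x hx])
      (by
        rw [lintegral_indicator measurableSet_closedBall, setLIntegral_const]
        exact ENNReal.mul_ne_top (by finiteness) measure_closedBall_lt_top.ne)
      (Eventually.of_forall fun x => by
        have h1 := ENNReal.Tendsto.pow (n := 2) ((hlim x).sub_const (m x)).enorm
        simpa using h1)
    simpa using this
  -- the sequence is Cauchy
  have hcau : CauchySeq fun n => (hu (φ n)).toLp (u (φ n)) := by
    rw [Metric.cauchySeq_iff']
    intro ε hε
    -- Each of two terms of the subsequence is within `2 ε / 5` of `m`: one fifth for mollifying,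
    -- uniform in the index, and one for the convergence of mollifications. The total `4 ε / 5` is
    -- less than `ε`.
    obtain ⟨r, hr, hr'⟩ := ht ((ε / 5) ^ 2) (by positivity)
    obtain ⟨m, hm, hlim⟩ := hmol r hr
    have hli : ∀ n, LocallyIntegrable (u n) := fun n => locallyIntegrable_of_memLp_two (hu n)
    have hmeas : ∀ n, AEStronglyMeasurable (mollify r hr (u n)) := fun n =>
      (mollify_contDiff r hr (hli n)).continuous.aestronglyMeasurable
    have hpos : (0 : ℝ≥0∞) < ENNReal.ofReal (ε / 5) ^ 2 := by positivity
    obtain ⟨N, hN⟩ := eventually_atTop.1 (hlim.eventually (gt_mem_nhds hpos))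
    have h1 : ∀ n, eLpNorm (mollify r hr (u n) - u n) 2 ≤ ENNReal.ofReal (ε / 5) := fun n => by
      rw [eLpNorm_two_le_iff, ← ENNReal.ofReal_pow (by positivity)]
      exact lintegral_mollify_sub_sq_le r hr (hli n) fun t h => hr' n t h
    have h2 : ∀ n ≥ N, eLpNorm (mollify r hr (u (φ n)) - m) 2 ≤ ENNReal.ofReal (ε / 5) :=
      fun n hn => eLpNorm_two_le_iff.2 (hN n hn).le
    have h3 : ∀ n ≥ N, eLpNorm (u (φ n) - m) 2 ≤ ENNReal.ofReal (2 * (ε / 5)) := fun n hn => by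
      have e : u (φ n) - m = (mollify r hr (u (φ n)) - m) - (mollify r hr (u (φ n)) - u (φ n)) := by
        abel
      rw [e, two_mul, ENNReal.ofReal_add (by positivity) (by positivity)]
      exact (eLpNorm_sub_le ((hmeas _).sub hm) ((hmeas _).sub (hu _).aestronglyMeasurable)
        (by norm_num)).trans (add_le_add (h2 n hn) (h1 _))
    refine ⟨N, fun n hn => ?_⟩
    rw [← edist_lt_ofReal, Lp.edist_toLp_toLp]
    have e : u (φ n) - u (φ N) = (u (φ n) - m) - (u (φ N) - m) := by abel
    rw [e]
    refine (eLpNorm_sub_le ((hu _).aestronglyMeasurable.sub hm)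
      ((hu _).aestronglyMeasurable.sub hm) (by norm_num)).trans_lt
      ((add_le_add (h3 n hn) (h3 N le_rfl)).trans_lt ?_)
    rw [← ENNReal.ofReal_add (by positivity) (by positivity)]
    exact (ENNReal.ofReal_lt_ofReal_iff hε).2 (by linarith)
  obtain ⟨v, hv⟩ := cauchySeq_tendsto_of_complete hcau
  refine ⟨φ, S.indicator v, hφ, (Lp.memLp v).indicator hSm, fun x hx => indicator_of_notMem hx _, ?_⟩
  rw [Lp.tendsto_Lp_iff_tendsto_eLpNorm'] at hv
  refine tendsto_of_tendsto_of_tendsto_of_le_of_le tendsto_const_nhds hv (fun _ => zero_le)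
    fun n => ?_
  refine eLpNorm_mono_ae ?_
  filter_upwards [(hu (φ n)).coeFn_toLp] with x hx
  by_cases hxS : x ∈ S
  · simp [hx, hxS]
  · simp [h0 _ x hxS, hxS]

/-! ### Translation estimates for piecewise constant functions. -/

namespace Discretisation

variable {Ω : Set (Eucl d)} (D : Discretisation Ω)

theorem integral_piM_mul (hΩ : Bornology.IsBounded Ω) (v : D.X) {F : Eucl d → ℝ}
    (hF : Continuous F) :
    ∫ x, D.piM v x * F x = ∑ K, v.1 K * ∫ x in D.cell K, F x := by
  have hFi : IntegrableOn F Ω :=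
    (hF.continuousOn.integrableOn_compact hΩ.isCompact_closure).mono_set subset_closure
  rw [← D.setIntegral_piM_mul hΩ v hFi, setIntegral_eq_integral_of_forall_compl_eq_zero]
  intro x hx
  rw [D.piM_apply_of_notMem v hx, zero_mul]

theorem integrable_piM (hΩ : Bornology.IsBounded Ω) (hΩo : IsOpen Ω) (v : D.X) :
    Integrable (D.piM v) := by
  obtain ⟨C, hC⟩ := D.exists_bound_piM v
  exact integrable_of_bound_of_notMem hΩ hΩo (D.measurable_piM v).aestronglyMeasurable hC
    fun x hx => D.piM_apply_of_notMem v hx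

/-- The total variation of a piecewise constant function bounds its increments in `L¹`. -/
theorem integral_abs_translate_sub_le (hΩ : Bornology.IsBounded Ω) (hΩo : IsOpen Ω) (hd : 0 < d)
    {v : D.X} (hv : D.MemX0 v) (η : Eucl d) :
    ∫ x, |D.piM v (x + η) - D.piM v x| ≤
      ‖η‖ * ∑ K, ∑ σ ∈ D.edges K, D.area σ * |v.2 σ - v.1 K| := by
  have hi := D.integrable_piM hΩ hΩo v
  refine integral_abs_le_of_dual ((hi.comp_add_right η).sub hi) fun φ hφ hc h1 => ?_
  have hφ1 : ContDiff ℝ 1 φ := hφ.of_le (by exact_mod_cast le_top)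
  refine abs_integral_mul_translate_sub_le hi hφ1 hc fun s => ?_
  have hψ : ContDiff ℝ 1 fun x => φ (x - s • η) := hφ1.comp (by fun_prop)
  have hfd : ∀ x, fderiv ℝ (fun x => φ (x - s • η)) x = fderiv ℝ φ (x - s • η) := fun x =>
    fderiv_comp_sub _
  have hcont : Continuous fun x => fderiv ℝ φ (x - s • η) η :=
    ((hφ1.continuous_fderiv one_ne_zero).comp (by fun_prop)).clm_apply continuous_const
  rw [D.integral_piM_mul hΩ v hcont]
  have key := D.abs_sum_mul_integral_fderiv_le hΩ hd v.1 hv hψ η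
  simp_rw [hfd] at key
  refine key.trans ?_
  refine mul_le_mul_of_nonneg_left (Finset.sum_le_sum fun K _ => Finset.sum_le_sum fun σ _ => ?_)
    (norm_nonneg _)
  rw [abs_sub_comm, mul_comm]
  refine mul_le_mul_of_nonneg_right ?_ (abs_nonneg _)
  simpa using D.abs_integral_face_le hΩ σ (C := 1) fun y _ => h1 _

/-- The map `s ↦ s|s|` converts an `L¹` bound on the increments of `v|v|` into an `L²` bound on
those of `v`. -/
theorem sq_sub_le_two_mul_abs (a b : ℝ) : (a - b) ^ 2 ≤ 2 * |a * (|a|) - b * (|b|)| := by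
  rcases le_total 0 a with ha | ha <;> rcases le_total 0 b with hb | hb
  · rw [abs_of_nonneg ha, abs_of_nonneg hb]
    rcases le_total a b with h | h
    · rw [abs_of_nonpos (by nlinarith)]; nlinarith
    · rw [abs_of_nonneg (by nlinarith)]; nlinarith
  · rw [abs_of_nonneg ha, abs_of_nonpos hb, abs_of_nonneg (by nlinarith)]
    nlinarith [sq_nonneg (a + b)]
  · rw [abs_of_nonpos ha, abs_of_nonneg hb, abs_of_nonpos (by nlinarith)]
    nlinarith [sq_nonneg (a + b)]
  · rw [abs_of_nonpos ha, abs_of_nonpos hb]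
    rcases le_total a b with h | h
    · rw [abs_of_nonpos (by nlinarith)]; nlinarith
    · rw [abs_of_nonneg (by nlinarith)]; nlinarith

theorem abs_mul_abs_sub_le (a b : ℝ) : |a * (|a|) - b * (|b|)| ≤ |a - b| * (|b| + |a|) := by
  have e : a * |a| - b * |b| = (a - b) * |a| + b * (|a| - |b|) := by ring
  rw [e]
  refine (abs_add_le _ _).trans ?_
  rw [abs_mul, abs_mul, abs_abs]
  nlinarith [abs_abs_sub_abs_le_abs_sub a b, abs_nonneg b, abs_nonneg a, abs_nonneg (a - b)]

/-- The function built on `v|v|` is again a discrete function vanishing on boundary faces, and its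
total variation is bounded by `|v|_X²`. Its `L¹` increments dominate the squared increments of `v`.
The result is only Hölder continuity of exponent `1/2` in `L²`, but it is uniform over all meshes,
which suffices for compactness. -/
theorem lintegral_translate_sub_sq_le (hΩ : Bornology.IsBounded Ω) (hΩo : IsOpen Ω) (hd : 0 < d)
    {R : ℝ} (hR0 : 0 ≤ R) (hR : Ω ⊆ Metric.closedBall 0 R) {v : D.X} (hv : D.MemX0 v)
    (η : Eucl d) :
    ∫⁻ x, ‖D.piM v (x + η) - D.piM v x‖ₑ ^ 2 ≤
      ENNReal.ofReal (2 * ‖η‖ * (√(8 * d * ((8 * d + 8) * R ^ 2) + 8 * R ^ 2) *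
        D.normX v ^ 2)) := by
  set w : D.X := (fun K => v.1 K * |v.1 K|, fun σ => v.2 σ * |v.2 σ|) with hw
  have hw0 : D.MemX0 w := fun σ hσ => by simp [hw, hv σ hσ]
  have hwp : ∀ x, D.piM w x = D.piM v x * |D.piM v x| := fun x => by
    by_cases hx : ∃ K, x ∈ D.cell K
    · obtain ⟨K, hK⟩ := hx
      rw [D.piM_apply_of_mem w hK, D.piM_apply_of_mem v hK]
    · have : ∀ u : D.X, D.piM u x = 0 := fun u =>
        Finset.sum_eq_zero fun K _ => indicator_of_notMem (fun h => hx ⟨K, h⟩) _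
      simp [this]
  have hiw := D.integrable_piM hΩ hΩo w
  have hdw : Integrable fun x => D.piM w (x + η) - D.piM w x := (hiw.comp_add_right η).sub hiw
  calc ∫⁻ x, ‖D.piM v (x + η) - D.piM v x‖ₑ ^ 2
      ≤ ∫⁻ x, ENNReal.ofReal (2 * |D.piM w (x + η) - D.piM w x|) := by
        refine lintegral_mono fun x => ?_
        rw [← ofReal_norm, ← ENNReal.ofReal_pow (norm_nonneg _), Real.norm_eq_abs, sq_abs, hwp, hwp]
        exact ENNReal.ofReal_le_ofReal (sq_sub_le_two_mul_abs _ _)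
    _ = ENNReal.ofReal (∫ x, 2 * |D.piM w (x + η) - D.piM w x|) :=
        (ofReal_integral_eq_lintegral_ofReal (hdw.abs.const_mul 2)
          (Eventually.of_forall fun x => by positivity)).symm
    _ ≤ _ := by
        refine ENNReal.ofReal_le_ofReal ?_
        rw [integral_const_mul, mul_assoc]
        gcongr
        refine (D.integral_abs_translate_sub_le hΩ hΩo hd hw0 η).trans ?_
        gcongr
        calc ∑ K, ∑ σ ∈ D.edges K, D.area σ * |w.2 σ - w.1 K|
            ≤ ∑ K, ∑ σ ∈ D.edges K, D.area σ * |v.2 σ - v.1 K| * (|v.1 K| + |v.2 σ|) := by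
              refine Finset.sum_le_sum fun K _ => Finset.sum_le_sum fun σ _ => ?_
              rw [mul_assoc]
              exact mul_le_mul_of_nonneg_left (abs_mul_abs_sub_le _ _) (D.area_pos hΩ σ).le
          _ ≤ _ := D.sum_area_mul_add_le hΩ hd hR v
          _ ≤ D.normX v * √((8 * d * ((8 * d + 8) * R ^ 2) + 8 * R ^ 2) * D.normX v ^ 2) := by
              gcongr
              · exact D.normX_nonneg v
              · have := D.sum_vol_mul_sq_le hΩ hd hR0 hR hv
                have hd' : (0 : ℝ) ≤ 8 * d := by positivity
                nlinarith [mul_le_mul_of_nonneg_left this hd']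
          _ = _ := by
              rw [Real.sqrt_mul (by positivity), Real.sqrt_sq (D.normX_nonneg v)]
              ring

theorem eLpNorm_piM_le (hΩ : Bornology.IsBounded Ω) (hΩo : IsOpen Ω) (hd : 0 < d)
    {R : ℝ} (hR0 : 0 ≤ R) (hR : Ω ⊆ Metric.closedBall 0 R) {v : D.X} (hv : D.MemX0 v) :
    eLpNorm (D.piM v) 2 ≤ ENNReal.ofReal (√((8 * d + 8) * R ^ 2) * D.normX v) := by
  rw [eLpNorm_two_le_iff, ← ENNReal.ofReal_pow (by have := D.normX_nonneg v; positivity), mul_pow,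
    Real.sq_sqrt (by positivity)]
  have hi : Integrable fun x => D.piM v x ^ 2 := (D.memLp_piM hΩ hΩo v).integrable_sq
  calc ∫⁻ x, ‖D.piM v x‖ₑ ^ 2 = ∫⁻ x, ENNReal.ofReal (D.piM v x ^ 2) := by
        refine lintegral_congr fun x => ?_
        rw [← ofReal_norm, ← ENNReal.ofReal_pow (norm_nonneg _), Real.norm_eq_abs, sq_abs]
    _ = ENNReal.ofReal (∫ x, D.piM v x ^ 2) :=
        (ofReal_integral_eq_lintegral_ofReal hi (Eventually.of_forall fun x => sq_nonneg _)).symm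
    _ ≤ _ := by
        refine ENNReal.ofReal_le_ofReal ((le_of_eq ?_).trans (D.sum_vol_mul_sq_le hΩ hd hR0 hR hv))
        rw [← D.setIntegral_piM_sq hΩ, setIntegral_eq_integral_of_forall_compl_eq_zero]
        intro x hx
        rw [D.piM_apply_of_notMem v hx]; norm_num

end Discretisation

/-- Compactness of bounded sequences of discrete functions. -/
theorem exists_subseq_tendsto_piM {Ω : Set (Eucl d)} (hΩ : Bornology.IsBounded Ω) (hΩo : IsOpen Ω)
    (hd : 0 < d) (D : ℕ → Discretisation Ω) (v : ∀ n, (D n).X) (hv : ∀ n, (D n).MemX0 (v n))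
    {C : ℝ} (hC : ∀ n, (D n).normX (v n) ≤ C) :
    ∃ (φ : ℕ → ℕ) (u : Eucl d → ℝ), StrictMono φ ∧ MemLp u 2 ∧ (∀ x ∉ Ω, u x = 0) ∧
      Tendsto (fun n => eLpNorm (fun x => (D (φ n)).piM (v (φ n)) x - u x) 2) atTop (𝓝 0) := by
  obtain ⟨R, hR0, hR⟩ := hΩ.subset_closedBall_lt 0 0
  have hC0 : 0 ≤ C := ((D 0).normX_nonneg (v 0)).trans (hC 0)
  set K := √(8 * d * ((8 * d + 8) * R ^ 2) + 8 * R ^ 2) with hK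
  have hK0 : 0 ≤ K := Real.sqrt_nonneg _
  have htr : ∀ n (t : Eucl d), ∫⁻ x, ‖(D n).piM (v n) (x - t) - (D n).piM (v n) x‖ₑ ^ 2 ≤
      ENNReal.ofReal (‖t‖ * (2 * (K * C ^ 2))) := fun n t => by
    have h2 := (D n).lintegral_translate_sub_sq_le hΩ hΩo hd hR0.le hR (hv n) (-t)
    rw [norm_neg, ← hK] at h2
    refine h2.trans (ENNReal.ofReal_le_ofReal ?_)
    have h1 : (D n).normX (v n) ^ 2 ≤ C ^ 2 :=
      pow_le_pow_left₀ ((D n).normX_nonneg (v n)) (hC n) 2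
    calc 2 * ‖t‖ * (K * (D n).normX (v n) ^ 2) ≤ 2 * ‖t‖ * (K * C ^ 2) := by gcongr
      _ = _ := by ring
  have hL2 : ∀ n, eLpNorm ((D n).piM (v n)) 2 ≤
      ENNReal.ofReal (√((8 * d + 8) * R ^ 2) * C) := fun n =>
    ((D n).eLpNorm_piM_le hΩ hΩo hd hR0.le hR (hv n)).trans (ENNReal.ofReal_le_ofReal
      (mul_le_mul_of_nonneg_left (hC n) (Real.sqrt_nonneg _)))
  refine exists_subseq_tendsto_of_translate (u := fun n => (D n).piM (v n)) hΩ hΩo.measurableSet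
    (fun n => (D n).memLp_piM hΩ hΩo (v n)) (fun n x hx => (D n).piM_apply_of_notMem (v n) hx)
    hL2 fun ε hε => ?_
  refine ⟨ε / (2 * (K * C ^ 2) + 1), by positivity, fun n t ht =>
    (htr n t).trans (ENNReal.ofReal_le_ofReal ?_)⟩
  rw [lt_div_iff₀ (by positivity)] at ht
  nlinarith [norm_nonneg t]

end HybridFV
namespace HybridFV
variable {d : ℕ}

/-! ### The limit of discrete functions has Lipschitz translates in `L²` -/

theorem tendsto_integral_mul_of_eLpNorm {α κ : Type*} [MeasurableSpace α] {P : Measure α}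
    {l : Filter κ} {f : κ → α → ℝ} {u g : α → ℝ} (hf : ∀ i, MemLp (f i) 2 P) (hu : MemLp u 2 P)
    (hg : MemLp g 2 P) (h : Tendsto (fun i => eLpNorm (fun x => f i x - u x) 2 P) l (𝓝 0)) :
    Tendsto (fun i => ∫ x, f i x * g x ∂P) l (𝓝 (∫ x, u x * g x ∂P)) := by
  have e : ∀ {w : α → ℝ} (hw : MemLp w 2 P), ∫ x, w x * g x ∂P = ⟪hg.toLp g, hw.toLp w⟫ := by
    intro w hw
    rw [L2.inner_def]
    refine integral_congr_ae ?_
    filter_upwards [hg.coeFn_toLp, hw.coeFn_toLp] with x h1 h2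
    rw [h1, h2]; simp
  have h1 := (Lp.tendsto_Lp_iff_tendsto_eLpNorm'' f hf u hu).2 h
  simp_rw [fun i => e (hf i), e hu]
  exact (innerSL ℝ (hg.toLp g)).continuous.tendsto _ |>.comp h1

theorem integrable_of_memLp_two_of_notMem {S : Set (Eucl d)} (hS : Bornology.IsBounded S)
    {u : Eucl d → ℝ} (hu : MemLp u 2) (h0 : ∀ x ∉ S, u x = 0) : Integrable u := by
  have h1 : IntegrableOn u (closure S) := by
    have := isFiniteMeasure_restrict.2
      (hS.isCompact_closure.measure_lt_top (μ := (volume : Measure (Eucl d)))).ne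
    exact (hu.restrict _).integrable (by norm_num)
  rw [← integrable_indicator_iff isClosed_closure.measurableSet] at h1
  rwa [indicator_eq_self.2] at h1
  intro x hx
  by_contra hxS
  exact hx (h0 x fun h => hxS (subset_closure h))

/-- The discrete bound on the weak derivative contains a term in `h` that depends on the test
function. It disappears in the limit, so by duality the limit has Lipschitz, and not merely Hölder,
translates. -/
theorem eLpNorm_translate_sub_le_of_tendsto {Ω : Set (Eucl d)} (hΩ : Bornology.IsBounded Ω)
    (hΩo : IsOpen Ω) (hd : 0 < d) (D : ℕ → Discretisation Ω)
    (hD : Tendsto (fun n => (D n).size) atTop (𝓝 0)) (v : ∀ n, (D n).X)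
    (hv : ∀ n, (D n).MemX0 (v n)) {C : ℝ} (hC : ∀ n, (D n).normX (v n) ≤ C) {u : Eucl d → ℝ}
    (hu : MemLp u 2) (h0 : ∀ x ∉ Ω, u x = 0)
    (h : Tendsto (fun n => eLpNorm (fun x => (D n).piM (v n) x - u x) 2) atTop (𝓝 0))
    (η : Eucl d) :
    eLpNorm (fun x => u (x + η) - u x) 2 ≤ ENNReal.ofReal (C * √(2 * d) * ‖η‖) := by
  have hC0 : 0 ≤ C := ((D 0).normX_nonneg (v 0)).trans (hC 0)
  have hui := integrable_of_memLp_two_of_notMem hΩ hu h0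
  refine eLpNorm_le_of_dual
    ((hu.comp_measurePreserving (measurePreserving_add_right volume η)).sub hu)
    (by positivity) fun φ hφ hc => ?_
  have hφ1 : ContDiff ℝ 1 φ := hφ.of_le (by exact_mod_cast le_top)
  refine abs_integral_mul_translate_sub_le hui hφ1 hc fun s => ?_
  set ψ : Eucl d → ℝ := fun x => φ (x - s • η) with hψ
  have hψs : ContDiff ℝ ∞ ψ := hφ.comp (by fun_prop)
  have hψc : HasCompactSupport ψ := hc.comp_homeomorph (Homeomorph.subRight (s • η))
  have hfd : ∀ x, fderiv ℝ ψ x = fderiv ℝ φ (x - s • η) := fun x => fderiv_comp_sub _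
  simp_rw [← hfd]
  obtain ⟨M, hM⟩ := IsTestFunction.exists_hasTaylorBound (Ω := univ) ⟨hψs, hψc, subset_univ _⟩
  have hcont : Continuous fun x => fderiv ℝ ψ x η :=
    (hM.contDiff.continuous_fderiv one_ne_zero).clm_apply continuous_const
  have hg : MemLp (fun x => fderiv ℝ ψ x η) 2 :=
    hcont.memLp_of_hasCompactSupport (hψc.fderiv_apply ℝ η)
  have hlim := tendsto_integral_mul_of_eLpNorm (fun n => (D n).memLp_piM hΩ hΩo (v n)) hu hg h
  have hsq : Integrable fun x => ψ x ^ 2 :=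
    (hψs.continuous.memLp_of_hasCompactSupport (p := 2) hψc).integrable_sq
  have e0 : ∫ x, ψ x ^ 2 = ∫ x, φ x ^ 2 :=
    integral_sub_right_eq_self (fun x => φ x ^ 2) (s • η)
  have hb : ∀ n, |∫ x, (D n).piM (v n) x * fderiv ℝ ψ x η| ≤
      ‖η‖ * (C * √(2 * d * ((∫ x, φ x ^ 2) + M ^ 2 * (D n).size ^ 2 * volume.real Ω))) := fun n => by
    have key := (D n).abs_integral_piM_mul_fderiv_le hΩ hd (hv n) hM η
    rw [setIntegral_eq_integral_of_forall_compl_eq_zero (fun x hx => by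
      rw [(D n).piM_apply_of_notMem _ hx, zero_mul])] at key
    refine key.trans ?_
    have : ∫ x in Ω, ψ x ^ 2 ≤ ∫ x, φ x ^ 2 := by
      rw [← e0]
      exact setIntegral_le_integral hsq (Eventually.of_forall fun x => sq_nonneg _)
    gcongr
    exact hC n
  have hr : Tendsto (fun n => ‖η‖ * (C * √(2 * d * ((∫ x, φ x ^ 2) +
      M ^ 2 * (D n).size ^ 2 * volume.real Ω)))) atTop
      (𝓝 (‖η‖ * (C * √(2 * d * ((∫ x, φ x ^ 2) + M ^ 2 * 0 ^ 2 * volume.real Ω))))) := by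
    refine ((Tendsto.sqrt ?_).const_mul C).const_mul _
    exact (((hD.pow 2).const_mul _).mul_const _).const_add _ |>.const_mul _
  refine (le_of_tendsto_of_tendsto' hlim.abs hr hb).trans (le_of_eq ?_)
  rw [zero_pow two_ne_zero, mul_zero, zero_mul, add_zero, Real.sqrt_mul (by positivity)]
  ring

/-! ### Exterior directions of polyhedral sets -/

/-- An open convex set contains a ball around some `z`, and moving from a point `q` of its closure
towards `z` enters it. The needed directions `(3 / ρ) • (z - q)` stay in a compact ball, so a finite
net of them works for all `q` and all small scales. -/
theorem exists_finite_translate_mem {C : Set (Eucl d)} (hC : Convex ℝ C) (hCo : IsOpen C) (R : ℝ) :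
    ∃ r₀ : ℝ, 0 < r₀ ∧ ∃ W : Finset (Eucl d), ∀ r : ℝ, 0 < r → r ≤ r₀ → ∀ q ∈ closure C, ‖q‖ ≤ R →
      ∀ x, ‖x - q‖ < r → ∃ w ∈ W, x + r • w ∈ C := by
  rcases C.eq_empty_or_nonempty with rfl | ⟨z, hz⟩
  · exact ⟨1, one_pos, ∅, by simp⟩
  obtain ⟨ρ, hρ, hball⟩ := Metric.isOpen_iff.1 hCo z hz
  obtain ⟨W, -, hWf, hW⟩ := Metric.totallyBounded_iff.1
    (isCompact_closedBall (0 : Eucl d) (3 / ρ * (‖z‖ + R))).totallyBounded 1 one_pos |>.imp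
      fun W h => (⟨trivial, h.1, h.2⟩ : True ∧ W.Finite ∧ _)
  refine ⟨ρ / 3, by positivity, hWf.toFinset, fun r hr hr0 q hq hqR x hx => ?_⟩
  have h1 : (3 / ρ) • (z - q) ∈ Metric.closedBall (0 : Eucl d) (3 / ρ * (‖z‖ + R)) := by
    rw [mem_closedBall_zero_iff, norm_smul, Real.norm_of_nonneg (by positivity)]
    gcongr
    exact (norm_sub_le _ _).trans (by linarith)
  obtain ⟨w, hwW, hw⟩ := mem_iUnion₂.1 (hW h1)
  refine ⟨w, by simpa using hwW, ?_⟩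
  -- The target is the convex combination `(1 - t) q + t y`. The errors from `x - q` and from the
  -- net are each below `ρ / 3` after division by `t`, so `y` stays in the ball around `z`; the
  -- bound `r ≤ ρ / 3` ensures `t ≤ 1`.
  set t := 3 * r / ρ with ht
  have ht0 : 0 < t := by positivity
  have ht1 : t ≤ 1 := by rw [ht, div_le_one hρ]; linarith
  set y := q + t⁻¹ • (x + r • w - q) with hy
  have hyC : y ∈ Metric.ball z ρ := by
    have e1 : y - z = (ρ / (3 * r)) • (x - q) - (ρ / 3) • ((3 / ρ) • (z - q) - w) := by
      have a1 : t⁻¹ = ρ / (3 * r) := by rw [ht, inv_div]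
      have a2 : t⁻¹ * r = ρ / 3 := by rw [a1]; field_simp
      have a3 : ρ / 3 * (3 / ρ) = 1 := by field_simp
      rw [hy, add_sub_right_comm x, smul_add, smul_smul, a2, a1, smul_sub (ρ / 3), smul_smul, a3,
        one_smul]
      abel
    rw [mem_ball_iff_norm, e1]
    rw [Metric.mem_ball, dist_eq_norm] at hw
    refine (norm_sub_le _ _).trans_lt ?_
    rw [norm_smul, norm_smul, Real.norm_of_nonneg (by positivity),
      Real.norm_of_nonneg (by positivity)]
    have b1 : ρ / (3 * r) * ‖x - q‖ < ρ / (3 * r) * r := by gcongr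
    have b2 : ρ / 3 * ‖(3 / ρ) • (z - q) - w‖ < ρ / 3 * 1 := by gcongr
    have b3 : ρ / (3 * r) * r = ρ / 3 := by field_simp
    linarith
  have hyi : y ∈ interior C := by rw [hCo.interior_eq]; exact hball hyC
  have key := hC.combo_interior_closure_mem_interior hyi hq ht0 (sub_nonneg.2 ht1) (by ring)
  rw [hCo.interior_eq] at key
  convert key using 1
  rw [hy, smul_add, smul_smul, mul_inv_cancel₀ ht0.ne', one_smul, sub_smul, one_smul]
  abel

/-- The points on prescribed sides of finitely many hyperplanes. -/
def chamber (s T : Finset (Eucl d × ℝ)) : Set (Eucl d) :=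
  {x | (∀ p ∈ T, p.2 < ⟪p.1, x⟫) ∧ ∀ p ∈ s, p ∉ T → ⟪p.1, x⟫ < p.2}

theorem chamber_eq (s T : Finset (Eucl d × ℝ)) :
    chamber s T = (⋂ p ∈ T, {x | p.2 < ⟪p.1, x⟫}) ∩
      ⋂ p ∈ (s.filter (· ∉ T) : Finset _), {x | ⟪p.1, x⟫ < p.2} := by
  ext x
  simp [chamber]

theorem isOpen_chamber (s T : Finset (Eucl d × ℝ)) : IsOpen (chamber s T) := by
  rw [chamber_eq]
  refine (isOpen_biInter_finset fun p _ => ?_).inter (isOpen_biInter_finset fun p _ => ?_)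
  · exact isOpen_lt continuous_const (by fun_prop)
  · exact isOpen_lt (by fun_prop) continuous_const

theorem convex_chamber (s T : Finset (Eucl d × ℝ)) : Convex ℝ (chamber s T) := by
  rw [chamber_eq]
  refine (convex_iInter₂ fun p _ => ?_).inter (convex_iInter₂ fun p _ => ?_)
  · exact convex_halfSpace_gt (innerSL ℝ p.1).toLinearMap.isLinear _
  · exact convex_halfSpace_lt (innerSL ℝ p.1).toLinearMap.isLinear _

theorem exists_mem_chamber {s : Finset (Eucl d × ℝ)} {x : Eucl d}
    (hx : ∀ p ∈ s, x ∉ hyperplane p.1 p.2) : ∃ T ∈ s.powerset, x ∈ chamber s T := by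
  classical
  refine ⟨s.filter fun p => p.2 < ⟪p.1, x⟫, by simp, ?_, ?_⟩
  · intro p hp
    exact (Finset.mem_filter.1 hp).2
  · intro p hp hpT
    have h1 : ¬ p.2 < ⟪p.1, x⟫ := fun h => hpT (Finset.mem_filter.2 ⟨hp, h⟩)
    exact lt_of_le_of_ne (not_lt.1 h1) (hx p hp)

/-- Since `Ω` is the interior of its closure, a point outside `Ω` is a limit of exterior points. The
hyperplanes are null, so these may be taken in the finitely many open chambers, one of which
accumulates at the point. A chamber is connected and avoids the boundary, so one that meets the
exterior is disjoint from `Ω`. -/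
theorem mem_closure_chamber_of_notMem {Ω : Set (Eucl d)} (hint : interior (closure Ω) = Ω)
    {s : Finset (Eucl d × ℝ)} (hs : ∀ p ∈ s, p.1 ≠ 0)
    (hfr : frontier Ω ⊆ ⋃ p ∈ s, hyperplane p.1 p.2) {q : Eucl d} (hq : q ∉ Ω) :
    ∃ T ∈ s.powerset, q ∈ closure (chamber s T) ∧ Disjoint (chamber s T) Ω := by
  have hΩo : IsOpen Ω := hint ▸ isOpen_interior
  have hq1 : q ∈ closure (closure Ω)ᶜ := by
    rw [closure_compl, hint]; exact hq
  have hdense : Dense (⋃ p ∈ s, hyperplane p.1 p.2)ᶜ := by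
    rw [← interior_eq_empty_iff_dense_compl]
    refine Measure.interior_eq_empty_of_null (μ := volume) ?_
    exact (measure_biUnion_null_iff s.countable_toSet).2 fun p hp => volume_hyperplane (hs p hp) _
  have hq2 : q ∈ closure (⋃ T ∈ s.powerset, chamber s T ∩ (closure Ω)ᶜ) := by
    have h1 := hdense.open_subset_closure_inter (isClosed_closure (s := Ω)).isOpen_compl
    refine closure_minimal (h1.trans (closure_mono ?_)) isClosed_closure hq1
    rintro x ⟨hx1, hx2⟩
    obtain ⟨T, hT, hxT⟩ := exists_mem_chamber (s := s) (x := x) fun p hp hxp =>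
      hx2 (mem_iUnion₂.2 ⟨p, hp, hxp⟩)
    exact mem_iUnion₂.2 ⟨T, hT, hxT, hx1⟩
  rw [Finset.closure_biUnion] at hq2
  obtain ⟨T, hT, hqT⟩ := mem_iUnion₂.1 hq2
  refine ⟨T, hT, closure_mono inter_subset_left hqT, ?_⟩
  have hne : (chamber s T ∩ (closure Ω)ᶜ).Nonempty := closure_nonempty_iff.1 ⟨q, hqT⟩
  have hsub : chamber s T ⊆ Ω ∪ (closure Ω)ᶜ := by
    intro x hx
    by_contra hcon
    simp only [mem_union, mem_compl_iff, not_or, not_not] at hcon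
    have hxf : x ∈ frontier Ω := ⟨hcon.2, by rw [hΩo.interior_eq]; exact hcon.1⟩
    obtain ⟨p, hp, hxp⟩ := mem_iUnion₂.1 (hfr hxf)
    have hxp' : ⟪p.1, x⟫ = p.2 := hxp
    by_cases hpT : p ∈ T
    · exact (hx.1 p hpT).ne' hxp'
    · exact (hx.2 p hp hpT).ne hxp'
  have h2 : chamber s T ⊆ (closure Ω)ᶜ :=
    (convex_chamber s T).isPreconnected.subset_right_of_subset_union hΩo
      isClosed_closure.isOpen_compl (disjoint_compl_right.mono_left subset_closure |>.mono_right
        le_rfl) hsub hne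
  exact (disjoint_compl_left.mono_left h2).mono_right subset_closure

/-- Points close to the complement of a polyhedral set leave it along one of finitely many
directions. -/
theorem IsPolyhedral.exists_finite_translate_notMem {Ω : Set (Eucl d)} (h : IsPolyhedral Ω)
    (R : ℝ) : ∃ r₀ : ℝ, 0 < r₀ ∧ ∃ W : Finset (Eucl d), ∀ r : ℝ, 0 < r → r ≤ r₀ → ∀ q ∉ Ω, ‖q‖ ≤ R →
      ∀ x, ‖x - q‖ < r → ∃ w ∈ W, x + r • w ∉ Ω := by
  classical
  obtain ⟨hint, s, hs, hfr⟩ := h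
  choose r₀ hr₀ W hW using fun T : Finset (Eucl d × ℝ) =>
    exists_finite_translate_mem (convex_chamber s T) (isOpen_chamber s T) R
  obtain ⟨m, hm, hmin⟩ : ∃ m : ℝ, 0 < m ∧ ∀ T ∈ s.powerset, m ≤ r₀ T :=
    ⟨s.powerset.inf' ⟨∅, by simp⟩ r₀, (Finset.lt_inf'_iff _).2 fun T _ => hr₀ T,
      fun T hT => Finset.inf'_le _ hT⟩
  refine ⟨m, hm, s.powerset.biUnion W, fun r hr hrm q hq hqR x hx => ?_⟩
  obtain ⟨T, hT, hqT, hdis⟩ := mem_closure_chamber_of_notMem hint hs hfr hq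
  obtain ⟨w, hw, hxw⟩ := hW T r hr (hrm.trans (hmin T hT)) q hqT hqR x hx
  exact ⟨w, Finset.mem_biUnion.2 ⟨T, hT, hw⟩, fun hmem => Set.disjoint_left.1 hdis hxw hmem⟩

/-! ### Smooth approximation of functions with Lipschitz translates -/

theorem compl_nonempty_of_isBounded (hd : 0 < d) {Ω : Set (Eucl d)} (hΩ : Bornology.IsBounded Ω) :
    Ωᶜ.Nonempty := by
  have : Nonempty (Fin d) := ⟨⟨0, hd⟩⟩
  rw [nonempty_compl]
  rintro rfl
  exact NormedSpace.unbounded_univ ℝ (Eucl d) hΩ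

/-- A substitute for a Hardy inequality. If `x` is close to the complement, some `x + r • w` lies
outside `Ω`, where `u` vanishes; so `u x` is an increment of `u`, and summing over the finitely many
`w` gives `O(r²)`. -/
theorem lintegral_sq_near_boundary_le (hd : 0 < d) {Ω : Set (Eucl d)}
    (hΩ : Bornology.IsBounded Ω) (hp : IsPolyhedral Ω) {u : Eucl d → ℝ} (hu : MemLp u 2)
    (h0 : ∀ x ∉ Ω, u x = 0) {A : ℝ}
    (hA : ∀ η : Eucl d, ∫⁻ x, ‖u (x + η) - u x‖ₑ ^ 2 ≤ ENNReal.ofReal ((A * ‖η‖) ^ 2)) :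
    ∃ r₀ : ℝ, 0 < r₀ ∧ ∃ K : ℝ, 0 ≤ K ∧ ∀ r : ℝ, 0 < r → r ≤ r₀ →
      ∫⁻ x, {x | Metric.infDist x Ωᶜ < r}.indicator (fun x => ‖u x‖ₑ ^ 2) x ≤
        ENNReal.ofReal (K * r ^ 2) := by
  obtain ⟨R, hR⟩ := hΩ.subset_closedBall 0
  obtain ⟨r₀, hr₀, W, hW⟩ := hp.exists_finite_translate_notMem (R + 1)
  refine ⟨min r₀ 1, by positivity, ∑ w ∈ W, (A * ‖w‖) ^ 2, by positivity, fun r hr hrr => ?_⟩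
  have hum : AEStronglyMeasurable u := hu.aestronglyMeasurable
  calc ∫⁻ x, {x | Metric.infDist x Ωᶜ < r}.indicator (fun x => ‖u x‖ₑ ^ 2) x
      ≤ ∫⁻ x, ∑ w ∈ W, ‖u (x + r • w) - u x‖ₑ ^ 2 := by
        refine lintegral_mono fun x => ?_
        by_cases hx : Metric.infDist x Ωᶜ < r
        · rw [indicator_of_mem (show x ∈ {x | Metric.infDist x Ωᶜ < r} from hx)]
          by_cases hxΩ : x ∈ Ω
          · obtain ⟨q, hq, hxq⟩ :=
              (Metric.infDist_lt_iff (compl_nonempty_of_isBounded hd hΩ)).1 hx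
            rw [dist_eq_norm] at hxq
            have hqR : ‖q‖ ≤ R + 1 := by
              have h1 := hR hxΩ
              rw [mem_closedBall_zero_iff] at h1
              have h2 := norm_sub_norm_le q x
              rw [norm_sub_rev] at h2
              linarith [hrr.trans (min_le_right _ _)]
            obtain ⟨w, hw, hxw⟩ := hW r hr (hrr.trans (min_le_left _ _)) q hq hqR x hxq
            refine le_trans (le_of_eq ?_)
              (Finset.single_le_sum (f := fun w => ‖u (x + r • w) - u x‖ₑ ^ 2)
                (fun _ _ => zero_le) hw)
            simp [h0 _ hxw]
          · simp [h0 x hxΩ]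
        · rw [indicator_of_notMem (show x ∉ {x | Metric.infDist x Ωᶜ < r} from hx)]
          exact zero_le
    _ = ∑ w ∈ W, ∫⁻ x, ‖u (x + r • w) - u x‖ₑ ^ 2 := by
        refine lintegral_finsetSum' _ fun w _ => ?_
        exact (((hum.comp_quasiMeasurePreserving
          (measurePreserving_add_right volume _).quasiMeasurePreserving).sub hum).enorm).pow_const 2
    _ ≤ ∑ w ∈ W, ENNReal.ofReal ((A * ‖r • w‖) ^ 2) := Finset.sum_le_sum fun w _ => hA _
    _ = ENNReal.ofReal ((∑ w ∈ W, (A * ‖w‖) ^ 2) * r ^ 2) := by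
        rw [← ENNReal.ofReal_sum_of_nonneg (fun w _ => sq_nonneg _), Finset.sum_mul]
        congr 1
        refine Finset.sum_congr rfl fun w _ => ?_
        rw [norm_smul, Real.norm_of_nonneg hr.le]
        ring

/-- A cutoff function, equal to `0` at distance at most `r` from the complement of `Ω` and to `1` at
distance at least `2 r`. -/
noncomputable def cutoff (Ω : Set (Eucl d)) (r : ℝ) (x : Eucl d) : ℝ :=
  min 1 (max 0 (Metric.infDist x Ωᶜ / r - 1))

section Cutoff

variable (Ω : Set (Eucl d)) {r : ℝ}

theorem continuous_cutoff : Continuous (cutoff Ω r) := by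
  unfold cutoff
  have := Metric.continuous_infDist_pt (Ωᶜ)
  fun_prop

theorem abs_cutoff_le (x : Eucl d) : |cutoff Ω r x| ≤ 1 := by
  unfold cutoff
  rw [abs_of_nonneg (le_min zero_le_one (le_max_left _ _))]
  exact min_le_left _ _

theorem cutoff_eq_zero (hr : 0 < r) {x : Eucl d} (hx : Metric.infDist x Ωᶜ ≤ r) : cutoff Ω r x = 0 := by
  unfold cutoff
  rw [max_eq_left, min_eq_right zero_le_one]
  rw [sub_nonpos, div_le_one hr]
  exact hx

theorem cutoff_eq_one (hr : 0 < r) {x : Eucl d} (hx : 2 * r ≤ Metric.infDist x Ωᶜ) : cutoff Ω r x = 1 := by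
  unfold cutoff
  refine min_eq_left (le_max_of_le_right ?_)
  rw [le_sub_iff_add_le, le_div_iff₀ hr]
  linarith

theorem abs_cutoff_sub_le (hr : 0 < r) (x z : Eucl d) : |cutoff Ω r (x + z) - cutoff Ω r x| ≤ ‖z‖ / r := by
  unfold cutoff
  have h1 : |Metric.infDist (x + z) Ωᶜ - Metric.infDist x Ωᶜ| ≤ ‖z‖ := by
    have := (Metric.lipschitz_infDist_pt Ωᶜ).dist_le_mul (x + z) x
    simpa [Real.dist_eq] using this
  refine (abs_min_sub_min_le_max _ _ _ _).trans (max_le (by simp; positivity) ?_)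
  refine (abs_max_sub_max_le_max _ _ _ _).trans (max_le (by simp; positivity) ?_)
  rw [sub_sub_sub_cancel_right, ← sub_div, abs_div, abs_of_pos hr]
  gcongr

end Cutoff

/-- The product splits into an increment of `u` and an increment of the cutoff times `u`. The latter
has slope `1 / r` and vanishes unless `x` is within `3 r` of the complement, where the mass of `u`
is `O(r²)`: the powers of `r` cancel, and `18 = 2 * 9`. -/
theorem lintegral_cutoff_translate_sub_le {Ω : Set (Eucl d)} {u : Eucl d → ℝ} (hu : MemLp u 2)
    {A : ℝ} (hA : ∀ η : Eucl d, ∫⁻ x, ‖u (x + η) - u x‖ₑ ^ 2 ≤ ENNReal.ofReal ((A * ‖η‖) ^ 2))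
    {K r : ℝ} (hK0 : 0 ≤ K) (hr : 0 < r)
    (hK : ∫⁻ x, {x | Metric.infDist x Ωᶜ < 3 * r}.indicator (fun x => ‖u x‖ₑ ^ 2) x ≤
      ENNReal.ofReal (K * (3 * r) ^ 2)) {z : Eucl d} (hz : ‖z‖ ≤ r) :
    ∫⁻ x, ‖cutoff Ω r (x + z) * u (x + z) - cutoff Ω r x * u x‖ₑ ^ 2 ≤
      ENNReal.ofReal ((2 * A ^ 2 + 18 * K) * ‖z‖ ^ 2) := by
  set S := {x | Metric.infDist x Ωᶜ < 3 * r} with hS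
  have hSm : MeasurableSet S :=
    (isOpen_lt (Metric.continuous_infDist_pt Ωᶜ) continuous_const).measurableSet
  have hum : AEStronglyMeasurable u := hu.aestronglyMeasurable
  have hdm : AEStronglyMeasurable fun x => u (x + z) - u x :=
    (hum.comp_quasiMeasurePreserving
      (measurePreserving_add_right volume z).quasiMeasurePreserving).sub hum
  have hpt : ∀ x, ‖cutoff Ω r (x + z) * u (x + z) - cutoff Ω r x * u x‖ₑ ^ 2 ≤
      ENNReal.ofReal 2 * ‖u (x + z) - u x‖ₑ ^ 2 +
        ENNReal.ofReal (2 * (‖z‖ / r) ^ 2) * S.indicator (fun x => ‖u x‖ₑ ^ 2) x := by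
    intro x
    have hsq : ∀ a : ℝ, ‖a‖ₑ ^ 2 = ENNReal.ofReal (a ^ 2) := fun a => by
      rw [← ofReal_norm, ← ENNReal.ofReal_pow (norm_nonneg _), Real.norm_eq_abs, sq_abs]
    have e : S.indicator (fun x => ‖u x‖ₑ ^ 2) x =
        ENNReal.ofReal (S.indicator (fun x => u x ^ 2) x) := by
      by_cases hx : x ∈ S <;> simp [hx, hsq]
    have hind : 0 ≤ S.indicator (fun x => u x ^ 2) x := indicator_nonneg (fun _ _ => sq_nonneg _) x
    rw [e, hsq, hsq, ← ENNReal.ofReal_mul (by positivity), ← ENNReal.ofReal_mul (by positivity),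
      ← ENNReal.ofReal_add (by positivity) (by positivity)]
    refine ENNReal.ofReal_le_ofReal ?_
    set a := cutoff Ω r (x + z) * (u (x + z) - u x)
    set b := (cutoff Ω r (x + z) - cutoff Ω r x) * u x
    have hab : cutoff Ω r (x + z) * u (x + z) - cutoff Ω r x * u x = a + b := by
      simp only [a, b]; ring
    have ha : a ^ 2 ≤ (u (x + z) - u x) ^ 2 := by
      simp only [a, mul_pow]
      refine mul_le_of_le_one_left (sq_nonneg _) ?_
      rw [← sq_abs]
      exact pow_le_one₀ (abs_nonneg _) (abs_cutoff_le Ω _)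
    have hb : b ^ 2 ≤ (‖z‖ / r) ^ 2 * S.indicator (fun x => u x ^ 2) x := by
      by_cases hx : x ∈ S
      · rw [indicator_of_mem hx]
        simp only [b, mul_pow]
        refine mul_le_mul_of_nonneg_right ?_ (sq_nonneg _)
        rw [← sq_abs]
        exact pow_le_pow_left₀ (abs_nonneg _) (abs_cutoff_sub_le Ω hr x z) 2
      · have hx' : 3 * r ≤ Metric.infDist x Ωᶜ := not_lt.1 hx
        have h1 : cutoff Ω r x = 1 := cutoff_eq_one Ω hr (by linarith)
        have h2 : cutoff Ω r (x + z) = 1 := by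
          refine cutoff_eq_one Ω hr ?_
          have := Metric.infDist_le_infDist_add_dist (s := Ωᶜ) (x := x) (y := x + z)
          rw [dist_self_add_right] at this
          linarith
        simp [b, h1, h2, hx]
    rw [hab]
    nlinarith [sq_nonneg (a - b)]
  calc ∫⁻ x, ‖cutoff Ω r (x + z) * u (x + z) - cutoff Ω r x * u x‖ₑ ^ 2
      ≤ ∫⁻ x, (ENNReal.ofReal 2 * ‖u (x + z) - u x‖ₑ ^ 2 +
        ENNReal.ofReal (2 * (‖z‖ / r) ^ 2) * S.indicator (fun x => ‖u x‖ₑ ^ 2) x) :=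
        lintegral_mono hpt
    _ = ENNReal.ofReal 2 * (∫⁻ x, ‖u (x + z) - u x‖ₑ ^ 2) + ENNReal.ofReal (2 * (‖z‖ / r) ^ 2) *
        ∫⁻ x, S.indicator (fun x => ‖u x‖ₑ ^ 2) x := by
        rw [lintegral_add_left' ((hdm.enorm.pow_const 2).const_mul _),
          lintegral_const_mul'' _ (hdm.enorm.pow_const 2),
          lintegral_const_mul'' _ ((hum.enorm.pow_const 2).indicator hSm)]
    _ ≤ ENNReal.ofReal 2 * ENNReal.ofReal ((A * ‖z‖) ^ 2) + ENNReal.ofReal (2 * (‖z‖ / r) ^ 2) *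
        ENNReal.ofReal (K * (3 * r) ^ 2) := by
        gcongr
        exact hA z
    _ = _ := by
        rw [← ENNReal.ofReal_mul (by positivity), ← ENNReal.ofReal_mul (by positivity),
          ← ENNReal.ofReal_add (by positivity) (by positivity)]
        congr 1
        field_simp
        ring

/-- Fatou's lemma for difference quotients in each coordinate direction, then the sum over the `d`
directions. -/
theorem lintegral_norm_gradient_sq_le {w : Eucl d → ℝ} (hw : ContDiff ℝ 1 w) {C r : ℝ} (hr : 0 < r)
    (hC : ∀ z : Eucl d, ‖z‖ ≤ r → ∫⁻ x, ‖w (x + z) - w x‖ₑ ^ 2 ≤ ENNReal.ofReal (C * ‖z‖ ^ 2)) :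
    ∫⁻ x, ‖gradient w x‖ₑ ^ 2 ≤ ENNReal.ofReal (d * C) := by
  have hdir : ∀ e : Eucl d, ‖e‖ = 1 → ∫⁻ x, ‖⟪gradient w x, e⟫‖ₑ ^ 2 ≤ ENNReal.ofReal C := by
    intro e he
    set t : ℕ → ℝ := fun n => r / (n + 1) with ht
    have ht0 : ∀ n, 0 < t n := fun n => by positivity
    have htr : ∀ n, t n ≤ r := fun n => div_le_self hr.le (by simp)
    have htl : Tendsto t atTop (𝓝[≠] 0) := by
      refine tendsto_nhdsWithin_iff.2 ⟨?_, Eventually.of_forall fun n => (ht0 n).ne'⟩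
      exact tendsto_const_div_atTop_nhds_zero_nat r |>.comp (tendsto_add_atTop_nat 1) |>.congr
        fun n => by simp [ht]
    have hlim : ∀ x, Tendsto (fun n => ‖(t n)⁻¹ • (w (x + t n • e) - w x)‖ₑ ^ 2) atTop
        (𝓝 (‖⟪gradient w x, e⟫‖ₑ ^ 2)) := fun x => by
      have h1 := ((hw.differentiable one_ne_zero) x).hasFDerivAt.hasLineDerivAt e
      have h2 := (hasDerivAt_iff_tendsto_slope_zero.1 h1).comp htl
      rw [inner_gradient_eq_fderiv]
      refine ENNReal.Tendsto.pow (n := 2) (Tendsto.enorm ?_)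
      simpa [Function.comp_def] using h2
    have hm : ∀ n, Measurable fun x => ‖(t n)⁻¹ • (w (x + t n • e) - w x)‖ₑ ^ 2 := fun n => by
      have := hw.continuous
      exact (Continuous.measurable (by fun_prop)).enorm.pow_const 2
    calc ∫⁻ x, ‖⟪gradient w x, e⟫‖ₑ ^ 2
        = ∫⁻ x, liminf (fun n => ‖(t n)⁻¹ • (w (x + t n • e) - w x)‖ₑ ^ 2) atTop :=
          lintegral_congr fun x => (hlim x).liminf_eq.symm
      _ ≤ liminf (fun n => ∫⁻ x, ‖(t n)⁻¹ • (w (x + t n • e) - w x)‖ₑ ^ 2) atTop :=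
          lintegral_liminf_le hm
      _ ≤ ENNReal.ofReal C := by
          refine liminf_le_of_le (by isBoundedDefault) fun b hb => ?_
          obtain ⟨n, hn⟩ := hb.exists
          refine hn.trans ?_
          simp_rw [enorm_smul, mul_pow]
          have h3 := hC (t n • e) (by
            rw [norm_smul, he, mul_one, Real.norm_of_nonneg (ht0 n).le]; exact htr n)
          rw [norm_smul, he, mul_one, Real.norm_of_nonneg (ht0 n).le] at h3
          rw [lintegral_const_mul' _ _ (by finiteness)]
          have h4 : ‖(t n)⁻¹‖ₑ ^ 2 = ENNReal.ofReal (((t n)⁻¹) ^ 2) := by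
            rw [← ofReal_norm, ← ENNReal.ofReal_pow (norm_nonneg _), Real.norm_eq_abs, sq_abs]
          rw [h4]
          refine (mul_le_mul_right h3 _).trans (le_of_eq ?_)
          rw [← ENNReal.ofReal_mul (by positivity)]
          congr 1
          have := (ht0 n).ne'
          field_simp
  have hsum : ∀ x, ‖gradient w x‖ₑ ^ 2 =
      ∑ i, ‖⟪gradient w x, EuclideanSpace.single i (1 : ℝ)⟫‖ₑ ^ 2 := fun x => by
    have hsq : ∀ a : ℝ, ‖a‖ₑ ^ 2 = ENNReal.ofReal (a ^ 2) := fun a => by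
      rw [← ofReal_norm, ← ENNReal.ofReal_pow (norm_nonneg _), Real.norm_eq_abs, sq_abs]
    rw [← ofReal_norm, ← ENNReal.ofReal_pow (norm_nonneg _), EuclideanSpace.norm_sq_eq,
      ENNReal.ofReal_sum_of_nonneg (fun _ _ => sq_nonneg _)]
    refine Finset.sum_congr rfl fun i _ => ?_
    rw [hsq, Real.norm_eq_abs, sq_abs, EuclideanSpace.inner_single_right, one_mul]
    rfl
  have hgm : ∀ i, Measurable fun x =>
      ‖⟪gradient w x, EuclideanSpace.single i (1 : ℝ)⟫‖ₑ ^ 2 := fun i => by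
    have := continuous_gradient hw
    exact (Continuous.measurable (by fun_prop)).enorm.pow_const 2
  simp_rw [hsum]
  rw [lintegral_finsetSum _ fun i _ => hgm i]
  refine (Finset.sum_le_sum fun i _ => hdir _ (by simp)).trans (le_of_eq ?_)
  rw [Finset.sum_const, Finset.card_univ, Fintype.card_fin, nsmul_eq_mul,
    ENNReal.ofReal_mul (by positivity), ENNReal.ofReal_natCast]

/-- Functions that vanish outside of a bounded polyhedral set and have Lipschitz translates in `L²`
are limits in `L²` of test functions that are bounded in `H¹`. -/
theorem exists_testFunction_tendsto (hd : 0 < d) {Ω : Set (Eucl d)}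
    (hΩ : Bornology.IsBounded Ω) (hp : IsPolyhedral Ω) {u : Eucl d → ℝ} (hu : MemLp u 2)
    (h0 : ∀ x ∉ Ω, u x = 0) {A : ℝ}
    (hA : ∀ η : Eucl d, ∫⁻ x, ‖u (x + η) - u x‖ₑ ^ 2 ≤ ENNReal.ofReal ((A * ‖η‖) ^ 2)) :
    ∃ (φ : ℕ → Eucl d → ℝ) (C : ℝ), (∀ n, IsTestFunction Ω (φ n)) ∧
      (∀ n, ∫⁻ x, ‖gradient (φ n) x‖ₑ ^ 2 ≤ ENNReal.ofReal C) ∧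
      Tendsto (fun n => eLpNorm (fun x => φ n x - u x) 2) atTop (𝓝 0) := by
  obtain ⟨r₀, hr₀, K, hK0, hK⟩ := lintegral_sq_near_boundary_le hd hΩ hp hu h0 hA
  set C := 2 * A ^ 2 + 18 * K with hC
  have hCpos : 0 ≤ C := by positivity
  have hmain : ∀ r : ℝ, 0 < r → 3 * r ≤ r₀ → ∃ w : Eucl d → ℝ, IsTestFunction Ω w ∧
      ∫⁻ x, ‖gradient w x‖ₑ ^ 2 ≤ ENNReal.ofReal (d * C) ∧
      eLpNorm (fun x => w x - u x) 2 ≤ ENNReal.ofReal ((√C + √(4 * K)) * r) := by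
    intro r hr hr3
    set g : Eucl d → ℝ := fun x => cutoff Ω r x * u x with hg
    have hgm : MemLp g 2 := hu.of_le
      ((continuous_cutoff Ω).aestronglyMeasurable.mul hu.aestronglyMeasurable)
      (Eventually.of_forall fun x => by
        rw [hg, norm_mul]
        exact mul_le_of_le_one_left (norm_nonneg _) (abs_cutoff_le Ω x))
    have hgl := locallyIntegrable_of_memLp_two hgm
    have hgt : ∀ z : Eucl d, ‖z‖ ≤ r →
        ∫⁻ x, ‖g (x + z) - g x‖ₑ ^ 2 ≤ ENNReal.ofReal (C * ‖z‖ ^ 2) := fun z hz =>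
      lintegral_cutoff_translate_sub_le hu hA hK0 hr (hK _ (by positivity) hr3) hz
    -- The cutoff vanishes within distance `r` of the complement, so mollifying at radius `r / 2`
    -- keeps the support at distance at least `r / 2` and hence compact in `Ω`.
    have hr2 : 0 < r / 2 := by positivity
    set w := mollify (r / 2) hr2 g with hw
    have hws : ContDiff ℝ ∞ w := mollify_contDiff _ hr2 hgl
    have hsupp : Function.support w ⊆ {x | r / 2 ≤ Metric.infDist x Ωᶜ} := by
      intro x hx
      by_contra hlt
      have hlt' : Metric.infDist x Ωᶜ < r / 2 := not_le.1 hlt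
      refine hx (mollify_support_subset _ hr2 g (S := {y | r < Metric.infDist y Ωᶜ})
        (fun y hy => ?_) fun y hy => ?_)
      · rw [hg]
        simp only
        rw [cutoff_eq_zero Ω hr (not_lt.1 hy), zero_mul]
      · have hy' : r < Metric.infDist y Ωᶜ := hy
        have := Metric.infDist_le_infDist_add_dist (s := Ωᶜ) (x := y) (y := x)
        rw [dist_comm, dist_eq_norm] at this
        linarith
    have hcl : IsClosed {x | r / 2 ≤ Metric.infDist x Ωᶜ} :=
      isClosed_le continuous_const (Metric.continuous_infDist_pt Ωᶜ)
    have hts : tsupport w ⊆ {x | r / 2 ≤ Metric.infDist x Ωᶜ} := closure_minimal hsupp hcl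
    have htΩ : tsupport w ⊆ Ω := fun x hx => by
      by_contra hxΩ
      have h1 : r / 2 ≤ Metric.infDist x Ωᶜ := hts hx
      rw [Metric.infDist_zero_of_mem (show x ∈ Ωᶜ from hxΩ)] at h1
      linarith
    have hwt : IsTestFunction Ω w := ⟨hws, HasCompactSupport.of_support_subset_isCompact
      hΩ.isCompact_closure (subset_closure.trans (htΩ.trans subset_closure)), htΩ⟩
    refine ⟨w, hwt, ?_, ?_⟩
    · exact lintegral_norm_gradient_sq_le hwt.contDiff_one hr fun z hz =>
        (lintegral_mollify_translate_sub_sq_le _ hr2 hgl z).trans (hgt z hz)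
    · have e : (fun x => w x - u x) = (fun x => w x - g x) + fun x => g x - u x := by
        ext x; simp
      have h1 : eLpNorm (fun x => w x - g x) 2 ≤ ENNReal.ofReal (√C * r) := by
        rw [eLpNorm_two_le_iff, ← ENNReal.ofReal_pow (by positivity), mul_pow,
          Real.sq_sqrt hCpos]
        refine lintegral_mollify_sub_sq_le _ hr2 hgl fun t ht => ?_
        simp_rw [sub_eq_add_neg _ t]
        refine (hgt (-t) (by rw [norm_neg]; linarith)).trans (ENNReal.ofReal_le_ofReal ?_)
        rw [norm_neg]
        gcongr
        linarith
      have h2 : eLpNorm (fun x => g x - u x) 2 ≤ ENNReal.ofReal (√(4 * K) * r) := by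
        rw [eLpNorm_two_le_iff, ← ENNReal.ofReal_pow (by positivity), mul_pow,
          Real.sq_sqrt (by positivity)]
        have h3 := hK (2 * r) (by positivity) (by linarith)
        have e4 : K * (2 * r) ^ 2 = 4 * K * r ^ 2 := by ring
        rw [e4] at h3
        refine le_trans (lintegral_mono fun x => ?_) h3
        by_cases hx : Metric.infDist x Ωᶜ < 2 * r
        · rw [indicator_of_mem (show x ∈ {x | Metric.infDist x Ωᶜ < 2 * r} from hx)]
          refine pow_le_pow_left' ?_ 2
          rw [← ofReal_norm, ← ofReal_norm]
          refine ENNReal.ofReal_le_ofReal ?_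
          have h5 : g x - u x = (cutoff Ω r x - 1) * u x := by simp only [hg]; ring
          rw [h5, norm_mul]
          refine mul_le_of_le_one_left (norm_nonneg _) ?_
          have h6 : 0 ≤ cutoff Ω r x := le_min zero_le_one (le_max_left _ _)
          have h7 := abs_le.1 (abs_cutoff_le Ω (r := r) x)
          rw [Real.norm_eq_abs, abs_le]
          constructor <;> linarith
        · have : g x = u x := by
            simp only [hg]; rw [cutoff_eq_one Ω hr (not_lt.1 hx), one_mul]
          simp [this]
      rw [e, add_mul, ENNReal.ofReal_add (by positivity) (by positivity)]
      exact (eLpNorm_add_le (hws.continuous.aestronglyMeasurable.sub hgm.aestronglyMeasurable)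
        (hgm.aestronglyMeasurable.sub hu.aestronglyMeasurable) (by norm_num)).trans
        (add_le_add h1 h2)
  have hrn : ∀ n : ℕ, 3 * (r₀ / 3 / (n + 1)) ≤ r₀ := fun n => by
    have := div_le_self (a := r₀ / 3) (by positivity) (show (1 : ℝ) ≤ n + 1 by simp)
    linarith
  choose φ hφ hφ1 hφ2 using fun n : ℕ => hmain (r₀ / 3 / (n + 1)) (by positivity) (hrn n)
  refine ⟨φ, d * C, hφ, hφ1, ?_⟩
  refine tendsto_of_tendsto_of_tendsto_of_le_of_le tendsto_const_nhds ?_ (fun _ => zero_le) hφ2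
  have h1 : Tendsto (fun n : ℕ => r₀ / 3 / ((n : ℝ) + 1)) atTop (𝓝 0) :=
    (tendsto_const_div_atTop_nhds_zero_nat (r₀ / 3)).comp (tendsto_add_atTop_nat 1) |>.congr
        fun n => by simp
  have h2 := ENNReal.tendsto_ofReal (h1.const_mul (√C + √(4 * K)))
  simpa using h2

end HybridFV
namespace HybridFV
variable {d : ℕ}

/-! ### Test functions and the space `H¹₀` -/

namespace IsTestFunction

variable {Ω : Set (Eucl d)} {φ ψ : Eucl d → ℝ}

theorem memLp (h : IsTestFunction Ω φ) : MemLp φ 2 :=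
  h.1.continuous.memLp_of_hasCompactSupport h.2.1

theorem hasCompactSupport_gradient (h : IsTestFunction Ω φ) : HasCompactSupport (gradient φ) :=
  (h.2.1.fderiv ℝ).comp_left (g := (InnerProductSpace.toDual ℝ (Eucl d)).symm) (map_zero _)

theorem memLp_gradient (h : IsTestFunction Ω φ) : MemLp (gradient φ) 2 :=
  (continuous_gradient h.contDiff_one).memLp_of_hasCompactSupport h.hasCompactSupport_gradient

theorem eq_zero (h : IsTestFunction Ω φ) {x : Eucl d} (hx : x ∉ Ω) : φ x = 0 :=
  image_eq_zero_of_notMem_tsupport fun h1 => hx (h.2.2 h1)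

theorem gradient_eq_zero (h : IsTestFunction Ω φ) {x : Eucl d} (hx : x ∉ Ω) : gradient φ x = 0 := by
  have : fderiv ℝ φ x = 0 := image_eq_zero_of_notMem_tsupport fun h1 =>
    hx (h.2.2 (tsupport_fderiv_subset ℝ h1))
  simp [gradient, this]

theorem zero : IsTestFunction Ω (0 : Eucl d → ℝ) :=
  ⟨contDiff_const, HasCompactSupport.zero, by simp [tsupport]⟩

theorem add (h : IsTestFunction Ω φ) (h' : IsTestFunction Ω ψ) : IsTestFunction Ω (φ + ψ) :=
  ⟨h.1.add h'.1, h.2.1.add h'.2.1, (tsupport_add φ ψ).trans (union_subset h.2.2 h'.2.2)⟩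

theorem const_smul (h : IsTestFunction Ω φ) (c : ℝ) : IsTestFunction Ω (c • φ) :=
  ⟨h.1.const_smul c, h.2.1.smul_left (f := fun _ => c),
    (tsupport_smul_subset_right (fun _ => c) φ).trans h.2.2⟩

theorem differentiable (h : IsTestFunction Ω φ) : Differentiable ℝ φ :=
  h.contDiff_one.differentiable one_ne_zero

end IsTestFunction

theorem gradient_add' {φ ψ : Eucl d → ℝ} (h : Differentiable ℝ φ) (h' : Differentiable ℝ ψ) :
    gradient (φ + ψ) = gradient φ + gradient ψ := by
  ext1 x
  simp [gradient, fderiv_add (h x) (h' x)]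

theorem gradient_const_smul' {φ : Eucl d → ℝ} (h : Differentiable ℝ φ) (c : ℝ) :
    gradient (c • φ) = c • gradient φ := by
  ext1 x
  simp [gradient, fderiv_const_smul (h x) c]

theorem integral_mul_inner_gradient {Ω : Set (Eucl d)} {φ ψ : Eucl d → ℝ}
    (h : IsTestFunction Ω φ) (h' : IsTestFunction Ω ψ) (e : Eucl d) :
    ∫ x in Ω, φ x * ⟪gradient ψ x, e⟫ = - ∫ x in Ω, ⟪gradient φ x, e⟫ * ψ x := by
  rw [setIntegral_eq_integral_of_forall_compl_eq_zero (fun x hx => by rw [h.eq_zero hx, zero_mul]),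
    setIntegral_eq_integral_of_forall_compl_eq_zero (fun x hx => by rw [h'.eq_zero hx, mul_zero])]
  simp_rw [inner_gradient_eq_fderiv]
  have h1 : Continuous fun x => fderiv ℝ φ x e :=
    (h.contDiff_one.continuous_fderiv one_ne_zero).clm_apply continuous_const
  have h2 : Continuous fun x => fderiv ℝ ψ x e :=
    (h'.contDiff_one.continuous_fderiv one_ne_zero).clm_apply continuous_const
  exact integral_mul_fderiv_eq_neg_fderiv_mul_of_integrable
    ((h1.mul h'.1.continuous).integrable_of_hasCompactSupport h'.2.1.mul_left)
    ((h.1.continuous.mul h2).integrable_of_hasCompactSupport h.2.1.mul_right)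
    ((h.1.continuous.mul h'.1.continuous).integrable_of_hasCompactSupport h.2.1.mul_right)
    (fun x _ => h.differentiable x) fun x _ => h'.differentiable x

/-- The Hilbert space `L²(Ω) × L²(Ω)^d`. -/
abbrev L2Pair (Ω : Set (Eucl d)) : Type :=
  WithLp 2 (Lp ℝ 2 (volume.restrict Ω) × Lp (Eucl d) 2 (volume.restrict Ω))

/-- The class of a function and a vector field. -/
noncomputable def toPair {Ω : Set (Eucl d)} {u : Eucl d → ℝ} {G : Eucl d → Eucl d}
    (hu : MemLp u 2 (volume.restrict Ω)) (hG : MemLp G 2 (volume.restrict Ω)) : L2Pair Ω :=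
  WithLp.toLp 2 (hu.toLp u, hG.toLp G)

/-- The classes of test functions and of their gradients. -/
noncomputable def testSubmodule (Ω : Set (Eucl d)) : Submodule ℝ (L2Pair Ω) where
  carrier := {p | ∃ (φ : Eucl d → ℝ) (h : IsTestFunction Ω φ),
    p = toPair (h.memLp.restrict Ω) (h.memLp_gradient.restrict Ω)}
  add_mem' := by
    rintro _ _ ⟨φ, h, rfl⟩ ⟨ψ, h', rfl⟩
    refine ⟨φ + ψ, h.add h', ?_⟩
    have e := gradient_add' h.differentiable h'.differentiable
    simp only [toPair, e]
    rw [MemLp.toLp_add (h.memLp.restrict Ω) (h'.memLp.restrict Ω),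
      MemLp.toLp_add (h.memLp_gradient.restrict Ω) (h'.memLp_gradient.restrict Ω)]
    rfl
  zero_mem' := by
    refine ⟨0, IsTestFunction.zero, ?_⟩
    have e : gradient (0 : Eucl d → ℝ) = 0 := by ext1 x; simp [gradient]
    simp only [toPair, e]
    rfl
  smul_mem' := by
    rintro c _ ⟨φ, h, rfl⟩
    refine ⟨c • φ, h.const_smul c, ?_⟩
    have e := gradient_const_smul' h.differentiable c
    simp only [toPair, e]
    rw [MemLp.toLp_const_smul c (h.memLp.restrict Ω),
      MemLp.toLp_const_smul c (h.memLp_gradient.restrict Ω)]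
    rfl

/-- The space `H¹₀(Ω)`, as a closed subspace of `L²(Ω) × L²(Ω)^d`. -/
noncomputable def sobolevZero (Ω : Set (Eucl d)) : Submodule ℝ (L2Pair Ω) :=
  (testSubmodule Ω).topologicalClosure

instance (Ω : Set (Eucl d)) : CompleteSpace (sobolevZero Ω) :=
  (testSubmodule Ω).isClosed_topologicalClosure.completeSpace_coe

section

variable {Ω : Set (Eucl d)} {u : Eucl d → ℝ} {G : Eucl d → Eucl d}

theorem tendsto_toPair_iff {κ : Type*} {l : Filter κ} {f : κ → Eucl d → ℝ}
    {F : κ → Eucl d → Eucl d} (hf : ∀ i, MemLp (f i) 2 (volume.restrict Ω))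
    (hF : ∀ i, MemLp (F i) 2 (volume.restrict Ω)) (hu : MemLp u 2 (volume.restrict Ω))
    (hG : MemLp G 2 (volume.restrict Ω)) :
    Tendsto (fun i => toPair (hf i) (hF i)) l (𝓝 (toPair hu hG)) ↔
      Tendsto (fun i => eLpNorm (fun x => f i x - u x) 2 (volume.restrict Ω)) l (𝓝 0) ∧
      Tendsto (fun i => eLpNorm (fun x => F i x - G x) 2 (volume.restrict Ω)) l (𝓝 0) := by
  have h1 : Tendsto (fun i => toPair (hf i) (hF i)) l (𝓝 (toPair hu hG)) ↔
      Tendsto (fun i => ((hf i).toLp (f i), (hF i).toLp (F i))) l (𝓝 (hu.toLp u, hG.toLp G)) :=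
    ((WithLp.homeomorphProd 2 (Lp ℝ 2 (volume.restrict Ω))
      (Lp (Eucl d) 2 (volume.restrict Ω))).symm.isInducing.tendsto_nhds_iff).symm
  rw [h1, nhds_prod_eq, tendsto_prod_iff']
  exact and_congr (Lp.tendsto_Lp_iff_tendsto_eLpNorm'' f hf u hu)
    (Lp.tendsto_Lp_iff_tendsto_eLpNorm'' F hF G hG)

theorem tendsto_integral_mul_inner_of_eLpNorm {α κ : Type*} [MeasurableSpace α] {P : Measure α}
    {l : Filter κ} {F : κ → α → Eucl d} {G H : α → Eucl d} (hF : ∀ i, MemLp (F i) 2 P)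
    (hG : MemLp G 2 P) (hH : MemLp H 2 P)
    (h : Tendsto (fun i => eLpNorm (fun x => F i x - G x) 2 P) l (𝓝 0)) :
    Tendsto (fun i => ∫ x, ⟪F i x, H x⟫ ∂P) l (𝓝 (∫ x, ⟪G x, H x⟫ ∂P)) := by
  have e : ∀ {w : α → Eucl d} (hw : MemLp w 2 P),
      ∫ x, ⟪w x, H x⟫ ∂P = ⟪hH.toLp H, hw.toLp w⟫ := by
    intro w hw
    rw [L2.inner_def]
    refine integral_congr_ae ?_
    filter_upwards [hH.coeFn_toLp, hw.coeFn_toLp] with x h1 h2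
    rw [h1, h2, real_inner_comm]
  have h1 := (Lp.tendsto_Lp_iff_tendsto_eLpNorm'' F hF G hG).2 h
  simp_rw [fun i => e (hF i), e hG]
  exact (innerSL ℝ (hH.toLp H)).continuous.tendsto _ |>.comp h1

theorem MemH10.toPair_mem (h : MemH10 Ω u G) : toPair h.memLp h.memLp_grad ∈ sobolevZero Ω := by
  obtain ⟨φ, hφ, h1, h2⟩ := h.approx
  refine mem_closure_of_tendsto ((tendsto_toPair_iff (fun n => (hφ n).memLp.restrict Ω)
    (fun n => (hφ n).memLp_gradient.restrict Ω) h.memLp h.memLp_grad).2 ⟨h1, h2⟩)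
    (Eventually.of_forall fun n => ⟨φ n, hφ n, rfl⟩)

/-- Only closure under limits has to be checked: both sides of the weak gradient identity are
continuous in `L²`, and test functions satisfy it. -/
theorem memH10_of_toPair_mem (hu : MemLp u 2 (volume.restrict Ω))
    (hG : MemLp G 2 (volume.restrict Ω)) (h : toPair hu hG ∈ sobolevZero Ω) : MemH10 Ω u G := by
  obtain ⟨p, hp, hlim⟩ := mem_closure_iff_seq_limit.1 h
  choose φ hφ hpφ using hp
  have hlim' : Tendsto (fun n => toPair ((hφ n).memLp.restrict Ω)
      ((hφ n).memLp_gradient.restrict Ω)) atTop (𝓝 (toPair hu hG)) :=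
    hlim.congr hpφ
  obtain ⟨h1, h2⟩ := (tendsto_toPair_iff _ _ hu hG).1 hlim'
  refine ⟨hu, hG, fun ψ hψ e => ?_, φ, hφ, h1, h2⟩
  have hg1 : MemLp (fun x => ⟪gradient ψ x, e⟫) 2 (volume.restrict Ω) :=
    (hψ.memLp_gradient.restrict Ω).inner_const e
  have hg2 : MemLp (fun x => ψ x • e) 2 (volume.restrict Ω) :=
    ((hψ.1.continuous.smul continuous_const).memLp_of_hasCompactSupport
      hψ.2.1.smul_right).restrict Ω
  have t1 := tendsto_integral_mul_of_eLpNorm (fun n => (hφ n).memLp.restrict Ω) hu hg1 h1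
  have t2 := tendsto_integral_mul_inner_of_eLpNorm (fun n => (hφ n).memLp_gradient.restrict Ω) hG
    hg2 h2
  simp_rw [fun n => integral_mul_inner_gradient (hφ n) hψ e] at t1
  simp_rw [inner_smul_right, mul_comm (ψ _)] at t2
  exact tendsto_nhds_unique t1 t2.neg

theorem IsTestFunction.memH10 {φ : Eucl d → ℝ} (h : IsTestFunction Ω φ) :
    MemH10 Ω φ (gradient φ) :=
  memH10_of_toPair_mem (h.memLp.restrict Ω) (h.memLp_gradient.restrict Ω)
    (subset_closure ⟨φ, h, rfl⟩)

/-- An `L²` limit of test functions that are bounded in `H¹` belongs to `H¹₀`. -/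
theorem exists_memH10_of_tendsto {φ : ℕ → Eucl d → ℝ} (hφ : ∀ n, IsTestFunction Ω (φ n)) {C : ℝ}
    (hC : ∀ n, ∫⁻ x, ‖gradient (φ n) x‖ₑ ^ 2 ≤ ENNReal.ofReal C)
    (hu : MemLp u 2 (volume.restrict Ω))
    (h : Tendsto (fun n => eLpNorm (fun x => φ n x - u x) 2 (volume.restrict Ω)) atTop (𝓝 0)) :
    ∃ G, MemH10 Ω u G := by
  have : Fact ((2 : ℝ≥0∞) ≠ ⊤) := ⟨by norm_num⟩
  have i1 : SecondCountableTopology (Lp ℝ 2 (volume.restrict Ω)) := inferInstance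
  have i2 : SecondCountableTopology (Lp (Eucl d) 2 (volume.restrict Ω)) := inferInstance
  have i3 : SecondCountableTopology (L2Pair Ω) := inferInstance
  have i4 : TopologicalSpace.SeparableSpace (L2Pair Ω) := inferInstance
  set p : ℕ → L2Pair Ω := fun n =>
    toPair ((hφ n).memLp.restrict Ω) ((hφ n).memLp_gradient.restrict Ω) with hp
  have hconv := (Lp.tendsto_Lp_iff_tendsto_eLpNorm'' φ (fun n => (hφ n).memLp.restrict Ω) u hu).2 h
  obtain ⟨B1, hB1⟩ := hconv.norm.bddAbove_range
  have hB2 : ∀ n, ‖((hφ n).memLp_gradient.restrict Ω).toLp‖ ≤ √(max C 0) := fun n => by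
    rw [Lp.norm_toLp]
    refine ENNReal.toReal_le_of_le_ofReal (Real.sqrt_nonneg _) ?_
    rw [eLpNorm_two_le_iff, ← ENNReal.ofReal_pow (Real.sqrt_nonneg _),
      Real.sq_sqrt (le_max_right _ _)]
    exact (setLIntegral_le_lintegral _ _).trans ((hC n).trans
      (ENNReal.ofReal_le_ofReal (le_max_left _ _)))
  have hb : ∀ n, ‖p n‖ ≤ √(B1 ^ 2 + √(max C 0) ^ 2) := fun n => by
    rw [WithLp.prod_norm_eq_of_L2]
    refine Real.sqrt_le_sqrt (add_le_add ?_ ?_)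
    · exact pow_le_pow_left₀ (norm_nonneg _) (hB1 ⟨n, rfl⟩) 2
    · exact pow_le_pow_left₀ (norm_nonneg _) (hB2 n) 2
  obtain ⟨a, χ, hχ, ha⟩ := exists_subseq_tendsto_inner hb
  have haV : a ∈ sobolevZero Ω := by
    -- A closed subspace equals its double orthogonal, so membership can be tested by inner products
    -- and passes to weak limits.
    have hV : (sobolevZero Ω)ᗮᗮ = sobolevZero Ω :=
      Submodule.orthogonal_orthogonal_eq_closure _ |>.trans
        (testSubmodule Ω).isClosed_topologicalClosure.submodule_topologicalClosure_eq
    rw [← hV, Submodule.mem_orthogonal']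
    intro y hy
    refine tendsto_nhds_unique (ha y) ?_
    have : ∀ n, ⟪p (χ n), y⟫ = 0 := fun n =>
      (Submodule.mem_orthogonal _ _).1 hy _ (subset_closure ⟨φ (χ n), hφ _, rfl⟩)
    simp [this]
  -- The function components converge strongly to `u`, so the weak limit has `u` as its first
  -- component; its second component is the gradient sought.
  have ha1 : a.fst = hu.toLp u := by
    refine ext_inner_right ℝ fun y => ?_
    have h1 := ha (WithLp.toLp 2 (y, 0))
    have h2 := Filter.Tendsto.inner (𝕜 := ℝ) (hconv.comp hχ.tendsto_atTop)
      (tendsto_const_nhds (x := y))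
    simp only [WithLp.prod_inner_apply, inner_zero_right, add_zero] at h1
    exact tendsto_nhds_unique h1 h2
  refine ⟨a.snd, memH10_of_toPair_mem hu (Lp.memLp _) ?_⟩
  have : toPair hu (Lp.memLp a.snd) = a := by
    simp only [toPair, Lp.toLp_coeFn, ← ha1]
    rfl
  rwa [this]

end

end HybridFV
namespace HybridFV
variable {d : ℕ}

/-! ### The continuous problem -/

theorem norm_toLp_eq_sqrt {α F : Type*} [MeasurableSpace α] {P : Measure α} [NormedAddCommGroup F]
    [InnerProductSpace ℝ F] {f : α → F} (hf : MemLp f 2 P) :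
    ‖hf.toLp f‖ = √(∫ x, ‖f x‖ ^ 2 ∂P) := by
  rw [norm_eq_sqrt_real_inner, L2.inner_def]
  congr 1
  refine integral_congr_ae ?_
  filter_upwards [hf.coeFn_toLp] with x h1
  rw [h1, real_inner_self_eq_norm_sq]

theorem abs_integral_inner_le {α F : Type*} [MeasurableSpace α] {P : Measure α}
    [NormedAddCommGroup F] [InnerProductSpace ℝ F] {f g : α → F} (hf : MemLp f 2 P)
    (hg : MemLp g 2 P) :
    |∫ x, ⟪f x, g x⟫ ∂P| ≤ √(∫ x, ‖f x‖ ^ 2 ∂P) * √(∫ x, ‖g x‖ ^ 2 ∂P) := by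
  rw [← norm_toLp_eq_sqrt hf, ← norm_toLp_eq_sqrt hg]
  refine (le_of_eq ?_).trans (abs_real_inner_le_norm _ _)
  rw [L2.inner_def]
  congr 1
  refine integral_congr_ae ?_
  filter_upwards [hf.coeFn_toLp, hg.coeFn_toLp] with x h1 h2
  rw [h1, h2]

/-- The same duality as for discrete functions, with classical integration by parts in place of the
discrete one. -/
theorem IsTestFunction.eLpNorm_translate_sub_le {Ω : Set (Eucl d)} {φ : Eucl d → ℝ}
    (h : IsTestFunction Ω φ) (η : Eucl d) :
    eLpNorm (fun x => φ (x + η) - φ x) 2 ≤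
      ENNReal.ofReal (‖η‖ * √(∫ x, ‖gradient φ x‖ ^ 2)) := by
  refine eLpNorm_le_of_dual
    ((h.memLp.comp_measurePreserving (measurePreserving_add_right volume η)).sub h.memLp)
    (by positivity) fun χ hχ hc => ?_
  have hφu : IsTestFunction univ φ := ⟨h.1, h.2.1, subset_univ _⟩
  refine abs_integral_mul_translate_sub_le
    (h.1.continuous.integrable_of_hasCompactSupport h.2.1)
    (hχ.of_le (by exact_mod_cast le_top)) hc fun s => ?_
  set ψ : Eucl d → ℝ := fun x => χ (x - s • η) with hψ
  have hψt : IsTestFunction univ ψ := ⟨hχ.comp (by fun_prop),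
    hc.comp_homeomorph (Homeomorph.subRight (s • η)), subset_univ _⟩
  have hfd : ∀ x, fderiv ℝ χ (x - s • η) = fderiv ℝ ψ x := fun x => (fderiv_comp_sub _).symm
  have key := integral_mul_inner_gradient hφu hψt η
  simp only [Measure.restrict_univ] at key
  simp_rw [hfd, ← inner_gradient_eq_fderiv]
  rw [key, abs_neg]
  have hm : MemLp (fun x => ψ x • η) 2 :=
    (hψt.1.continuous.smul continuous_const).memLp_of_hasCompactSupport hψt.2.1.smul_right
  have h1 := abs_integral_inner_le h.memLp_gradient hm
  simp_rw [inner_smul_right, mul_comm (ψ _)] at h1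
  refine h1.trans (le_of_eq ?_)
  have e0 : ∫ x, ψ x ^ 2 = ∫ x, χ x ^ 2 := integral_sub_right_eq_self (fun x => χ x ^ 2) (s • η)
  simp_rw [norm_smul, mul_pow, Real.norm_eq_abs, sq_abs]
  rw [integral_mul_const, e0, Real.sqrt_mul (integral_nonneg fun x => sq_nonneg _),
    Real.sqrt_sq (norm_nonneg _)]
  ring

/-- A translation of length `2 R + 1` moves `Ω` off itself. On `Ω` the increment of a test function
is then minus the function, and the translation estimate becomes the Poincaré inequality, which
extends to the closure. -/
theorem exists_poincare (hd : 0 < d) {Ω : Set (Eucl d)} (hΩ : Bornology.IsBounded Ω) :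
    ∃ C : ℝ, 0 ≤ C ∧ ∀ p ∈ sobolevZero Ω, ‖p.fst‖ ≤ C * ‖p.snd‖ := by
  obtain ⟨R, hR0, hR⟩ := hΩ.subset_closedBall_lt 0 0
  obtain ⟨e, he⟩ := Discretisation.exists_unit_vector hd
  have hη : ‖(2 * R + 1) • e‖ = 2 * R + 1 := by
    rw [norm_smul, he, mul_one, Real.norm_of_nonneg (by positivity)]
  refine ⟨2 * R + 1, by positivity, fun p hp => ?_⟩
  have hcl : IsClosed {p : L2Pair Ω | ‖p.fst‖ ≤ (2 * R + 1) * ‖p.snd‖} :=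
    isClosed_le ((WithLp.fstL 2 ℝ _ _).continuous.norm)
      ((WithLp.sndL 2 ℝ _ _).continuous.norm.const_mul _)
  refine closure_minimal ?_ hcl hp
  rintro _ ⟨φ, h, rfl⟩
  have hb : 0 ≤ (2 * R + 1) * √(∫ x, ‖gradient φ x‖ ^ 2) :=
    mul_nonneg (by linarith) (Real.sqrt_nonneg _)
  have hgr : ‖(h.memLp_gradient.restrict Ω).toLp‖ = √(∫ x, ‖gradient φ x‖ ^ 2) := by
    rw [norm_toLp_eq_sqrt (h.memLp_gradient.restrict Ω),
      setIntegral_eq_integral_of_forall_compl_eq_zero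
      (fun x hx => by rw [h.gradient_eq_zero hx]; simp)]
  change ‖(h.memLp.restrict Ω).toLp‖ ≤ (2 * R + 1) * ‖(h.memLp_gradient.restrict Ω).toLp‖
  rw [hgr, Lp.norm_toLp]
  refine ENNReal.toReal_le_of_le_ofReal hb ?_
  have h1 := h.eLpNorm_translate_sub_le ((2 * R + 1) • e)
  rw [hη] at h1
  refine le_trans ?_ h1
  refine (eLpNorm_mono_measure _ Measure.restrict_le_self).trans (eLpNorm_mono fun x => ?_)
  by_cases hx : x ∈ Ω
  · have hx' : x + (2 * R + 1) • e ∉ Ω := fun h2 => by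
      have a1 := hR hx
      have a2 := hR h2
      rw [mem_closedBall_zero_iff] at a1 a2
      have a3 := norm_sub_le (x + (2 * R + 1) • e) x
      rw [add_sub_cancel_left, hη] at a3
      linarith
    simp [h.eq_zero hx']
  · simp [h.eq_zero hx]

/-- Both bounds are read off in an orthonormal basis of eigenvectors. -/
theorem matrix_bounds {A : Matrix (Fin d) (Fin d) ℝ} (hA : A.IsSymm) {lo hi : ℝ} (hlo : 0 ≤ lo)
    (hlh : lo ≤ hi) (hsp : spectrum ℝ A ⊆ Icc lo hi) (x : Eucl d) :
    lo * ‖x‖ ^ 2 ≤ ⟪Matrix.toEuclideanLin A x, x⟫ ∧ ‖Matrix.toEuclideanLin A x‖ ≤ hi * ‖x‖ := by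
  have hH : A.IsHermitian := by rw [Matrix.IsHermitian, Matrix.conjTranspose_eq_transpose_of_trivial]; exact hA
  set b := hH.eigenvectorBasis
  have hsym : (Matrix.toEuclideanLin A).IsSymmetric := Matrix.isSymmetric_toEuclideanLin_iff.2 hH
  have hb : ∀ i, ⟪Matrix.toEuclideanLin A x, b i⟫ = hH.eigenvalues i * ⟪x, b i⟫ := fun i => by
    rw [hsym x (b i)]
    have : Matrix.toEuclideanLin A (b i) = hH.eigenvalues i • b i := by
      ext j
      exact congrFun (hH.mulVec_eigenvectorBasis i) j
    rw [this, inner_smul_right]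
  have hev : ∀ i, lo ≤ hH.eigenvalues i ∧ hH.eigenvalues i ≤ hi := fun i =>
    hsp (hH.eigenvalues_mem_spectrum_real i)
  constructor
  · rw [← b.sum_inner_mul_inner, ← b.sum_sq_norm_inner_right x, Finset.mul_sum]
    refine Finset.sum_le_sum fun i _ => ?_
    rw [hb, Real.norm_eq_abs, sq_abs, real_inner_comm x]
    nlinarith [(hev i).1, sq_nonneg ⟪x, b i⟫]
  · refine abs_le_of_sq_le_sq' ?_ (mul_nonneg (hlo.trans hlh) (norm_nonneg x)) |>.2
    rw [← b.sum_sq_norm_inner_right, mul_pow, ← b.sum_sq_norm_inner_right x, Finset.mul_sum]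
    refine Finset.sum_le_sum fun i _ => ?_
    rw [real_inner_comm, hb, norm_mul, mul_pow, real_inner_comm x]
    gcongr
    rw [Real.norm_of_nonneg (hlo.trans (hev i).1)]
    exact (hev i).2

/-! ### The diffusion operator and Lax–Milgram. -/

section Tensor

variable {Ω : Set (Eucl d)} {Λ : Eucl d → Matrix (Fin d) (Fin d) ℝ} {lo hi : ℝ}

theorem IsDiffusionTensor.memLp (hΛ : IsDiffusionTensor Ω Λ lo hi) (hlo : 0 ≤ lo) (hlh : lo ≤ hi)
    {G : Eucl d → Eucl d} (hG : MemLp G 2 (volume.restrict Ω)) :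
    MemLp (fun x => Matrix.toEuclideanLin (Λ x) (G x)) 2 (volume.restrict Ω) := by
  refine hG.of_le_mul (c := hi) (AEMeasurable.aestronglyMeasurable ?_) ?_
  · have h1 : AEMeasurable (fun x => fun i => ∑ j, Λ x i j * G x j) (volume.restrict Ω) := by
      refine aemeasurable_pi_lambda _ fun i => Finset.aemeasurable_fun_sum _ fun j _ => ?_
      refine (hΛ.measurable i j).mul ?_
      have : Continuous fun y : Eucl d => y j := by fun_prop
      exact this.measurable.comp_aemeasurable hG.aestronglyMeasurable.aemeasurable
    exact (PiLp.continuous_toLp 2 (fun _ : Fin d => ℝ)).measurable.comp_aemeasurable h1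
  · filter_upwards [hΛ.symm, hΛ.spectrum_subset] with x h1 h2
    exact (matrix_bounds h1 hlo hlh h2 _).2

/-- The multiplication by `Λ` in `L²(Ω)^d`. -/
noncomputable def tensorMap (hΛ : IsDiffusionTensor Ω Λ lo hi) (hlo : 0 ≤ lo) (hlh : lo ≤ hi) :
    Lp (Eucl d) 2 (volume.restrict Ω) →L[ℝ] Lp (Eucl d) 2 (volume.restrict Ω) :=
  LinearMap.mkContinuous
    { toFun := fun g => (hΛ.memLp hlo hlh (Lp.memLp g)).toLp
      map_add' := fun g g' => by
        rw [← MemLp.toLp_add (hΛ.memLp hlo hlh (Lp.memLp g)) (hΛ.memLp hlo hlh (Lp.memLp g')),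
          MemLp.toLp_eq_toLp_iff]
        filter_upwards [Lp.coeFn_add g g'] with x hx
        change Matrix.toEuclideanLin (Λ x) ((g + g' : Lp (Eucl d) 2 (volume.restrict Ω)) x) =
          Matrix.toEuclideanLin (Λ x) (g x) + Matrix.toEuclideanLin (Λ x) (g' x)
        rw [hx, Pi.add_apply, map_add]
      map_smul' := fun c g => by
        rw [RingHom.id_apply, ← MemLp.toLp_const_smul c (hΛ.memLp hlo hlh (Lp.memLp g)),
          MemLp.toLp_eq_toLp_iff]
        filter_upwards [Lp.coeFn_smul c g] with x hx
        simp [hx] } hi fun g => by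
    have h0 : ‖g‖ = ‖(Lp.memLp g).toLp g‖ := by rw [Lp.toLp_coeFn]
    refine Lp.norm_le_mul_norm_of_ae_le_mul ?_
    filter_upwards [hΛ.symm, hΛ.spectrum_subset,
      (hΛ.memLp hlo hlh (Lp.memLp g)).coeFn_toLp] with x h1 h2 h3
    change ‖(hΛ.memLp hlo hlh (Lp.memLp g)).toLp _ x‖ ≤ _
    rw [h3]
    exact (matrix_bounds h1 hlo hlh h2 _).2

theorem energy_eq_inner (hΛ : IsDiffusionTensor Ω Λ lo hi) (hlo : 0 ≤ lo) (hlh : lo ≤ hi)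
    {G H : Eucl d → Eucl d} (hG : MemLp G 2 (volume.restrict Ω))
    (hH : MemLp H 2 (volume.restrict Ω)) :
    energy Ω Λ G H = ⟪tensorMap hΛ hlo hlh (hG.toLp G), hH.toLp H⟫ := by
  rw [L2.inner_def, energy]
  refine integral_congr_ae ?_
  filter_upwards [hG.coeFn_toLp, hH.coeFn_toLp,
    (hΛ.memLp hlo hlh (Lp.memLp (hG.toLp G))).coeFn_toLp] with x h1 h2 h3
  change _ = ⟪(hΛ.memLp hlo hlh (Lp.memLp (hG.toLp G))).toLp _ x, _⟫
  rw [h3, h1, h2]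

theorem le_inner_tensorMap (hΛ : IsDiffusionTensor Ω Λ lo hi) (hlo : 0 ≤ lo) (hlh : lo ≤ hi)
    (g : Lp (Eucl d) 2 (volume.restrict Ω)) :
    lo * ‖g‖ ^ 2 ≤ ⟪tensorMap hΛ hlo hlh g, g⟫ := by
  have e : ‖g‖ ^ 2 = ∫ x in Ω, ‖g x‖ ^ 2 := by
    rw [← real_inner_self_eq_norm_sq, L2.inner_def]
    simp_rw [real_inner_self_eq_norm_sq]
  rw [e, L2.inner_def, ← integral_const_mul]
  refine integral_mono_ae ?_ (L2.integrable_inner _ _) ?_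
  · have := L2.integrable_inner (𝕜 := ℝ) g g
    simp_rw [real_inner_self_eq_norm_sq] at this
    exact this.const_mul lo
  · filter_upwards [hΛ.symm, hΛ.spectrum_subset,
      (hΛ.memLp hlo hlh (Lp.memLp g)).coeFn_toLp] with x h1 h2 h3
    change _ ≤ ⟪(hΛ.memLp hlo hlh (Lp.memLp g)).toLp _ x, _⟫
    rw [h3]
    exact (matrix_bounds h1 hlo hlh h2 _).1

theorem energy_comm (hΛ : IsDiffusionTensor Ω Λ lo hi) (G H : Eucl d → Eucl d) :
    energy Ω Λ G H = energy Ω Λ H G := by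
  refine integral_congr_ae ?_
  filter_upwards [hΛ.symm] with x h1
  have hH : (Λ x).IsHermitian := by
    rw [Matrix.IsHermitian, Matrix.conjTranspose_eq_transpose_of_trivial]; exact h1
  rw [Matrix.isSymmetric_toEuclideanLin_iff.2 hH, real_inner_comm]

/-- The bilinear form of the continuous problem on `H¹₀(Ω)`. -/
noncomputable def energyForm (hΛ : IsDiffusionTensor Ω Λ lo hi) (hlo : 0 ≤ lo) (hlh : lo ≤ hi) :
    sobolevZero Ω →L[ℝ] sobolevZero Ω →L[ℝ] ℝ :=
  (innerSL ℝ).bilinearComp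
    (tensorMap hΛ hlo hlh ∘L WithLp.sndL 2 ℝ _ _ ∘L (sobolevZero Ω).subtypeL)
    (WithLp.sndL 2 ℝ _ _ ∘L (sobolevZero Ω).subtypeL)

theorem isCoercive_energyForm (hd : 0 < d) (hΩ : Bornology.IsBounded Ω)
    (hΛ : IsDiffusionTensor Ω Λ lo hi) (hlo : 0 < lo) (hlh : lo ≤ hi) :
    IsCoercive (energyForm hΛ hlo.le hlh) := by
  obtain ⟨C, hC0, hC⟩ := exists_poincare hd hΩ
  refine ⟨lo / (C ^ 2 + 1), by positivity, fun p => ?_⟩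
  have h1 := le_inner_tensorMap hΛ hlo.le hlh (p : L2Pair Ω).snd
  refine le_trans ?_ h1
  rw [mul_assoc, ← sq, Submodule.coe_norm, WithLp.prod_norm_sq_eq_of_L2, div_mul_eq_mul_div,
    div_le_iff₀ (by positivity)]
  have h2 := pow_le_pow_left₀ (norm_nonneg _) (hC p p.2) 2
  nlinarith

theorem memH10_of_mem_sobolevZero {p : L2Pair Ω} (hp : p ∈ sobolevZero Ω) :
    MemH10 Ω p.fst p.snd := by
  refine memH10_of_toPair_mem (Lp.memLp _) (Lp.memLp _) ?_
  have : toPair (Lp.memLp p.fst) (Lp.memLp p.snd) = p := by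
    simp only [toPair, Lp.toLp_coeFn]
    rfl
  rwa [this]

/-- Existence of a weak solution. -/
theorem exists_isWeakSolution (hd : 0 < d) (hΩ : Bornology.IsBounded Ω)
    (hΛ : IsDiffusionTensor Ω Λ lo hi) (hlo : 0 < lo) (hlh : lo ≤ hi) {f : Eucl d → ℝ}
    (hf : MemLp f 2 (volume.restrict Ω)) :
    ∃ (u : Eucl d → ℝ) (G : Eucl d → Eucl d), IsWeakSolution Ω Λ f u G := by
  have hco := isCoercive_energyForm hd hΩ hΛ hlo hlh
  set ℓ : sobolevZero Ω →L[ℝ] ℝ :=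
    innerSL ℝ (hf.toLp f) ∘L WithLp.fstL 2 ℝ _ _ ∘L (sobolevZero Ω).subtypeL
  -- The Lax–Milgram isomorphism is inverted on the Riesz representative of the right-hand side.
  set p := hco.continuousLinearEquivOfBilin.symm ((InnerProductSpace.toDual ℝ (sobolevZero Ω)).symm ℓ)
    with hp
  have hpq : ∀ q, energyForm hΛ hlo.le hlh p q = ℓ q := fun q => by
    rw [← hco.continuousLinearEquivOfBilin_apply, hp, ContinuousLinearEquiv.apply_symm_apply,
      InnerProductSpace.toDual_symm_apply]
  refine ⟨(p : L2Pair Ω).fst, (p : L2Pair Ω).snd,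
    memH10_of_mem_sobolevZero p.2, fun v H hv => ?_⟩
  have h1 := hpq ⟨_, hv.toPair_mem⟩
  rw [energy_eq_inner hΛ hlo.le hlh (Lp.memLp _) hv.memLp_grad, Lp.toLp_coeFn]
  refine h1.trans ?_
  change ⟪hf.toLp f, hv.memLp.toLp v⟫ = _
  rw [L2.inner_def]
  refine integral_congr_ae ?_
  filter_upwards [hf.coeFn_toLp, hv.memLp.coeFn_toLp] with x a1 a2
  rw [a1, a2]; simp [mul_comm]

theorem eq_zero_of_inner_tensorMap_eq_zero (hd : 0 < d) (hΩ : Bornology.IsBounded Ω)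
    (hΛ : IsDiffusionTensor Ω Λ lo hi) (hlo : 0 < lo) (hlh : lo ≤ hi)
    {w : Lp ℝ 2 (volume.restrict Ω)} {g : Lp (Eucl d) 2 (volume.restrict Ω)}
    (hmem : WithLp.toLp 2 (w, g) ∈ sobolevZero Ω) (h : ⟪tensorMap hΛ hlo.le hlh g, g⟫ = 0) :
    w = 0 ∧ g = 0 := by
  obtain ⟨C, -, hC⟩ := exists_poincare hd hΩ
  have h1 := le_inner_tensorMap hΛ hlo.le hlh g
  rw [h] at h1
  have hg0 : g = 0 := by
    have h3 : ‖g‖ ^ 2 ≤ 0 := le_of_mul_le_mul_left (h1.trans_eq (mul_zero lo).symm) hlo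
    exact norm_eq_zero.1 (pow_eq_zero_iff two_ne_zero |>.1 (le_antisymm h3 (sq_nonneg _)))
  have h3 := hC _ hmem
  rw [WithLp.toLp_snd, WithLp.toLp_fst, hg0, norm_zero, mul_zero] at h3
  exact ⟨norm_le_zero_iff.1 h3, hg0⟩

/-- Uniqueness of the weak solution. -/
theorem IsWeakSolution.ae_eq (hd : 0 < d) (hΩ : Bornology.IsBounded Ω)
    (hΛ : IsDiffusionTensor Ω Λ lo hi) (hlo : 0 < lo) (hlh : lo ≤ hi) {f u u' : Eucl d → ℝ}
    {G G' : Eucl d → Eucl d} (h' : IsWeakSolution Ω Λ f u' G') (h : IsWeakSolution Ω Λ f u G) :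
    u' =ᵐ[volume.restrict Ω] u ∧ G' =ᵐ[volume.restrict Ω] G := by
  have hmem : WithLp.toLp 2 (h'.1.memLp.toLp u' - h.1.memLp.toLp u,
      h'.1.memLp_grad.toLp G' - h.1.memLp_grad.toLp G) ∈ sobolevZero Ω :=
    (sobolevZero Ω).sub_mem h'.1.toPair_mem h.1.toPair_mem
  generalize hw : h'.1.memLp.toLp u' - h.1.memLp.toLp u = w at hmem
  generalize hg : h'.1.memLp_grad.toLp G' - h.1.memLp_grad.toLp G = g at hmem
  have hq : MemH10 Ω w g := memH10_of_mem_sobolevZero hmem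
  have e1 := h.2 _ _ hq
  have e2 := h'.2 _ _ hq
  rw [energy_eq_inner hΛ hlo.le hlh h.1.memLp_grad hq.memLp_grad, Lp.toLp_coeFn] at e1
  rw [energy_eq_inner hΛ hlo.le hlh h'.1.memLp_grad hq.memLp_grad, Lp.toLp_coeFn] at e2
  have h2 : ⟪tensorMap hΛ hlo.le hlh g, g⟫ = 0 := by
    have e3 : tensorMap hΛ hlo.le hlh g = tensorMap hΛ hlo.le hlh (h'.1.memLp_grad.toLp G') -
        tensorMap hΛ hlo.le hlh (h.1.memLp_grad.toLp G) := by rw [← map_sub, hg]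
    rw [e3, inner_sub_left, e1, e2, sub_self]
  obtain ⟨hw0, hg0⟩ := eq_zero_of_inner_tensorMap_eq_zero hd hΩ hΛ hlo hlh hmem h2
  exact ⟨(MemLp.toLp_eq_toLp_iff _ _).1 (sub_eq_zero.1 (hw.trans hw0)),
    (MemLp.toLp_eq_toLp_iff _ _).1 (sub_eq_zero.1 (hg.trans hg0))⟩

end Tensor

end HybridFV
namespace HybridFV
variable {d : ℕ}

theorem eLpNorm_two_eq_sqrt {α F : Type*} [MeasurableSpace α] {P : Measure α}
    [NormedAddCommGroup F] [InnerProductSpace ℝ F] {f : α → F} (hf : MemLp f 2 P) :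
    eLpNorm f 2 P = ENNReal.ofReal (√(∫ x, ‖f x‖ ^ 2 ∂P)) := by
  rw [← norm_toLp_eq_sqrt hf, Lp.norm_toLp, ENNReal.ofReal_toReal hf.eLpNorm_ne_top]

namespace Discretisation

variable {Ω : Set (Eucl d)} (D : Discretisation Ω)

/-! ### The flux form -/

section FluxForm

variable (F : D.Vol → D.Edge → (D.X →ₗ[ℝ] ℝ))

theorem fluxForm_add_left (u u' v : D.X) :
    D.fluxForm F (u + u') v = D.fluxForm F u v + D.fluxForm F u' v := by
  simp [fluxForm, add_mul, Finset.sum_add_distrib]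

theorem fluxForm_smul_left (c : ℝ) (u v : D.X) :
    D.fluxForm F (c • u) v = c * D.fluxForm F u v := by
  simp [fluxForm, Finset.mul_sum, mul_assoc]

theorem fluxForm_add_right (u v v' : D.X) :
    D.fluxForm F u (v + v') = D.fluxForm F u v + D.fluxForm F u v' := by
  simp only [fluxForm, ← Finset.sum_add_distrib]
  refine Finset.sum_congr rfl fun K _ => Finset.sum_congr rfl fun σ _ => ?_
  simp only [Prod.fst_add, Prod.snd_add, Pi.add_apply]
  ring

theorem fluxForm_smul_right (c : ℝ) (u v : D.X) :
    D.fluxForm F u (c • v) = c * D.fluxForm F u v := by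
  simp only [fluxForm, Finset.mul_sum]
  refine Finset.sum_congr rfl fun K _ => Finset.sum_congr rfl fun σ _ => ?_
  simp only [Prod.smul_fst, Prod.smul_snd, Pi.smul_apply, smul_eq_mul]
  ring

/-- The flux form as a bilinear map. -/
noncomputable def fluxBilin : D.X →ₗ[ℝ] D.X →ₗ[ℝ] ℝ :=
  LinearMap.mk₂ ℝ (D.fluxForm F) (D.fluxForm_add_left F) (D.fluxForm_smul_left F)
    (D.fluxForm_add_right F) (D.fluxForm_smul_right F)

theorem fluxForm_sub_left (u u' v : D.X) :
    D.fluxForm F (u - u') v = D.fluxForm F u v - D.fluxForm F u' v :=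
  LinearMap.congr_fun (map_sub (D.fluxBilin F) u u') v

theorem fluxForm_sub_right (u v v' : D.X) :
    D.fluxForm F u (v - v') = D.fluxForm F u v - D.fluxForm F u v' :=
  map_sub (D.fluxBilin F u) v v'

theorem normX_neg (v : D.X) : D.normX (-v) = D.normX v := by
  unfold normX
  congr 1
  refine Finset.sum_congr rfl fun K _ => Finset.sum_congr rfl fun σ _ => ?_
  simp only [Prod.fst_neg, Prod.snd_neg, Pi.neg_apply]
  ring

theorem abs_fluxForm_le {M : ℝ}
    (hM : ∀ u v : D.X, D.fluxForm F u v ≤ M * D.normX u * D.normX v) (u v : D.X) :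
    |D.fluxForm F u v| ≤ M * D.normX u * D.normX v := by
  refine abs_le.2 ⟨?_, hM u v⟩
  have h1 := hM u (-v)
  have h2 : D.fluxForm F u (-v) = - D.fluxForm F u v := map_neg (D.fluxBilin F u) v
  rw [h2, D.normX_neg] at h1
  linarith

/-- The semi-norm is a norm on `X_{D,0}`: Poincaré kills the cell values, and then the face values
vanish since every face belongs to some cell. -/
theorem eq_zero_of_normX_eq_zero (hΩ : Bornology.IsBounded Ω) (hd : 0 < d) {v : D.X}
    (hv : D.MemX0 v) (h : D.normX v = 0) : v = 0 := by
  obtain ⟨R, hR0, hR⟩ := hΩ.subset_closedBall_lt 0 0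
  have h1 := D.sum_vol_mul_sq_le hΩ hd hR0.le hR hv
  rw [h, zero_pow two_ne_zero, mul_zero] at h1
  have hnn : ∀ K ∈ Finset.univ, 0 ≤ D.vol K * v.1 K ^ 2 := fun K _ =>
    mul_nonneg (D.vol_pos hΩ K).le (sq_nonneg _)
  have hK : ∀ K, v.1 K = 0 := fun K => by
    have h2 := (Finset.sum_eq_zero_iff_of_nonneg hnn).1
      (le_antisymm h1 (Finset.sum_nonneg hnn)) K (Finset.mem_univ K)
    simpa [(D.vol_pos hΩ K).ne'] using h2
  have h3 := D.normX_sq hΩ v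
  rw [h, zero_pow two_ne_zero] at h3
  have hnn' : ∀ K ∈ Finset.univ, 0 ≤ ∑ σ ∈ D.edges K, D.area σ / D.dist K σ *
      (v.2 σ - v.1 K) ^ 2 := fun K _ => Finset.sum_nonneg fun σ hσ =>
    mul_nonneg (div_nonneg (D.area_pos hΩ σ).le (D.dist_pos' hσ).le) (sq_nonneg _)
  have hσ : ∀ σ, v.2 σ = 0 := fun σ => by
    obtain ⟨K, hσK⟩ := D.exists_mem_edges σ
    have h4 := (Finset.sum_eq_zero_iff_of_nonneg hnn').1 h3.symm K (Finset.mem_univ K)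
    have h5 := (Finset.sum_eq_zero_iff_of_nonneg (fun τ hτ =>
      mul_nonneg (div_nonneg (D.area_pos hΩ τ).le (D.dist_pos' hτ).le) (sq_nonneg _))).1 h4 σ hσK
    have h6 := (div_pos (D.area_pos hΩ σ) (D.dist_pos' hσK)).ne'
    rw [mul_eq_zero, or_iff_right h6, hK, sub_zero] at h5
    exact pow_eq_zero_iff two_ne_zero |>.1 h5
  exact Prod.ext (funext hK) (funext hσ)

/-- The space `X_{D,B}` as a submodule. -/
def subspaceXB (B : Set D.Edge) (β : D.Edge → D.Vol → ℝ) : Submodule ℝ D.X where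
  carrier := {v | D.MemXB B β v}
  add_mem' := by
    rintro u v ⟨hu, hu'⟩ ⟨hv, hv'⟩
    refine ⟨fun σ hσ => ?_, fun σ hσ => ?_⟩
    · simp [hu σ hσ, hv σ hσ]
    · simp [hu' σ hσ, hv' σ hσ, mul_add, Finset.sum_add_distrib]
  zero_mem' := ⟨fun σ _ => rfl, fun σ _ => by simp⟩
  smul_mem' := by
    rintro c v ⟨hv, hv'⟩
    refine ⟨fun σ hσ => ?_, fun σ hσ => ?_⟩
    · simp [hv σ hσ]
    · simp [hv' σ hσ, Finset.mul_sum, mul_left_comm]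

/-- The scheme has exactly one solution. -/
theorem existsUnique_isSchemeSolution (hΩ : Bornology.IsBounded Ω) (hd : 0 < d)
    (B : Set D.Edge) (β : D.Edge → D.Vol → ℝ) {α : ℝ} (hα : 0 < α)
    (hco : ∀ u : D.X, α * D.normX u ^ 2 ≤ D.fluxForm F u u) (f : Eucl d → ℝ) :
    ∃! u, D.IsSchemeSolution B β F f u := by
  set A : D.subspaceXB B β →ₗ[ℝ] Module.Dual ℝ (D.subspaceXB B β) :=
    (D.fluxBilin F).domRestrict₁₂ _ _ with hA
  have hAa : ∀ u v : D.subspaceXB B β, A u v = D.fluxForm F u v := fun u v => rfl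
  -- Coercivity on the subspace gives injectivity into the dual; equality of dimensions then gives
  -- surjectivity.
  have hinj : Function.Injective A := by
    rw [injective_iff_map_eq_zero]
    intro u hu
    have h1 : D.fluxForm F u u = 0 := by rw [← hAa, hu]; rfl
    have h2 := hco u
    rw [h1] at h2
    have h3 : D.normX (u : D.X) ^ 2 ≤ 0 := le_of_mul_le_mul_left (h2.trans_eq (mul_zero α).symm) hα
    have h4 : D.normX (u : D.X) = 0 :=
      pow_eq_zero_iff two_ne_zero |>.1 (le_antisymm h3 (sq_nonneg _))
    exact Subtype.ext (D.eq_zero_of_normX_eq_zero hΩ hd u.2.1 h4)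
  have hsurj : Function.Surjective A :=
    (LinearMap.injective_iff_surjective_of_finrank_eq_finrank
      Subspace.dual_finrank_eq.symm).1 hinj
  set ℓ : D.X →ₗ[ℝ] ℝ := ∑ K, (∫ x in D.cell K, f x) •
    ((LinearMap.proj K : (D.Vol → ℝ) →ₗ[ℝ] ℝ) ∘ₗ LinearMap.fst ℝ _ _)
  have hℓ : ∀ v : D.X, ℓ v = ∑ K, v.1 K * ∫ x in D.cell K, f x := fun v => by
    simp [ℓ, LinearMap.sum_apply, mul_comm]
  obtain ⟨u, hu⟩ := hsurj (ℓ.domRestrict _)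
  refine ⟨u, ⟨u.2, fun v hv => ?_⟩, fun u' hu' => ?_⟩
  · rw [← hℓ]
    exact LinearMap.congr_fun hu ⟨v, hv⟩
  · have : (⟨u', hu'.1⟩ : D.subspaceXB B β) = u := by
      refine hinj (LinearMap.ext fun v => ?_)
      rw [hu]
      exact (hu'.2 v v.2).trans (hℓ v).symm
    rw [← this]

end FluxForm

/-! ### Estimates in `L²(Ω)` -/

theorem sum_mul_setIntegral_eq (hΩ : Bornology.IsBounded Ω) {f : Eucl d → ℝ}
    (hf : MemLp f 2 (volume.restrict Ω)) (v : D.X) :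
    ∑ K, v.1 K * ∫ x in D.cell K, f x = ∫ x in Ω, D.piM v x * f x := by
  have : IsFiniteMeasure (volume.restrict Ω) := isFiniteMeasure_restrict.2 hΩ.measure_lt_top.ne
  exact (D.setIntegral_piM_mul hΩ v (hf.integrable (by norm_num))).symm

/-- Testing the scheme with its solution and applying coercivity, Cauchy–Schwarz and Poincaré. The
constant is chosen before the mesh and the fluxes, so it is uniform over the family. -/
theorem exists_normX_le_of_isSchemeSolution (hΩ : Bornology.IsBounded Ω) (hΩo : IsOpen Ω)
    (hd : 0 < d) {f : Eucl d → ℝ} (hf : MemLp f 2 (volume.restrict Ω)) {α : ℝ} (hα : 0 < α) :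
    ∃ C : ℝ, ∀ (D : Discretisation Ω) (F : D.Vol → D.Edge → (D.X →ₗ[ℝ] ℝ)) (B : Set D.Edge)
      (β : D.Edge → D.Vol → ℝ) (u : D.X), (∀ u : D.X, α * D.normX u ^ 2 ≤ D.fluxForm F u u) →
      D.IsSchemeSolution B β F f u → D.normX u ≤ C := by
  obtain ⟨R, hR0, hR⟩ := hΩ.subset_closedBall_lt 0 0
  refine ⟨√((8 * d + 8) * R ^ 2) * √(∫ x in Ω, ‖f x‖ ^ 2) / α, fun D F B β u hco hu => ?_⟩
  have h1 := hu.2 u hu.1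
  rw [D.sum_mul_setIntegral_eq hΩ hf] at h1
  have hm : MemLp (D.piM u) 2 (volume.restrict Ω) := (D.memLp_piM hΩ hΩo u).restrict Ω
  have h2 := abs_integral_inner_le hf hm
  simp only [RCLike.inner_apply, conj_trivial] at h2
  have h3 : √(∫ x in Ω, ‖D.piM u x‖ ^ 2) ≤ √((8 * d + 8) * R ^ 2) * D.normX u := by
    have h4 := (eLpNorm_mono_measure (D.piM u) (ν := volume.restrict Ω)
      Measure.restrict_le_self).trans (D.eLpNorm_piM_le hΩ hΩo hd hR0.le hR hu.1.1)
    rw [eLpNorm_two_eq_sqrt hm] at h4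
    exact (ENNReal.ofReal_le_ofReal_iff
      (mul_nonneg (Real.sqrt_nonneg _) (D.normX_nonneg u))).1 h4
  have h5 := hco u
  rw [h1] at h5
  rcases (D.normX_nonneg u).eq_or_lt with h0 | h0
  · rw [← h0]
    positivity
  · rw [le_div_iff₀ hα]
    refine le_of_mul_le_mul_right ?_ h0
    calc D.normX u * α * D.normX u = α * D.normX u ^ 2 := by ring
      _ ≤ _ := h5
      _ ≤ _ := le_abs_self _
      _ ≤ _ := h2
      _ ≤ √(∫ x in Ω, ‖f x‖ ^ 2) * (√((8 * d + 8) * R ^ 2) * D.normX u) := by gcongr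
      _ = _ := by ring

theorem memLp_grad (hΩ : Bornology.IsBounded Ω) (v : D.X) :
    MemLp (D.grad v) 2 (volume.restrict Ω) := by
  have : IsFiniteMeasure (volume.restrict Ω) := isFiniteMeasure_restrict.2 hΩ.measure_lt_top.ne
  obtain ⟨C, hC⟩ := D.exists_bound_grad v
  exact MemLp.of_bound (D.measurable_grad hΩ v).aestronglyMeasurable C (Eventually.of_forall hC)

theorem eLpNorm_grad_le (hΩ : Bornology.IsBounded Ω) (hd : 0 < d) {θ : ℝ}
    (hθ : ∀ K, ∀ σ ∈ D.edges K, D.diam K ≤ θ * D.dist K σ) (v : D.X) :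
    eLpNorm (D.grad v) 2 (volume.restrict Ω) ≤
      ENNReal.ofReal (√(4 + 2 * d + 4 * d ^ 2 * θ ^ 2) * D.normX v) := by
  rw [eLpNorm_two_eq_sqrt (D.memLp_grad hΩ v), D.setIntegral_norm_grad_sq hΩ hd]
  refine ENNReal.ofReal_le_ofReal (Real.sqrt_le_iff.2 ⟨mul_nonneg (Real.sqrt_nonneg _)
    (D.normX_nonneg v), ?_⟩)
  rw [mul_pow, Real.sq_sqrt (by positivity)]
  exact D.sum_cone_norm_gradCone_sq_le hΩ hd hθ v

theorem ae_exists_mem_cone (hΩ : Bornology.IsBounded Ω) (hd : 0 < d) :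
    ∀ᵐ x, x ∈ Ω → ∃ K, ∃ σ ∈ D.edges K, x ∈ D.cone K σ := by
  have h1 : ∀ᵐ x, ∀ K, x ∈ D.cell K → ∃ σ ∈ D.edges K, x ∈ D.cone K σ := by
    rw [ae_all_iff]
    intro K
    filter_upwards [(D.isStarCell hΩ K).ae_mem_coneSet hd] with x hx hxK
    obtain ⟨σ, hσ⟩ := mem_iUnion.1 (hx hxK)
    exact ⟨σ, σ.2, hσ⟩
  filter_upwards [h1, D.ae_exists_mem_cell hΩ] with x hx hx' hxΩ
  obtain ⟨K, hK⟩ := hx' hxΩ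
  exact ⟨K, hx K hK⟩

theorem eLpNorm_grad_interp_sub_le (hΩ : Bornology.IsBounded Ω) (hΩo : IsOpen Ω) (hd : 0 < d) {θ : ℝ}
    (hθ0 : 0 ≤ θ) (hθ : ∀ K, ∀ σ ∈ D.edges K, D.diam K ≤ θ * D.dist K σ) {φ : Eucl d → ℝ} {M : ℝ}
    (hφ : HasTaylorBound φ M) :
    eLpNorm (fun x => D.grad (D.interp φ) x - gradient φ x) 2 (volume.restrict Ω) ≤
      volume Ω ^ (2 : ℝ)⁻¹ *
        ENNReal.ofReal ((1 + θ * d + d * θ * (1 + θ * d)) * M * D.size) := by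
  have hae : ∀ᵐ x ∂(volume.restrict Ω), ‖D.grad (D.interp φ) x - gradient φ x‖ ≤
      (1 + θ * d + d * θ * (1 + θ * d)) * M * D.size := by
    rw [ae_restrict_iff' hΩo.measurableSet]
    filter_upwards [D.ae_exists_mem_cone hΩ hd] with x hx hxΩ
    obtain ⟨K, σ, hσ, hxc⟩ := hx hxΩ
    rw [D.grad_apply_of_mem hΩ _ hσ hxc]
    refine (D.norm_gradCone_interp_sub_le hΩ hd hθ0 (hθ K) hφ hσ
      (D.cone_subset_cell hΩ hσ hxc)).trans ?_
    have := hφ.nonneg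
    gcongr
    exact D.diam_le_size K
  simpa using eLpNorm_le_of_ae_bound (p := 2) hae

theorem eLpNorm_piM_interp_sub_le (hΩ : Bornology.IsBounded Ω) (hΩo : IsOpen Ω)
    {φ : Eucl d → ℝ} {M : ℝ} (hφ : HasTaylorBound φ M) :
    eLpNorm (fun x => D.piM (D.interp φ) x - φ x) 2 (volume.restrict Ω) ≤
      volume Ω ^ (2 : ℝ)⁻¹ * ENNReal.ofReal (M * D.size) := by
  have hae : ∀ᵐ x ∂(volume.restrict Ω), ‖D.piM (D.interp φ) x - φ x‖ ≤ M * D.size := by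
    rw [ae_restrict_iff' hΩo.measurableSet]
    filter_upwards [D.ae_exists_mem_cell hΩ] with x hx hxΩ
    obtain ⟨K, hK⟩ := hx hxΩ
    rw [D.piM_apply_of_mem _ hK]
    refine (hφ.lip _ _).trans ?_
    have := hφ.nonneg
    gcongr
    refine (D.dist_le_diam_of_mem_closure hΩ (subset_closure (D.center_mem K))
      (subset_closure hK)).trans (D.diam_le_size K)
  simpa using eLpNorm_le_of_ae_bound (p := 2) hae

end Discretisation

/-! ### Interpolation and recovery along a family of meshes. -/

section Families

variable {Ω : Set (Eucl d)} {ι : Type*} (D : ι → Discretisation Ω)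

theorem tendsto_size_sizeToZero : Tendsto (fun i => (D i).size) (sizeToZero D) (𝓝 0) :=
  tendsto_comap

/-- Countable generation allows convergence as `h → 0` to be tested along sequences. -/
instance : (sizeToZero D).IsCountablyGenerated := by
  unfold sizeToZero; infer_instance

theorem tendsto_mul_ofReal_size {c : ℝ≥0∞} (hc : c ≠ ⊤) (a : ℝ) :
    Tendsto (fun i => c * ENNReal.ofReal (a * (D i).size)) (sizeToZero D) (𝓝 0) := by
  have h1 := ENNReal.tendsto_ofReal ((tendsto_size_sizeToZero D).const_mul a)
  have h2 := ENNReal.Tendsto.const_mul h1 (Or.inr hc)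
  simpa using h2

theorem tendsto_piM_interp (hΩ : Bornology.IsBounded Ω) (hΩo : IsOpen Ω) {φ : Eucl d → ℝ}
    (hφ : IsTestFunction Ω φ) :
    Tendsto (fun i => eLpNorm (fun x => (D i).piM ((D i).interp φ) x - φ x) 2
      (volume.restrict Ω)) (sizeToZero D) (𝓝 0) := by
  obtain ⟨M, hM⟩ := hφ.exists_hasTaylorBound
  exact tendsto_of_tendsto_of_tendsto_of_le_of_le tendsto_const_nhds
    (tendsto_mul_ofReal_size D (ENNReal.rpow_ne_top_of_nonneg (by norm_num)
      hΩ.measure_lt_top.ne) M) (fun _ => zero_le)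
    fun i => (D i).eLpNorm_piM_interp_sub_le hΩ hΩo hM

theorem tendsto_grad_interp (hΩ : Bornology.IsBounded Ω) (hΩo : IsOpen Ω) (hd : 0 < d) {θ : ℝ}
    (hθ0 : 0 ≤ θ) (hθ : ∀ i, ∀ K, ∀ σ ∈ (D i).edges K, (D i).diam K ≤ θ * (D i).dist K σ)
    {φ : Eucl d → ℝ} (hφ : IsTestFunction Ω φ) :
    Tendsto (fun i => eLpNorm (fun x => (D i).grad ((D i).interp φ) x - gradient φ x) 2
      (volume.restrict Ω)) (sizeToZero D) (𝓝 0) := by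
  obtain ⟨M, hM⟩ := hφ.exists_hasTaylorBound
  exact tendsto_of_tendsto_of_tendsto_of_le_of_le tendsto_const_nhds
    (tendsto_mul_ofReal_size D (ENNReal.rpow_ne_top_of_nonneg (by norm_num)
      hΩ.measure_lt_top.ne) _) (fun _ => zero_le)
    fun i => (D i).eLpNorm_grad_interp_sub_le hΩ hΩo hd hθ0 (hθ i) hM

theorem eventually_memX0_interp (hΩ : Bornology.IsBounded Ω) (hΩo : IsOpen Ω) {φ : Eucl d → ℝ}
    (hφ : IsTestFunction Ω φ) : ∀ᶠ i in sizeToZero D, (D i).MemX0 ((D i).interp φ) := by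
  obtain ⟨ε, hε, h⟩ := Discretisation.exists_pos_memX0_interp hΩ hΩo hφ
  filter_upwards [(tendsto_size_sizeToZero D).eventually (gt_mem_nhds hε)] with i hi using h _ hi

/-- The interpolations of a test function are asymptotically bounded by the norm of its gradient. -/
theorem eventually_normX_interp_le (hΩ : Bornology.IsBounded Ω) (hd : 0 < d) {θ : ℝ}
    (hθ : ∀ i, ∀ K, ∀ σ ∈ (D i).edges K, (D i).diam K ≤ θ * (D i).dist K σ)
    {φ : Eucl d → ℝ} (hφ : IsTestFunction Ω φ) {C : ℝ}
    (hC : ∫ x in Ω, ‖gradient φ x‖ ^ 2 ≤ C) :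
    ∀ᶠ i in sizeToZero D, (D i).normX ((D i).interp φ) ≤ √(2 * d * θ ^ 2 * (2 * C + 1)) := by
  obtain ⟨M, hM⟩ := hφ.exists_hasTaylorBound
  have h1 : Tendsto (fun i => 3 * M ^ 2 * (D i).size ^ 2 * volume.real Ω) (sizeToZero D)
      (𝓝 (3 * M ^ 2 * 0 ^ 2 * volume.real Ω)) :=
    (((tendsto_size_sizeToZero D).pow 2).const_mul _).mul_const _
  have h2 : 3 * M ^ 2 * 0 ^ 2 * volume.real Ω < 1 := by norm_num
  filter_upwards [h1.eventually (gt_mem_nhds h2)] with i hi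
  refine Real.le_sqrt_of_sq_le (((D i).normX_interp_sq_le hΩ hd (hθ i) hM).trans ?_)
  gcongr

/-- Every element of `H¹₀(Ω)` is the limit of a bounded family of discrete functions. -/
theorem exists_recovery (hΩ : Bornology.IsBounded Ω) (hΩo : IsOpen Ω) (hne : Ω.Nonempty)
    (hd : 0 < d) {θ : ℝ}
    (hθ : ∀ i, ∀ K, ∀ σ ∈ (D i).edges K, (D i).diam K ≤ θ * (D i).dist K σ)
    {u : Eucl d → ℝ} {G : Eucl d → Eucl d} (hu : MemH10 Ω u G) :
    ∃ (r : ∀ i, (D i).X) (C : ℝ), (∀ i, (D i).MemX0 (r i)) ∧ (∀ i, (D i).normX (r i) ≤ C) ∧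
      Tendsto (fun i => eLpNorm (fun x => (D i).piM (r i) x - u x) 2 (volume.restrict Ω))
        (sizeToZero D) (𝓝 0) := by
  obtain ⟨φ, hφ, h1, h2⟩ := hu.approx
  obtain ⟨C, hC⟩ : ∃ C : ℝ, ∀ n, ∫ x in Ω, ‖gradient (φ n) x‖ ^ 2 ≤ C := by
    have hconv := ((Lp.tendsto_Lp_iff_tendsto_eLpNorm''
      (fun n => gradient (φ n)) (fun n => (hφ n).memLp_gradient.restrict Ω) G hu.memLp_grad).2 h2)
    obtain ⟨b, hb⟩ := hconv.norm.bddAbove_range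
    refine ⟨b ^ 2, fun n => ?_⟩
    have h3 : ‖((hφ n).memLp_gradient.restrict Ω).toLp‖ ≤ b := hb ⟨n, rfl⟩
    rw [norm_toLp_eq_sqrt] at h3
    exact (Real.sqrt_le_left ((Real.sqrt_nonneg _).trans h3)).1 h3
  set C' := √(2 * d * θ ^ 2 * (2 * C + 1))
  set S : ∀ i, Set (D i).X := fun i => {v | (D i).MemX0 v ∧ (D i).normX v ≤ C'}
  set e : ∀ i, (D i).X → ℝ≥0∞ := fun i v =>
    eLpNorm (fun x => (D i).piM v x - u x) 2 (volume.restrict Ω)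
  -- The recovery is, on each mesh, a near-minimiser of the `L²` distance to `u` among admissible
  -- vectors with `|·|_X ≤ C'`. The positive slack `h_D` guarantees that one exists, and no diagonal
  -- extraction is needed: eventually every interpolant `φ n` is a competitor.
  have hex : ∀ i, ∃ v ∈ S i, ∀ w ∈ S i, e i v ≤ e i w + ENNReal.ofReal (D i).size := by
    intro i
    have h0 : (0 : (D i).X) ∈ S i := ⟨fun σ _ => rfl, by
      simp [Discretisation.normX, C']⟩
    have hpos : 0 < ENNReal.ofReal (D i).size :=
      ENNReal.ofReal_pos.2 ((D i).size_pos hΩ hd hne)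
    have hfin : ⨅ w : S i, e i w ≠ ⊤ := by
      refine ne_top_of_le_ne_top ?_ (iInf_le _ ⟨0, h0⟩)
      exact ((((D i).memLp_piM hΩ hΩo 0).restrict Ω).sub hu.memLp).eLpNorm_ne_top
    obtain ⟨v, hv⟩ := iInf_lt_iff.1 (ENNReal.lt_add_right hfin hpos.ne')
    refine ⟨v, v.2, fun w hw => hv.le.trans ?_⟩
    gcongr
    exact iInf_le (fun w : S i => e i w) ⟨w, hw⟩
  choose r hr hrmin using hex
  refine ⟨r, C', fun i => (hr i).1, fun i => (hr i).2, ?_⟩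
  rw [ENNReal.tendsto_nhds_zero]
  intro ε hε
  have hε3 : 0 < ε / 3 := ENNReal.div_pos hε.ne' (by norm_num)
  obtain ⟨n, hn⟩ := ((ENNReal.tendsto_nhds_zero.1 h1) (ε / 3) hε3).exists
  have hsz : Tendsto (fun i => ENNReal.ofReal (D i).size) (sizeToZero D) (𝓝 0) := by
    simpa using ENNReal.tendsto_ofReal (tendsto_size_sizeToZero D)
  filter_upwards [eventually_memX0_interp D hΩ hΩo (hφ n),
    eventually_normX_interp_le D hΩ hd hθ (hφ n) (hC n),
    (ENNReal.tendsto_nhds_zero.1 (tendsto_piM_interp D hΩ hΩo (hφ n))) (ε / 3) hε3,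
    (ENNReal.tendsto_nhds_zero.1 hsz) (ε / 3) hε3] with i a1 a2 a3 a4
  have a5 : e i ((D i).interp (φ n)) ≤ ε / 3 + ε / 3 := by
    have e1 : (fun x => (D i).piM ((D i).interp (φ n)) x - u x) =
      (fun x => (D i).piM ((D i).interp (φ n)) x - φ n x) + fun x => φ n x - u x := by
      ext x; simp
    simp only [e]
    rw [e1]
    have m1 := ((D i).memLp_piM hΩ hΩo ((D i).interp (φ n))).restrict Ω
    have m2 := (hφ n).memLp.restrict Ω
    exact (eLpNorm_add_le (m1.sub m2).aestronglyMeasurable (m2.sub hu.memLp).aestronglyMeasurable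
      (by norm_num)).trans (add_le_add a3 hn)
  calc e i (r i) ≤ e i ((D i).interp (φ n)) + ENNReal.ofReal (D i).size := hrmin i _ ⟨a1, a2⟩
    _ ≤ ε / 3 + ε / 3 + ε / 3 := add_le_add a5 a4
    _ = ε := ENNReal.add_thirds ε

end Families

end HybridFV
namespace HybridFV
variable {d : ℕ}

/-! ### Convergence of the scheme -/

/-- Bounded sequences of discrete functions converge in `L²`, up to a subsequence, to an element of
`H¹₀(Ω)`. -/
theorem exists_subseq_memH10 {Ω : Set (Eucl d)} (hΩ : Bornology.IsBounded Ω) (hΩo : IsOpen Ω)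
    (hp : IsPolyhedral Ω) (hd : 0 < d) (D : ℕ → Discretisation Ω)
    (hD : Tendsto (fun n => (D n).size) atTop (𝓝 0)) (v : ∀ n, (D n).X)
    (hv : ∀ n, (D n).MemX0 (v n)) {C : ℝ} (hC : ∀ n, (D n).normX (v n) ≤ C) :
    ∃ (χ : ℕ → ℕ) (u : Eucl d → ℝ) (G : Eucl d → Eucl d), StrictMono χ ∧ MemH10 Ω u G ∧
      Tendsto (fun n => eLpNorm (fun x => (D (χ n)).piM (v (χ n)) x - u x) 2 (volume.restrict Ω))
        atTop (𝓝 0) := by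
  obtain ⟨χ, u, hχ, hu, h0, hlim⟩ := exists_subseq_tendsto_piM hΩ hΩo hd D v hv hC
  have hC0 : 0 ≤ C := ((D 0).normX_nonneg (v 0)).trans (hC 0)
  have hA : ∀ η : Eucl d, ∫⁻ x, ‖u (x + η) - u x‖ₑ ^ 2 ≤
      ENNReal.ofReal ((C * √(2 * d) * ‖η‖) ^ 2) := fun η => by
    have h1 := eLpNorm_translate_sub_le_of_tendsto hΩ hΩo hd (fun n => D (χ n))
      (hD.comp hχ.tendsto_atTop) (fun n => v (χ n)) (fun n => hv _) (fun n => hC _) hu h0 hlim η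
    rwa [eLpNorm_two_le_iff, ← ENNReal.ofReal_pow
      (mul_nonneg (mul_nonneg hC0 (Real.sqrt_nonneg _)) (norm_nonneg _))] at h1
  obtain ⟨φ, B, hφ, hB, hφu⟩ := exists_testFunction_tendsto hd hΩ hp hu h0 hA
  have hres : ∀ {κ : Type} {l : Filter κ} {g : κ → Eucl d → ℝ},
      Tendsto (fun n => eLpNorm (g n) 2) l (𝓝 0) →
      Tendsto (fun n => eLpNorm (g n) 2 (volume.restrict Ω)) l (𝓝 0) := fun h =>
    tendsto_of_tendsto_of_tendsto_of_le_of_le tendsto_const_nhds h (fun _ => zero_le)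
      fun n => eLpNorm_mono_measure _ Measure.restrict_le_self
  obtain ⟨G, hG⟩ := exists_memH10_of_tendsto hφ hB (hu.restrict Ω) (hres hφu)
  exact ⟨χ, u, G, hχ, hG, hres hlim⟩

/-- Both sides are continuous in the test pair for the `H¹` norm, so density suffices. Symmetry of
the tensor reconciles the order of the arguments with the one produced by consistency. -/
theorem isWeakSolution_of_testFunction {Ω : Set (Eucl d)}
    {Λ : Eucl d → Matrix (Fin d) (Fin d) ℝ} {lo hi : ℝ} (hΛ : IsDiffusionTensor Ω Λ lo hi)
    (hlo : 0 ≤ lo) (hlh : lo ≤ hi) {f u : Eucl d → ℝ} {G : Eucl d → Eucl d}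
    (hf : MemLp f 2 (volume.restrict Ω)) (hu : MemH10 Ω u G)
    (h : ∀ φ, IsTestFunction Ω φ → energy Ω Λ (gradient φ) G = ∫ x in Ω, φ x * f x) :
    IsWeakSolution Ω Λ f u G := by
  refine ⟨hu, fun v H hv => ?_⟩
  obtain ⟨φ, hφ, h1, h2⟩ := hv.approx
  have t1 := tendsto_integral_mul_of_eLpNorm (fun n => (hφ n).memLp.restrict Ω) hv.memLp hf h1
  have t2 := tendsto_integral_mul_inner_of_eLpNorm (fun n => (hφ n).memLp_gradient.restrict Ω)
    hv.memLp_grad (hΛ.memLp hlo hlh hu.memLp_grad) h2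
  have e : ∀ n, ∫ x in Ω, ⟪gradient (φ n) x, Matrix.toEuclideanLin (Λ x) (G x)⟫ =
      ∫ x in Ω, φ n x * f x := fun n => by
    rw [← h _ (hφ n), energy_comm hΛ]
    exact integral_congr_ae (Eventually.of_forall fun x => real_inner_comm _ _)
  simp_rw [e] at t2
  calc energy Ω Λ G H = ∫ x in Ω, ⟪H x, Matrix.toEuclideanLin (Λ x) (G x)⟫ :=
        integral_congr_ae (Eventually.of_forall fun x => real_inner_comm _ _)
    _ = ∫ x in Ω, v x * f x := tendsto_nhds_unique t2 t1
    _ = _ := integral_congr_ae (Eventually.of_forall fun x => mul_comm _ _)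

/-- The left-hand side is the quadratic form of `Λ` at `P - G`, expanded by symmetry. -/
theorem energy_sub_le {Ω : Set (Eucl d)} {Λ : Eucl d → Matrix (Fin d) (Fin d) ℝ} {lo hi : ℝ}
    (hΛ : IsDiffusionTensor Ω Λ lo hi) (hlo : 0 ≤ lo) (hlh : lo ≤ hi) {G P : Eucl d → Eucl d}
    (hG : MemLp G 2 (volume.restrict Ω)) (hP : MemLp P 2 (volume.restrict Ω)) {δ : ℝ} (hδ : 0 ≤ δ)
    (h : eLpNorm (fun x => P x - G x) 2 (volume.restrict Ω) ≤ ENNReal.ofReal δ) :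
    energy Ω Λ G G - 2 * energy Ω Λ G P + energy Ω Λ P P ≤ ‖tensorMap hΛ hlo hlh‖ * δ ^ 2 := by
  have hn : ‖hP.toLp P - hG.toLp G‖ ≤ δ := by
    rw [← MemLp.toLp_sub, Lp.norm_toLp]
    exact ENNReal.toReal_le_of_le_ofReal hδ h
  have e : energy Ω Λ G G - 2 * energy Ω Λ G P + energy Ω Λ P P =
      ⟪tensorMap hΛ hlo hlh (hP.toLp P - hG.toLp G), hP.toLp P - hG.toLp G⟫ := by
    rw [map_sub, inner_sub_left, inner_sub_right, inner_sub_right, ← energy_eq_inner,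
      ← energy_eq_inner, ← energy_eq_inner, ← energy_eq_inner, energy_comm hΛ P G]
    ring
  rw [e]
  generalize hP.toLp P - hG.toLp G = g at hn
  generalize tensorMap hΛ hlo hlh = T
  calc ⟪T g, g⟫ ≤ ‖T g‖ * ‖g‖ := real_inner_le_norm _ _
    _ ≤ ‖T‖ * ‖g‖ * ‖g‖ := mul_le_mul_of_nonneg_right (T.le_opNorm g) (norm_nonneg _)
    _ = ‖T‖ * ‖g‖ ^ 2 := by ring
    _ ≤ ‖T‖ * δ ^ 2 := mul_le_mul_of_nonneg_left (pow_le_pow_left₀ (norm_nonneg _) hn 2)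
        (norm_nonneg _)

section

variable {Ω : Set (Eucl d)} {ι : Type*} {D : ι → Discretisation Ω}

theorem tendsto_normX_interpB_sub (hΩ : Bornology.IsBounded Ω) (hd : 0 < d)
    {B : ∀ i, Set (D i).Edge} {β : ∀ i, (D i).Edge → (D i).Vol → ℝ}
    (hβ : ∀ i, (D i).IsBarycentric (B i) (β i)) {θ : ℝ} (hθ : 0 ≤ θ)
    (hreg : ∀ i, (D i).thetaB (B i) (β i) ≤ θ) {φ : Eucl d → ℝ} (hφ : IsTestFunction Ω φ) :
    Tendsto (fun i => (D i).normX ((D i).interpB (B i) (β i) φ - (D i).interp φ)) (sizeToZero D)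
      (𝓝 0) := by
  obtain ⟨M, hM⟩ := hφ.exists_hasTaylorBound
  refine squeeze_zero (fun i => (D i).normX_nonneg _)
    (fun i => (D i).normX_interpB_sub_interp_le hΩ hd hθ (hreg i) (hβ i) hM) ?_
  simpa using (tendsto_size_sizeToZero D).const_mul (M * θ ^ 2 * √(d * volume.real Ω))

/-- The scheme tested against interpolations of test functions. -/
theorem tendsto_fluxForm_interp (hΩ : Bornology.IsBounded Ω) (hΩo : IsOpen Ω) (hd : 0 < d)
    {f : Eucl d → ℝ} (hf : MemLp f 2 (volume.restrict Ω))
    {B : ∀ i, Set (D i).Edge} (hB : ∀ i, B i ⊆ (D i).intEdges)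
    {β : ∀ i, (D i).Edge → (D i).Vol → ℝ} (hβ : ∀ i, (D i).IsBarycentric (B i) (β i)) {θ : ℝ}
    (hθ : 0 ≤ θ) (hreg : ∀ i, (D i).thetaB (B i) (β i) ≤ θ) {F : FluxFamily D}
    (hcont : F.IsContinuous) {uD : ∀ i, (D i).X} {C : ℝ} (hC : ∀ i, (D i).normX (uD i) ≤ C)
    (huD : ∀ i, (D i).IsSchemeSolution (B i) (β i) (F i) f (uD i)) {φ : Eucl d → ℝ}
    (hφ : IsTestFunction Ω φ) :
    Tendsto (fun i => (D i).fluxForm (F i) (uD i) ((D i).interp φ)) (sizeToZero D)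
      (𝓝 (∫ x in Ω, φ x * f x)) := by
  obtain ⟨M, hM0, hM⟩ := hcont
  have t1 : Tendsto (fun i => ∫ x in Ω, (D i).piM ((D i).interp φ) x * f x) (sizeToZero D)
      (𝓝 (∫ x in Ω, φ x * f x)) :=
    tendsto_integral_mul_of_eLpNorm (fun i => ((D i).memLp_piM hΩ hΩo _).restrict Ω)
      (hφ.memLp.restrict Ω) hf (tendsto_piM_interp D hΩ hΩo hφ)
  have t2 : Tendsto (fun i => (D i).fluxForm (F i) (uD i)
      ((D i).interpB (B i) (β i) φ - (D i).interp φ)) (sizeToZero D) (𝓝 0) := by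
    refine squeeze_zero_norm (a := fun i =>
      M * C * (D i).normX ((D i).interpB (B i) (β i) φ - (D i).interp φ)) (fun i => ?_) ?_
    · refine ((D i).abs_fluxForm_le (F i) (hM i) _ _).trans ?_
      have := (D i).normX_nonneg ((D i).interpB (B i) (β i) φ - (D i).interp φ)
      gcongr
      exact hC i
    · simpa using (tendsto_normX_interpB_sub hΩ hd hβ hθ hreg hφ).const_mul (M * C)
  have t3 := t1.sub t2
  rw [sub_zero] at t3
  refine t3.congr' ?_
  filter_upwards [eventually_memX0_interp D hΩ hΩo hφ] with i hi
  have h1 := (huD i).2 _ ((D i).interpB_memXB (hB i) (β i) hi)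
  rw [(D i).sum_mul_setIntegral_eq hΩ hf] at h1
  have h2 : (D i).piM ((D i).interpB (B i) (β i) φ) = (D i).piM ((D i).interp φ) := rfl
  rw [(D i).fluxForm_sub_right, h1, h2, sub_sub_cancel]

/-- Convergence of the approximate solutions in `L²(Ω)`. -/
theorem tendsto_piM_of_isSchemeSolution (hΩ : Bornology.IsBounded Ω) (hΩo : IsOpen Ω)
    (hne : Ω.Nonempty) (hp : IsPolyhedral Ω) (hd : 0 < d)
    {Λ : Eucl d → Matrix (Fin d) (Fin d) ℝ} {lo hi : ℝ} (hΛ : IsDiffusionTensor Ω Λ lo hi)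
    (hlo : 0 < lo) (hlh : lo ≤ hi) {f : Eucl d → ℝ} (hf : MemLp f 2 (volume.restrict Ω))
    {B : ∀ i, Set (D i).Edge} (hB : ∀ i, B i ⊆ (D i).intEdges)
    {β : ∀ i, (D i).Edge → (D i).Vol → ℝ} (hβ : ∀ i, (D i).IsBarycentric (B i) (β i)) {θ : ℝ}
    (hθ : 0 ≤ θ) (hreg : ∀ i, (D i).thetaB (B i) (β i) ≤ θ) {F : FluxFamily D}
    (hcont : F.IsContinuous) (hcons : F.IsConsistent Λ) {uD : ∀ i, (D i).X} {C : ℝ}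
    (hC : ∀ i, (D i).normX (uD i) ≤ C)
    (huD : ∀ i, (D i).IsSchemeSolution (B i) (β i) (F i) f (uD i))
    {u : Eucl d → ℝ} {G : Eucl d → Eucl d} (hu : IsWeakSolution Ω Λ f u G) :
    Tendsto (fun i => eLpNorm (fun x => (D i).piM (uD i) x - u x) 2 (volume.restrict Ω))
      (sizeToZero D) (𝓝 0) := by
  classical
  refine tendsto_of_subseq_tendsto fun ns hns => ?_
  have hsz : Tendsto (fun n => (D (ns n)).size) atTop (𝓝 0) :=
    (tendsto_size_sizeToZero D).comp hns
  obtain ⟨χ, w, H, hχ, hw, hlim⟩ := exists_subseq_memH10 hΩ hΩo hp hd (fun n => D (ns n)) hsz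
    (fun n => uD (ns n)) (fun n => (huD _).1.1) (fun n => hC _)
  refine ⟨χ, ?_⟩
  obtain ⟨r, C', hr0, hrC, hrlim⟩ := exists_recovery D hΩ hΩo hne hd
    (fun i K σ hσ => (D i).diam_le_theta (hreg i) hσ) hw
  -- Consistency concerns families indexed by all meshes and limits as `h → 0`, not subsequences.
  -- The scheme solutions are kept on the subsequence, and all other indices are filled with a
  -- recovery of the limit `w`.
  set W : ∀ i, (D i).X := fun i => if ∃ n, i = ns (χ n) then uD i else r i with hW
  have hWn : ∀ n, W (ns (χ n)) = uD (ns (χ n)) := fun n => if_pos ⟨n, rfl⟩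
  have hWlim : Tendsto (fun i => eLpNorm (fun x => (D i).piM (W i) x - w x) 2 (volume.restrict Ω))
      (sizeToZero D) (𝓝 0) := by
    rw [ENNReal.tendsto_nhds_zero]
    intro ε hε
    obtain ⟨N, hN⟩ := eventually_atTop.1 ((ENNReal.tendsto_nhds_zero.1 hlim) ε hε)
    -- The first `N` meshes of the subsequence have sizes bounded below by some `δ > 0`; so `h < δ`
    -- forces an index of the subsequence to come from `n ≥ N`.
    obtain ⟨δ, hδ, hδN⟩ : ∃ δ : ℝ, 0 < δ ∧ ∀ n < N, δ ≤ (D (ns (χ n))).size := by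
      rcases Nat.eq_zero_or_pos N with h0 | h0
      · exact ⟨1, one_pos, fun n hn => by omega⟩
      · refine ⟨(Finset.range N).inf' ⟨0, by simpa using h0⟩ fun n => (D (ns (χ n))).size,
          (Finset.lt_inf'_iff _).2 fun n _ => (D _).size_pos hΩ hd hne, fun n hn =>
          Finset.inf'_le _ (by simpa using hn)⟩
    filter_upwards [(ENNReal.tendsto_nhds_zero.1 hrlim) ε hε,
      (tendsto_size_sizeToZero D).eventually (gt_mem_nhds hδ)] with i h1 h2
    by_cases hi : ∃ n, i = ns (χ n)
    · obtain ⟨n, rfl⟩ := hi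
      rw [hWn]
      refine hN n ?_
      by_contra hlt
      exact absurd (hδN n (not_le.1 hlt)) (not_le.2 h2)
    · rw [hW]
      simp only [if_neg hi]
      exact h1
  have hW0 : ∀ i, (D i).MemX0 (W i) := fun i => by
    by_cases hi : ∃ n, i = ns (χ n)
    · rw [hW]; simp only [if_pos hi]; exact (huD i).1.1
    · rw [hW]; simp only [if_neg hi]; exact hr0 i
  have hWC : ∃ c : ℝ, 0 < c ∧ ∀ i, (D i).normX (W i) ≤ c := by
    refine ⟨max 1 (max C C'), by positivity, fun i => ?_⟩
    by_cases hi : ∃ n, i = ns (χ n)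
    · rw [hW]; simp only [if_pos hi]
      exact (hC i).trans ((le_max_left _ _).trans (le_max_right _ _))
    · rw [hW]; simp only [if_neg hi]
      exact (hrC i).trans ((le_max_right _ _).trans (le_max_right _ _))
  have hsub : Tendsto (fun n => ns (χ n)) atTop (sizeToZero D) := hns.comp hχ.tendsto_atTop
  have hws : IsWeakSolution Ω Λ f w H := by
    refine isWeakSolution_of_testFunction hΛ hlo.le hlh hf hw fun φ hφ => ?_
    have h1 := (hcons W w H hW0 hWC hw hWlim φ hφ).comp hsub
    have h2 := (tendsto_fluxForm_interp hΩ hΩo hd hf hB hβ hθ hreg hcont hC huD hφ).comp hsub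
    refine tendsto_nhds_unique h1 (h2.congr fun n => ?_)
    simp only [Function.comp_apply, hWn]
  -- The limit of the subsequence is a weak solution, so by uniqueness it equals `u`, whichever
  -- subsequence was extracted.
  have hae := (hws.ae_eq hd hΩ hΛ hlo hlh hu).1
  refine hlim.congr fun n => eLpNorm_congr_ae ?_
  filter_upwards [hae] with x hx
  rw [hx]

/-- Energy estimate for the difference between the approximate solution and an interpolation. -/
theorem exists_tendsto_energy_bound (hΩ : Bornology.IsBounded Ω) (hΩo : IsOpen Ω) (hd : 0 < d)
    {Λ : Eucl d → Matrix (Fin d) (Fin d) ℝ}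
    {f : Eucl d → ℝ} (hf : MemLp f 2 (volume.restrict Ω))
    {B : ∀ i, Set (D i).Edge} (hB : ∀ i, B i ⊆ (D i).intEdges)
    {β : ∀ i, (D i).Edge → (D i).Vol → ℝ} (hβ : ∀ i, (D i).IsBarycentric (B i) (β i)) {θ : ℝ}
    (hθ : 0 ≤ θ) (hreg : ∀ i, (D i).thetaB (B i) (β i) ≤ θ) {F : FluxFamily D}
    (hcont : F.IsContinuous) {α : ℝ}
    (hcoer : ∀ i, ∀ v : (D i).X, α * (D i).normX v ^ 2 ≤ (D i).fluxForm (F i) v v)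
    (hsymm : F.IsSymmetric) (hcons : F.IsConsistent Λ) {uD : ∀ i, (D i).X}
    (huD : ∀ i, (D i).IsSchemeSolution (B i) (β i) (F i) f (uD i))
    {u : Eucl d → ℝ} (hu : MemLp u 2 (volume.restrict Ω))
    (hlim : Tendsto (fun i => eLpNorm (fun x => (D i).piM (uD i) x - u x) 2 (volume.restrict Ω))
      (sizeToZero D) (𝓝 0)) {φ : Eucl d → ℝ} (hφ : IsTestFunction Ω φ) :
    ∃ a : ι → ℝ, Tendsto a (sizeToZero D) (𝓝 ((∫ x in Ω, u x * f x) -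
        2 * (∫ x in Ω, φ x * f x) + energy Ω Λ (gradient φ) (gradient φ))) ∧
      ∀ᶠ i in sizeToZero D,
        α * (D i).normX (uD i - (D i).interpB (B i) (β i) φ) ^ 2 ≤ a i := by
  classical
  obtain ⟨M, hM0, hM⟩ := hcont
  have hreg' : ∀ i, ∀ K, ∀ σ ∈ (D i).edges K, (D i).diam K ≤ θ * (D i).dist K σ :=
    fun i K σ hσ => (D i).diam_le_theta (hreg i) hσ
  set P : ∀ i, (D i).X := fun i => (D i).interp φ
  set PB : ∀ i, (D i).X := fun i => (D i).interpB (B i) (β i) φ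
  set A := √(2 * d * θ ^ 2 * (2 * (∫ x in Ω, ‖gradient φ x‖ ^ 2) + 1))
  have hPA : ∀ᶠ i in sizeToZero D, (D i).normX (P i) ≤ A :=
    eventually_normX_interp_le D hΩ hd hreg' hφ le_rfl
  have hP0 : ∀ᶠ i in sizeToZero D, (D i).MemX0 (P i) := eventually_memX0_interp D hΩ hΩo hφ
  -- consistency for the interpolations
  set W : ∀ i, (D i).X := fun i => if (D i).MemX0 (P i) ∧ (D i).normX (P i) ≤ A then P i else 0
  have hWP : ∀ᶠ i in sizeToZero D, W i = P i := by
    filter_upwards [hPA, hP0] with i h1 h2 using if_pos ⟨h2, h1⟩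
  have hPP : Tendsto (fun i => (D i).fluxForm (F i) (P i) (P i)) (sizeToZero D)
      (𝓝 (energy Ω Λ (gradient φ) (gradient φ))) := by
    have h1 := hcons W φ (gradient φ) (fun i => ?_) ⟨max 1 A, by positivity, fun i => ?_⟩
      hφ.memH10 ?_ φ hφ
    · refine h1.congr' ?_
      filter_upwards [hWP] with i hi
      rw [hi]
    · by_cases hi : (D i).MemX0 (P i) ∧ (D i).normX (P i) ≤ A
      · simp only [W, if_pos hi]; exact hi.1
      · simp only [W, if_neg hi]; exact fun σ _ => rfl
    · by_cases hi : (D i).MemX0 (P i) ∧ (D i).normX (P i) ≤ A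
      · simp only [W, if_pos hi]; exact hi.2.trans (le_max_right _ _)
      · simp only [W, if_neg hi]
        refine le_trans ?_ (le_max_left _ _)
        simp [Discretisation.normX]
    · refine (tendsto_piM_interp D hΩ hΩo hφ).congr' ?_
      filter_upwards [hWP] with i hi
      rw [hi]
  have hδ : Tendsto (fun i => (D i).normX (PB i - P i)) (sizeToZero D) (𝓝 0) :=
    tendsto_normX_interpB_sub hΩ hd hβ hθ hreg hφ
  have hPBPB : Tendsto (fun i => (D i).fluxForm (F i) (PB i) (PB i)) (sizeToZero D)
      (𝓝 (energy Ω Λ (gradient φ) (gradient φ))) := by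
    have hdiff : Tendsto (fun i => (D i).fluxForm (F i) (PB i) (PB i) -
        (D i).fluxForm (F i) (P i) (P i)) (sizeToZero D) (𝓝 0) := by
      refine squeeze_zero_norm' (a := fun i => M * (D i).normX (PB i - P i) ^ 2 +
        2 * (M * A * (D i).normX (PB i - P i))) ?_ ?_
      · filter_upwards [hPA] with i hi
        -- Quadratic expansion around `P i`, symmetry merging the two cross terms; every term
        -- contains the vanishing norm of `PB i - P i`.
        have e1 : (D i).fluxForm (F i) (PB i) (PB i) - (D i).fluxForm (F i) (P i) (P i) =
            (D i).fluxForm (F i) (PB i - P i) (PB i - P i) +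
              2 * (D i).fluxForm (F i) (P i) (PB i - P i) := by
          simp only [Discretisation.fluxForm_sub_left, Discretisation.fluxForm_sub_right]
          rw [hsymm i (PB i) (P i)]
          ring
        have b1 := (D i).abs_fluxForm_le (F i) (hM i) (PB i - P i) (PB i - P i)
        have b2 := (D i).abs_fluxForm_le (F i) (hM i) (P i) (PB i - P i)
        have h0 := (D i).normX_nonneg (PB i - P i)
        have b3 : M * (D i).normX (P i) * (D i).normX (PB i - P i) ≤
            M * A * (D i).normX (PB i - P i) := by gcongr
        rw [e1, Real.norm_eq_abs]
        refine (abs_add_le _ _).trans ?_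
        rw [abs_mul, abs_two]
        nlinarith
      · simpa using ((hδ.pow 2).const_mul M).add ((hδ.const_mul (M * A)).const_mul 2)
    simpa using hdiff.add hPP
  have hfu : Tendsto (fun i => ∫ x in Ω, (D i).piM (uD i) x * f x) (sizeToZero D)
      (𝓝 (∫ x in Ω, u x * f x)) :=
    tendsto_integral_mul_of_eLpNorm (fun i => ((D i).memLp_piM hΩ hΩo _).restrict Ω) hu hf hlim
  have hfφ : Tendsto (fun i => ∫ x in Ω, (D i).piM (P i) x * f x) (sizeToZero D)
      (𝓝 (∫ x in Ω, φ x * f x)) :=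
    tendsto_integral_mul_of_eLpNorm (fun i => ((D i).memLp_piM hΩ hΩo _).restrict Ω)
      (hφ.memLp.restrict Ω) hf (tendsto_piM_interp D hΩ hΩo hφ)
  refine ⟨_, (hfu.sub (hfφ.const_mul 2)).add hPBPB, ?_⟩
  filter_upwards [hP0] with i hi
  have h1 := (huD i).2 _ ((D i).interpB_memXB (hB i) (β i) hi)
  have h2 := (huD i).2 _ (huD i).1
  rw [(D i).sum_mul_setIntegral_eq hΩ hf] at h1 h2
  have h3 : (D i).piM ((D i).interpB (B i) (β i) φ) = (D i).piM (P i) := rfl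
  rw [h3] at h1
  -- The form is expanded at the difference: the scheme evaluates `⟨u_D,u_D⟩` and, the corrected
  -- interpolant being admissible, also both cross terms by symmetry.
  refine (hcoer i _).trans (le_of_eq ?_)
  rw [(D i).fluxForm_sub_left, (D i).fluxForm_sub_right, (D i).fluxForm_sub_right,
    hsymm i ((D i).interpB (B i) (β i) φ) (uD i), h1, h2]
  ring

/-- Convergence of the discrete gradients in `L²(Ω)^d`. -/
theorem tendsto_grad_of_tendsto_piM (hΩ : Bornology.IsBounded Ω) (hΩo : IsOpen Ω) (hd : 0 < d)
    {Λ : Eucl d → Matrix (Fin d) (Fin d) ℝ} {lo hi : ℝ} (hΛ : IsDiffusionTensor Ω Λ lo hi)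
    (hlo : 0 ≤ lo) (hlh : lo ≤ hi) {f : Eucl d → ℝ} (hf : MemLp f 2 (volume.restrict Ω))
    {B : ∀ i, Set (D i).Edge} (hB : ∀ i, B i ⊆ (D i).intEdges)
    {β : ∀ i, (D i).Edge → (D i).Vol → ℝ} (hβ : ∀ i, (D i).IsBarycentric (B i) (β i)) {θ : ℝ}
    (hθ : 0 ≤ θ) (hreg : ∀ i, (D i).thetaB (B i) (β i) ≤ θ) {F : FluxFamily D}
    (hcont : F.IsContinuous) (hcoer : F.IsCoercive) (hsymm : F.IsSymmetric)
    (hcons : F.IsConsistent Λ) {uD : ∀ i, (D i).X}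
    (huD : ∀ i, (D i).IsSchemeSolution (B i) (β i) (F i) f (uD i))
    {u : Eucl d → ℝ} {G : Eucl d → Eucl d} (hu : IsWeakSolution Ω Λ f u G)
    (hlim : Tendsto (fun i => eLpNorm (fun x => (D i).piM (uD i) x - u x) 2 (volume.restrict Ω))
      (sizeToZero D) (𝓝 0)) :
    Tendsto (fun i => eLpNorm (fun x => (D i).grad (uD i) x - G x) 2 (volume.restrict Ω))
      (sizeToZero D) (𝓝 0) := by
  obtain ⟨α, hα, hco⟩ := hcoer
  have hreg' : ∀ i, ∀ K, ∀ σ ∈ (D i).edges K, (D i).diam K ≤ θ * (D i).dist K σ :=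
    fun i K σ hσ => (D i).diam_le_theta (hreg i) hσ
  have hT0 : 0 ≤ ‖tensorMap hΛ hlo hlh‖ := norm_nonneg _
  have hT := fun {P : Eucl d → Eucl d} (hP : MemLp P 2 (volume.restrict Ω)) =>
    fun {δ : ℝ} (hδ : 0 ≤ δ) => energy_sub_le hΛ hlo hlh hu.1.memLp_grad hP hδ
  generalize ‖tensorMap hΛ hlo hlh‖ = t at hT hT0
  set c := √(4 + 2 * d + 4 * d ^ 2 * θ ^ 2)
  set κ := √((t + 1) / α)
  have hc0 : 0 ≤ c := Real.sqrt_nonneg _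
  have hκ0 : 0 ≤ κ := Real.sqrt_nonneg _
  have key : ∀ δ : ℝ, 0 < δ → ∀ᶠ i in sizeToZero D,
      eLpNorm (fun x => (D i).grad (uD i) x - G x) 2 (volume.restrict Ω) ≤
        ENNReal.ofReal ((c * κ + c + 2) * δ) := by
    intro δ hδ
    obtain ⟨ψ, hψ, -, hψG⟩ := hu.1.approx
    have hδ' : 0 < ENNReal.ofReal δ := ENNReal.ofReal_pos.2 hδ
    obtain ⟨n, hn⟩ := ((ENNReal.tendsto_nhds_zero.1 hψG) _ hδ').exists
    have hφ := hψ n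
    generalize ψ n = φ at hn hφ
    have hpL := hφ.memLp_gradient.restrict Ω
    obtain ⟨a, ha, hale⟩ := exists_tendsto_energy_bound hΩ hΩo hd hf hB hβ hθ hreg hcont hco hsymm
      hcons huD hu.1.memLp hlim hφ
    -- Testing the weak formulation with `u` and with `φ` turns the limit of the error bound into
    -- the `Λ`-energy of `u - φ`.
    have e1 : ∫ x in Ω, u x * f x = energy Ω Λ G G := by
      rw [hu.2 u G hu.1]
      exact integral_congr_ae (Eventually.of_forall fun x => mul_comm _ _)
    have e2 : ∫ x in Ω, φ x * f x = energy Ω Λ G (gradient φ) := by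
      rw [hu.2 φ _ hφ.memH10]
      exact integral_congr_ae (Eventually.of_forall fun x => mul_comm _ _)
    rw [e1, e2] at ha
    -- Using `t + 1` instead of the operator norm `t` makes the inequality strict, so it persists
    -- for `h` small.
    have hq : energy Ω Λ G G - 2 * energy Ω Λ G (gradient φ) +
        energy Ω Λ (gradient φ) (gradient φ) < (t + 1) * δ ^ 2 := by
      have := hT hpL hδ.le hn
      have := pow_pos hδ 2
      linarith
    filter_upwards [hale, ha.eventually (gt_mem_nhds hq),
      (tendsto_normX_interpB_sub hΩ hd hβ hθ hreg hφ).eventually (gt_mem_nhds hδ),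
      (ENNReal.tendsto_nhds_zero.1 (tendsto_grad_interp D hΩ hΩo hd hθ hreg' hφ)) _ hδ']
      with i h1 h2 h3 h4
    have h5 : (D i).normX (uD i - (D i).interpB (B i) (β i) φ) ≤ κ * δ := by
      refine le_of_sq_le_sq ?_ (mul_nonneg hκ0 hδ.le)
      rw [mul_pow, Real.sq_sqrt (div_nonneg (by linarith) hα.le), div_mul_eq_mul_div,
        le_div_iff₀ hα, mul_comm]
      exact h1.trans h2.le
    have b1 := ((D i).eLpNorm_grad_le hΩ hd (hreg' i)
      (uD i - (D i).interpB (B i) (β i) φ)).trans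
        (ENNReal.ofReal_le_ofReal (mul_le_mul_of_nonneg_left h5 hc0))
    have b2 := ((D i).eLpNorm_grad_le hΩ hd (hreg' i)
      ((D i).interpB (B i) (β i) φ - (D i).interp φ)).trans
        (ENNReal.ofReal_le_ofReal (mul_le_mul_of_nonneg_left h3.le hc0))
    -- Four errors: scheme against corrected interpolant (coercivity), corrected against plain
    -- interpolant, consistency of the discrete gradient on `φ`, and density of test functions. The
    -- first two are controlled by `|·|_X` through the constant `c`.
    have e : (fun x => (D i).grad (uD i) x - G x) =
        ((D i).grad (uD i - (D i).interpB (B i) (β i) φ) +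
          (D i).grad ((D i).interpB (B i) (β i) φ - (D i).interp φ)) +
        ((fun x => (D i).grad ((D i).interp φ) x - gradient φ x) +
          fun x => gradient φ x - G x) := by
      funext x
      simp only [Pi.add_apply, (D i).grad_sub]
      abel
    have m1 := ((D i).memLp_grad hΩ
      (uD i - (D i).interpB (B i) (β i) φ)).aestronglyMeasurable
    have m2 := ((D i).memLp_grad hΩ
      ((D i).interpB (B i) (β i) φ - (D i).interp φ)).aestronglyMeasurable
    have m3 := (((D i).memLp_grad hΩ ((D i).interp φ)).sub hpL).aestronglyMeasurable
    have m4 := (hpL.sub hu.1.memLp_grad).aestronglyMeasurable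
    rw [e]
    calc _ ≤ (ENNReal.ofReal (c * (κ * δ)) + ENNReal.ofReal (c * δ)) +
          (ENNReal.ofReal δ + ENNReal.ofReal δ) :=
        (eLpNorm_add_le (m1.add m2) (m3.add m4) one_le_two).trans (add_le_add
          ((eLpNorm_add_le m1 m2 one_le_two).trans (add_le_add b1 b2))
          ((eLpNorm_add_le m3 m4 one_le_two).trans (add_le_add h4 hn)))
      _ = ENNReal.ofReal ((c * κ + c + 2) * δ) := by
        have p1 : 0 ≤ c * (κ * δ) := mul_nonneg hc0 (mul_nonneg hκ0 hδ.le)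
        have p2 : 0 ≤ c * δ := mul_nonneg hc0 hδ.le
        rw [← ENNReal.ofReal_add p1 p2, ← ENNReal.ofReal_add hδ.le hδ.le,
          ← ENNReal.ofReal_add (add_nonneg p1 p2) (add_nonneg hδ.le hδ.le)]
        congr 1
        ring
  rw [ENNReal.tendsto_nhds_zero]
  intro ε hε
  by_cases hε' : ε = ⊤
  · exact Eventually.of_forall fun i => hε' ▸ le_top
  have hC : 0 < c * κ + c + 2 := by positivity
  filter_upwards [key (ε.toReal / (c * κ + c + 2)) (div_pos (ENNReal.toReal_pos hε.ne' hε') hC)]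
    with i hi
  rwa [mul_div_cancel₀ _ hC.ne', ENNReal.ofReal_toReal hε'] at hi

end

end HybridFV
theorem theorem4p1 {d : ℕ} (hd : 0 < d)
    (Ω : Set (HybridFV.Eucl d)) (hΩo : IsOpen Ω) (hΩb : Bornology.IsBounded Ω)
    (hΩc : IsConnected Ω) (hΩp : HybridFV.IsPolyhedral Ω)
    (Λ : HybridFV.Eucl d → Matrix (Fin d) (Fin d) ℝ) (lo hi : ℝ) (hlo : 0 < lo) (hlohi : lo ≤ hi)
    (hΛ : HybridFV.IsDiffusionTensor Ω Λ lo hi)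
    (f : HybridFV.Eucl d → ℝ) (hf : MemLp f 2 (volume.restrict Ω))
    {ι : Type*} (D : ι → HybridFV.Discretisation Ω)
    (B : ∀ i, Set (D i).Edge) (hB : ∀ i, B i ⊆ (D i).intEdges)
    (β : ∀ i, (D i).Edge → (D i).Vol → ℝ) (hβ : ∀ i, (D i).IsBarycentric (B i) (β i))
    (θ : ℝ) (hθ : 0 < θ) (hreg : ∀ i, (D i).thetaB (B i) (β i) ≤ θ)
    (F : HybridFV.FluxFamily D) (hcont : F.IsContinuous) (hcoer : F.IsCoercive)
    (hsymm : F.IsSymmetric) (hcons : F.IsConsistent Λ) :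
    -- the scheme has exactly one solution on each discretisation
    (∀ i, ∃! u, (D i).IsSchemeSolution (B i) (β i) (F i) f u) ∧
    -- existence and uniqueness of the weak solution, and convergence to it
    ∃ (u : HybridFV.Eucl d → ℝ) (G : HybridFV.Eucl d → HybridFV.Eucl d),
      HybridFV.IsWeakSolution Ω Λ f u G ∧
      (∀ u' G', HybridFV.IsWeakSolution Ω Λ f u' G' →
        u' =ᵐ[volume.restrict Ω] u ∧ G' =ᵐ[volume.restrict Ω] G) ∧
      ∀ uD : ∀ i, (D i).X, (∀ i, (D i).IsSchemeSolution (B i) (β i) (F i) f (uD i)) →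
        Tendsto (fun i => eLpNorm (fun x => (D i).piM (uD i) x - u x) 2 (volume.restrict Ω))
          (HybridFV.sizeToZero D) (𝓝 0) ∧
        Tendsto (fun i => eLpNorm (fun x => (D i).grad (uD i) x - G x) 2 (volume.restrict Ω))
          (HybridFV.sizeToZero D) (𝓝 0) := by
  have hcoer' := hcoer
  obtain ⟨α, hα, hco⟩ := hcoer'
  refine ⟨fun i => (D i).existsUnique_isSchemeSolution (F i) hΩb hd (B i) (β i) hα (hco i) f, ?_⟩
  obtain ⟨u, G, hu⟩ := HybridFV.exists_isWeakSolution hd hΩb hΛ hlo hlohi hf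
  refine ⟨u, G, hu, fun u' G' h' => h'.ae_eq hd hΩb hΛ hlo hlohi hu, fun uD huD => ?_⟩
  obtain ⟨C, hC⟩ := HybridFV.Discretisation.exists_normX_le_of_isSchemeSolution hΩb hΩo hd hf hα
  have hlim := HybridFV.tendsto_piM_of_isSchemeSolution hΩb hΩo hΩc.nonempty hΩp hd hΛ hlo hlohi hf
    hB hβ hθ.le hreg hcont hcons (fun i => hC (D i) (F i) (B i) (β i) (uD i) (hco i) (huD i)) huD hu
  exact ⟨hlim, HybridFV.tendsto_grad_of_tendsto_piM hΩb hΩo hd hΛ hlo.le hlohi hf hB hβ hθ.le hreg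
    hcont hcoer hsymm hcons huD hu hlim⟩
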